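/- **Setting.** Let $KB$ be a Bayesian knowledge base with logic program $PB\cup CB$ (its conditional probability tables and combination rule play no role here). $PB$ and $CB$ are finite sets of clauses. $PB\cup CB$ is a Datalog program except for the predicate $member$, whose second argument in $PB$ and in the clauses of $CB$ other than its definition is a list of constants; $CB$ contains the unit clause $true$ and the definition $member(X,[X|L])$, $member(X,[Y|L])\leftarrow member(X,L)$, and no other clauses for these two predicates. Each clause of $PB$ has the form $$A\leftarrow A_1,\dots,A_l,\ true,\ L_1,\dots,L_m,\ member(X_1,DOM_1),\dots,member(X_s,DOM_s),$$ where $A,A_1,\dots,A_l$ are atoms whose predicate symbols do not occur in $CB$, the context $L_1,\dots,L_m$ consists of positive and negative literals, and every variable of $A$ is among $X_1,\dots,X_s$. (A clause with $l=m=s=0$ is a unit clause.) Let $WF(PB\cup CB)=\langle I_t,I_f\rangle$ be the well-founded model. The space of random variables $\mathcal S(KB)$ is the least set of ground atoms that contains all unit clauses of $PB$ and contains $A$ whenever, for some Herbrand ground instance of a clause of $PB$ as above, the literals $L_1,\dots,L_m$ and the type constraints $member(X_i,DOM_i)$ are true in $WF(PB\cup CB)$ and $A_1,\dots,A_l\in\mathcal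 S(KB)$. **Algorithm 1.** Start with $\mathcal S'(KB)=\emptyset$. For each predicate symbol $p_i$ occurring in the head of a clause of $PB$ (in any order), evaluate the goal $\leftarrow p_i(\vec X_i)$, with $\vec X_i$ distinct variables, by SLG-resolution on $PB\cup CB$, and add to $\mathcal S'(KB)$ the table $\mathcal T_{p_i(\vec X_i)}$ of all (unconditional) answers derived for the goal. Finally return $\mathcal S'(KB)$. Here SLG-resolution (Chen and Warren) is tabled evaluation with delaying: starting from the forest that consists of the tree of the goal, the operations new subgoal, program clause resolution, positive return, negative return, delaying, simplification, completion and answer completion are applied in any order until none is applicable; literals are selected by an arbitrary computation rule. The evaluation of a goal *flounders* if, when no operation is applicable any more, a non-ground negative literal is selected in the tree of some subgoal that is not completed. **Theorem.** Let $KB$ be a Bayesian knowledge base and fix any computation rule. Algorithm 1 terminates: it has no infinite run, whatever the order in which the goals and the SLG operations are chosen. Every run in which no evaluation flounders returns a finite set $\mathcal S'(KB)$, and $\mathcal S'(KB)=\mathcal S(KB)$. -/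

import Mathlib

/-! ### Logic programs

Terms are variables (numbered), constants from `C`, and lists built from the empty list and `cons`.
Lists are the only compound terms; they serve as second arguments of `member`.  A predicate symbol
is a name together with an arity. -/

namespace BKB

inductive Term (C : Type*) where
  | var (n : ℕ)
  | const (c : C)
  | nil
  | cons (h t : Term C)

namespace Term

def subst {C : Type*} (σ : ℕ → Term C) : Term C → Term C
  | var n => σ n
  | const c => const c
  | nil => nil
  | cons h t => cons (h.subst σ) (t.subst σ)

def vars {C : Type*} : Term C → Set ℕ
  | var n => {n}
  | const _ => ∅
  | nil => ∅
  | cons h t => h.vars ∪ t.vars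

def consts {C : Type*} : Term C → Set C
  | var _ => ∅
  | const c => {c}
  | nil => ∅
  | cons h t => h.consts ∪ t.consts

/-- A list of constants, as a term. -/
def ofList {C : Type*} : List C → Term C
  | [] => nil
  | c :: l => cons (const c) (ofList l)

/-- Terms of a function-free language: variables and constants. -/
def IsSimple {C : Type*} (t : Term C) : Prop :=
  (∃ n, t = var n) ∨ (∃ c, t = const c)

end Term

/-- Names of predicates: the special names `true` and `member`, and all others. -/
inductive Pred (P : Type*) where
  | truth
  | member
  | user (p : P)

structure Atom (P C : Type*) where
  pred : Pred P
  args : List (Term C)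

namespace Atom

variable {P C : Type*}

/-- The predicate symbol (name and arity) of an atom. -/
def sym (A : Atom P C) : Pred P × ℕ := (A.pred, A.args.length)

def subst (σ : ℕ → Term C) (A : Atom P C) : Atom P C := ⟨A.pred, A.args.map (Term.subst σ)⟩

def vars (A : Atom P C) : Set ℕ := {n | ∃ t ∈ A.args, n ∈ t.vars}

def consts (A : Atom P C) : Set C := {c | ∃ t ∈ A.args, c ∈ t.consts}

def IsGround (A : Atom P C) : Prop := A.vars = ∅

/-- Renaming of variables. -/
def rename (ρ : Equiv.Perm ℕ) (A : Atom P C) : Atom P C := A.subst (fun n => .var (ρ n))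

/-- Equality up to renaming of variables. -/
def IsVariant (A B : Atom P C) : Prop := ∃ ρ : Equiv.Perm ℕ, B = A.rename ρ

/-- `θ` is a most general unifier of `A` and `B`. -/
def IsMGU (θ : ℕ → Term C) (A B : Atom P C) : Prop :=
  A.subst θ = B.subst θ ∧
    ∀ σ : ℕ → Term C, A.subst σ = B.subst σ → ∃ τ : ℕ → Term C, ∀ n, σ n = (θ n).subst τ

/-- The special atom `true`. -/
def truth : Atom P C := ⟨.truth, []⟩

/-- The atom `member(t, l)`. -/
def member (t l : Term C) : Atom P C := ⟨.member, [t, l]⟩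

/-- Atoms allowed in a program that is Datalog except for `member`: no function symbols, except
that the second argument of `member` is a list of constants. -/
def IsDatalog (A : Atom P C) : Prop :=
  (∃ p, A.pred = .user p ∧ ∀ t ∈ A.args, t.IsSimple) ∨ A = truth ∨
    ∃ (t : Term C) (dom : List C), t.IsSimple ∧ A = member t (.ofList dom)

end Atom

inductive Literal (P C : Type*) where
  | pos (A : Atom P C)
  | neg (A : Atom P C)

namespace Literal

variable {P C : Type*}

def atom : Literal P C → Atom P C
  | pos A => A
  | neg A => A

def subst (σ : ℕ → Term C) : Literal P C → Literal P C
  | pos A => pos (A.subst σ)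
  | neg A => neg (A.subst σ)

def rename (ρ : Equiv.Perm ℕ) (L : Literal P C) : Literal P C := L.subst (fun n => .var (ρ n))

end Literal

/-- A clause `head ← body`. -/
structure Clause (P C : Type*) where
  head : Atom P C
  body : List (Literal P C)

namespace Clause

variable {P C : Type*}

/-- The atoms occurring in a clause. -/
def atoms (c : Clause P C) : List (Atom P C) := c.head :: c.body.map Literal.atom

def subst (σ : ℕ → Term C) (c : Clause P C) : Clause P C :=
  ⟨c.head.subst σ, c.body.map (Literal.subst σ)⟩

def rename (ρ : Equiv.Perm ℕ) (c : Clause P C) : Clause P C := c.subst (fun n => .var (ρ n))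

def vars (c : Clause P C) : Set ℕ := {n | ∃ A ∈ c.atoms, n ∈ A.vars}

end Clause

/-! ### Herbrand instances and the well-founded model -/

section WellFounded

variable {P C : Type*}

/-- The Herbrand universe: ground terms over the constants of the program and the list
constructors, which belong to the language of every program considered here. -/
def herbrandUniverse (prog : List (Clause P C)) : Set (Term C) :=
  {t | t.vars = ∅ ∧ ∀ a ∈ t.consts, ∃ c ∈ prog, ∃ A ∈ c.atoms, a ∈ A.consts}

/-- The Herbrand base. -/
def herbrandBase (prog : List (Clause P C)) : Set (Atom P C) :=
  {A | (∃ c ∈ prog, ∃ B ∈ c.atoms, B.sym = A.sym) ∧ ∀ t ∈ A.args, t ∈ herbrandUniverse prog}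

/-- Substitutions of all variables by terms of the Herbrand universe. -/
def IsGrounding (prog : List (Clause P C)) (σ : ℕ → Term C) : Prop :=
  ∀ n, σ n ∈ herbrandUniverse prog

/-- The set of all ground instances of clauses of the program. -/
def groundInstances (prog : List (Clause P C)) : Set (Clause P C) :=
  {g | ∃ c ∈ prog, ∃ σ, IsGrounding prog σ ∧ g = c.subst σ}

/-- A partial interpretation: the set of true atoms and the set of false atoms. -/
abbrev PInterp (P C : Type*) := Set (Atom P C) × Set (Atom P C)

/-- A literal is true in a partial interpretation. -/
def Literal.TrueIn (I : PInterp P C) : Literal P C → Prop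
  | .pos A => A ∈ I.1
  | .neg A => A ∈ I.2

/-- A literal is false in a partial interpretation. -/
def Literal.FalseIn (I : PInterp P C) : Literal P C → Prop
  | .pos A => A ∈ I.2
  | .neg A => A ∈ I.1

/-- `U` is an unfounded set of the program with respect to `I`. -/
def IsUnfounded (prog : List (Clause P C)) (I : PInterp P C) (U : Set (Atom P C)) : Prop :=
  U ⊆ herbrandBase prog ∧
    ∀ g ∈ groundInstances prog, g.head ∈ U →
      ∃ L ∈ g.body, L.FalseIn I ∨ ∃ B ∈ U, L = .pos B

/-- Immediate consequences of the program with respect to `I`. -/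
def immediateConsequences (prog : List (Clause P C)) (I : PInterp P C) : Set (Atom P C) :=
  {A | ∃ g ∈ groundInstances prog, g.head = A ∧ ∀ L ∈ g.body, L.TrueIn I}

/-- The greatest unfounded set with respect to `I`. -/
def greatestUnfounded (prog : List (Clause P C)) (I : PInterp P C) : Set (Atom P C) :=
  ⋃₀ {U | IsUnfounded prog I U}

theorem Literal.TrueIn.mono {I J : PInterp P C} (h : I ≤ J) {L : Literal P C} (hL : L.TrueIn I) :
    L.TrueIn J := by
  cases L with
  | pos A => exact h.1 hL
  | neg A => exact h.2 hL

theorem Literal.FalseIn.mono {I J : PInterp P C} (h : I ≤ J) {L : Literal P C}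
    (hL : L.FalseIn I) : L.FalseIn J := by
  cases L with
  | pos A => exact h.2 hL
  | neg A => exact h.1 hL

/-- The operator `I ↦ (T(I), U(I))` of the well-founded semantics. -/
def wfOperator (prog : List (Clause P C)) : PInterp P C →o PInterp P C where
  toFun I := (immediateConsequences prog I, greatestUnfounded prog I)
  monotone' := by
    intro I J h
    refine ⟨?_, ?_⟩
    · rintro A ⟨g, hg, rfl, hb⟩
      exact ⟨g, hg, rfl, fun L hL => (hb L hL).mono h⟩
    · rintro A ⟨U, ⟨hU, hU'⟩, hA⟩
      refine ⟨U, ⟨hU, fun g hg hgU => ?_⟩, hA⟩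
      obtain ⟨L, hL, hL' | hL'⟩ := hU' g hg hgU
      · exact ⟨L, hL, Or.inl (hL'.mono h)⟩
      · exact ⟨L, hL, Or.inr hL'⟩

/-- The well-founded model `(I_t, I_f)`. -/
def wellFoundedModel (prog : List (Clause P C)) : PInterp P C := (wfOperator prog).lfp

end WellFounded

/-! ### Bayesian knowledge bases -/

/-- A clause
`head ← influences, true, context, member(X₁, DOM₁), …, member(Xₛ, DOMₛ)`;
`types` lists the pairs `(Xᵢ, DOMᵢ)`. -/
structure PBClause (P C : Type*) where
  head : Atom P C
  influences : List (Atom P C)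
  context : List (Literal P C)
  types : List (ℕ × List C)

namespace PBClause

variable {P C : Type*}

/-- The type constraints `member(Xᵢ, DOMᵢ)`. -/
def typeConstraints (c : PBClause P C) : List (Literal P C) :=
  c.types.map fun x => .pos (.member (.var x.1) (.ofList x.2))

def toClause (c : PBClause P C) : Clause P C :=
  ⟨c.head, c.influences.map .pos ++ .pos .truth :: (c.context ++ c.typeConstraints)⟩

/-- Unit clauses; the marker `true` is disregarded. -/
def IsUnit (c : PBClause P C) : Prop := c.influences = [] ∧ c.context = [] ∧ c.types = []

end PBClause

/-- The clauses that define `true` and `member`: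
`true.`, `member(X, [X|L]).` and `member(X, [Y|L]) ← member(X, L).` -/
def builtinClauses (P C : Type*) : List (Clause P C) :=
  [⟨.truth, []⟩,
    ⟨.member (.var 0) (.cons (.var 0) (.var 1)), []⟩,
    ⟨.member (.var 0) (.cons (.var 1) (.var 2)), [.pos (.member (.var 0) (.var 2))]⟩]

/-- The logic program `PB ∪ CB` of a Bayesian knowledge base, Datalog except for `member`.
`CB` consists of the clauses `aux` and of the clauses defining `true` and `member`.  The conditional
probability tables and the combination rule, which are attached to the logic program, enter neither
the space of random variables nor its computation and are left out. -/
structure KnowledgeBase (P C : Type*) where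
  PB : List (PBClause P C)
  aux : List (Clause P C)
  pb_datalog : ∀ c ∈ PB, ∀ A ∈ c.toClause.atoms, A.IsDatalog
  aux_datalog : ∀ c ∈ aux, ∀ A ∈ c.atoms, A.IsDatalog
  aux_head : ∀ c ∈ aux, ∃ p, c.head.pred = .user p
  /-- The predicate symbols of heads and direct influences occur only in `PB`. -/
  only_in_PB : ∀ c ∈ PB, ∀ A ∈ c.head :: c.influences,
    ∀ d ∈ builtinClauses P C ++ aux, ∀ B ∈ d.atoms, B.sym ≠ A.sym
  /-- Every variable of the head has a type constraint. -/
  typed : ∀ c ∈ PB, ∀ n ∈ c.head.vars, ∃ x ∈ c.types, x.1 = n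

namespace KnowledgeBase

variable {P C : Type*}

def CB (KB : KnowledgeBase P C) : List (Clause P C) := builtinClauses P C ++ KB.aux

/-- The logic program `PB ∪ CB`. -/
def program (KB : KnowledgeBase P C) : List (Clause P C) :=
  KB.PB.map PBClause.toClause ++ KB.CB

/-- The predicate symbols occurring in heads of clauses of `PB`. -/
def headSyms (KB : KnowledgeBase P C) : Set (Pred P × ℕ) := {s | ∃ c ∈ KB.PB, c.head.sym = s}

/-- Membership in the space of random variables. -/
inductive IsRandomVariable (KB : KnowledgeBase P C) : Atom P C → Prop
  | unit (c : PBClause P C) (hc : c ∈ KB.PB) (hu : c.IsUnit) : IsRandomVariable KB c.head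
  | derive (c : PBClause P C) (hc : c ∈ KB.PB) (σ : ℕ → Term C) (hσ : IsGrounding KB.program σ)
      (hctx : ∀ L ∈ c.context, (L.subst σ).TrueIn (wellFoundedModel KB.program))
      (htyp : ∀ L ∈ c.typeConstraints, (L.subst σ).TrueIn (wellFoundedModel KB.program))
      (hinf : ∀ A ∈ c.influences, IsRandomVariable KB (A.subst σ)) :
      IsRandomVariable KB (c.head.subst σ)

/-- The space of random variables `S(KB)`. -/
def space (KB : KnowledgeBase P C) : Set (Atom P C) := {A | KB.IsRandomVariable A}

end KnowledgeBase

/-! ### SLG-resolution -/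

section SLG

variable {P C : Type*}

/-- A computation rule: it selects a position in every non-empty goal. -/
structure ComputationRule (P C : Type*) where
  index : List (Literal P C) → ℕ
  index_lt : ∀ G, G ≠ [] → index G < G.length

/-- In the goal `G = G₁, L, G₂` the rule selects the literal `L`. -/
def ComputationRule.Selects (R : ComputationRule P C) (G G₁ : List (Literal P C))
    (L : Literal P C) (G₂ : List (Literal P C)) : Prop :=
  G = G₁ ++ L :: G₂ ∧ R.index G = G₁.length

/-- Delayed literals: a ground negative literal `¬ A`, or a positive literal `A` that was resolved
with a conditional answer with head `ans` from the table of the subgoal `call`. -/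
inductive Delayed (P C : Type*) where
  | neg (A : Atom P C)
  | pos (A call ans : Atom P C)

/-- Substitutions act on the delayed literal itself; `call` and `ans` refer to table entries. -/
def Delayed.subst (σ : ℕ → Term C) : Delayed P C → Delayed P C
  | .neg A => .neg (A.subst σ)
  | .pos A call ans => .pos (A.subst σ) call ans

/-- The atom of a delayed literal. -/
def Delayed.atom : Delayed P C → Atom P C
  | .neg A => A
  | .pos A _ _ => A

/-- A node `head ← delays | goals` of the tree of some subgoal. -/
structure Node (P C : Type*) where
  head : Atom P C
  delays : List (Delayed P C)
  goals : List (Literal P C)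

def Node.vars (N : Node P C) : Set ℕ :=
  N.head.vars ∪ {n | ∃ d ∈ N.delays, n ∈ d.atom.vars} ∪ {n | ∃ L ∈ N.goals, n ∈ L.atom.vars}

/-- Equality of delayed literals, where the answer referred to matters only up to renaming. -/
inductive Delayed.Same : Delayed P C → Delayed P C → Prop
  | neg (A : Atom P C) : Delayed.Same (.neg A) (.neg A)
  | pos (A call ans ans' : Atom P C) (h : ans.IsVariant ans') :
      Delayed.Same (.pos A call ans) (.pos A call ans')

/-- Equality of nodes up to renaming of variables. -/
def Node.IsVariant (N N' : Node P C) : Prop :=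
  ∃ ρ : Equiv.Perm ℕ,
    N'.head = N.head.rename ρ ∧ N'.goals = N.goals.map (Literal.rename ρ) ∧
    List.Forall₂ Delayed.Same (N.delays.map (Delayed.subst fun n => .var (ρ n))) N'.delays

/-- An SLG forest: the subgoals that have a tree, the nodes `(S, N)` generated so far (`N` a
non-root node of the tree of `S`), the nodes that have failed or have been replaced by a successor,
and the subgoals whose trees are marked as completed. -/
structure Forest (P C : Type*) where
  subgoals : Set (Atom P C)
  nodes : Set (Atom P C × Node P C)
  disposed : Set (Atom P C × Node P C)
  completed : Set (Atom P C)

namespace Forest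

/-- The initial forest for the goal `← A`. -/
def init (A : Atom P C) : Forest P C := ⟨{A}, ∅, ∅, ∅⟩

def IsActive (F : Forest P C) (S : Atom P C) (N : Node P C) : Prop :=
  (S, N) ∈ F.nodes ∧ (S, N) ∉ F.disposed

/-- The tree of `S` already contains the node `N`, up to renaming of variables. -/
def HasNode (F : Forest P C) (S : Atom P C) (N : Node P C) : Prop :=
  ∃ N', (S, N') ∈ F.nodes ∧ N'.IsVariant N

/-- Add a subgoal. -/
def addSubgoal (F : Forest P C) (S : Atom P C) : Forest P C :=
  { F with subgoals := insert S F.subgoals }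

/-- Add a node to the tree of `S`, unless the tree contains it up to renaming. -/
def addNode (F : Forest P C) (S : Atom P C) (N : Node P C) : Forest P C :=
  { F with nodes := F.nodes ∪ {x | x = (S, N) ∧ ¬ F.HasNode S N} }

/-- Dispose of a set of nodes. -/
def dispose (F : Forest P C) (U : Set (Atom P C × Node P C)) : Forest P C :=
  { F with disposed := F.disposed ∪ U }

/-- Mark subgoals as completed. -/
def complete (F : Forest P C) (E : Set (Atom P C)) : Forest P C :=
  { F with completed := F.completed ∪ E }

/-- `H ← D |` is an answer of the subgoal `S`; it is unconditional if `D` is empty. -/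
def IsAnswer (F : Forest P C) (S H : Atom P C) (D : List (Delayed P C)) : Prop :=
  F.IsActive S ⟨H, D, []⟩

/-- The table of a subgoal: the (unconditional) answers that have been derived for it. -/
def table (F : Forest P C) (S : Atom P C) : Set (Atom P C) := {H | F.IsAnswer S H []}

/-- The ground subgoal `A` has succeeded. -/
def Succeeded (F : Forest P C) (A : Atom P C) : Prop := F.IsAnswer A A []

/-- The ground subgoal `A` has failed: it is completed without answers. -/
def Failed (F : Forest P C) (A : Atom P C) : Prop :=
  A ∈ F.completed ∧ ∀ H D, ¬ F.IsAnswer A H D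

/-- A delayed literal has become successful. -/
def DelayedSucceeded (F : Forest P C) : Delayed P C → Prop
  | .neg A => F.Failed A
  | .pos _ call ans => ∃ H, H.IsVariant ans ∧ F.IsAnswer call H []

/-- A delayed literal has become failed. -/
def DelayedFailed (F : Forest P C) : Delayed P C → Prop
  | .neg A => F.Succeeded A
  | .pos _ call ans => call ∈ F.completed ∧ ∀ H D, H.IsVariant ans → ¬ F.IsAnswer call H D

/-- `N` is a resolvent of the subgoal `S` with a clause of the program. -/
def ClauseResolvent (prog : List (Clause P C)) (S : Atom P C) (N : Node P C) : Prop :=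
  ∃ c ∈ prog, ∃ (ρ : Equiv.Perm ℕ) (θ : ℕ → Term C),
    Disjoint (c.rename ρ).vars S.vars ∧ Atom.IsMGU θ S (c.rename ρ).head ∧
    N = ⟨S.subst θ, [], (c.rename ρ).body.map (Literal.subst θ)⟩

/-- The delayed literal left behind by resolving `B` with an answer `H ← D |` of `call`. -/
def returnDelay (B call H : Atom P C) : List (Delayed P C) → List (Delayed P C)
  | [] => []
  | _ :: _ => [.pos B call H]

/-- `N'` is a resolvent of the node `N`, on its selected positive literal `B`, with an answer of
the tree of `B`. -/
def AnswerResolvent (R : ComputationRule P C) (F : Forest P C) (N N' : Node P C) : Prop :=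
  ∃ G₁ B G₂, R.Selects N.goals G₁ (.pos B) G₂ ∧
    ∃ call ∈ F.subgoals, B.IsVariant call ∧ ∃ H D, F.IsAnswer call H D ∧
      ∃ (ρ : Equiv.Perm ℕ) (θ : ℕ → Term C),
        Disjoint (H.rename ρ).vars N.vars ∧ Atom.IsMGU θ B (H.rename ρ) ∧
        N' = ⟨N.head.subst θ,
              N.delays.map (Delayed.subst θ) ++ returnDelay (B.subst θ) call H D,
              (G₁ ++ G₂).map (Literal.subst θ)⟩

/-- The set `E` of subgoals is completely evaluated: each `S ∈ E` has an unconditional answer that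
is a variant of `S`, or no further clause or answer resolution is possible in the tree of `S` and
all nodes that still have goals wait for answers of completed subgoals or of subgoals in `E`. -/
def CompletelyEvaluated (prog : List (Clause P C)) (R : ComputationRule P C) (F : Forest P C)
    (E : Set (Atom P C)) : Prop :=
  ∀ S ∈ E, (∃ H, H.IsVariant S ∧ F.IsAnswer S H []) ∨
    ((∀ N, ClauseResolvent prog S N → F.HasNode S N) ∧
      ∀ N, F.IsActive S N → N.goals ≠ [] →
        (∃ G₁ B G₂, R.Selects N.goals G₁ (.pos B) G₂ ∧
          ∃ call ∈ F.subgoals, B.IsVariant call ∧ call ∈ F.completed ∪ E) ∧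
        ∀ N', AnswerResolvent R F N N' → F.HasNode S N')

/-- `U` is a set of unsupported answers: answers of completed subgoals, each of which depends on a
delayed positive literal all of whose supporting answers belong to `U`. -/
def Unsupported (F : Forest P C) (U : Set (Atom P C × Node P C)) : Prop :=
  ∀ S N, (S, N) ∈ U → S ∈ F.completed ∧ F.IsActive S N ∧ N.goals = [] ∧
    ∃ A call ans, Delayed.pos A call ans ∈ N.delays ∧ call ∈ F.completed ∧
      ∀ H D, H.IsVariant ans → F.IsAnswer call H D → (call, ⟨H, D, []⟩) ∈ U

/-- The operations of SLG-resolution. -/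
inductive Step (prog : List (Clause P C)) (R : ComputationRule P C) :
    Forest P C → Forest P C → Prop
  /-- NEW SUBGOAL -/
  | newSubgoal (F : Forest P C) (S : Atom P C) (N : Node P C) (G₁ G₂ : List (Literal P C))
      (L : Literal P C) (hS : S ∉ F.completed) (hN : F.IsActive S N)
      (hsel : R.Selects N.goals G₁ L G₂) (hL : ∀ A, L = .neg A → A.IsGround)
      (hnew : ∀ A ∈ F.subgoals, ¬ L.atom.IsVariant A) :
      Step prog R F (F.addSubgoal L.atom)
  /-- PROGRAM CLAUSE RESOLUTION -/
  | clauseResolution (F : Forest P C) (S : Atom P C) (N : Node P C) (hSF : S ∈ F.subgoals)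
      (hS : S ∉ F.completed) (hres : ClauseResolvent prog S N) (hnew : ¬ F.HasNode S N) :
      Step prog R F (F.addNode S N)
  /-- POSITIVE RETURN -/
  | positiveReturn (F : Forest P C) (S : Atom P C) (N N' : Node P C) (hS : S ∉ F.completed)
      (hN : F.IsActive S N) (hres : AnswerResolvent R F N N') (hnew : ¬ F.HasNode S N') :
      Step prog R F (F.addNode S N')
  /-- NEGATIVE RETURN, the selected negative literal succeeds -/
  | negationSuccess (F : Forest P C) (S : Atom P C) (N : Node P C) (G₁ G₂ : List (Literal P C))
      (A : Atom P C) (hS : S ∉ F.completed) (hN : F.IsActive S N)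
      (hsel : R.Selects N.goals G₁ (.neg A) G₂) (hA : A.IsGround) (hf : F.Failed A) :
      Step prog R F ((F.addNode S ⟨N.head, N.delays, G₁ ++ G₂⟩).dispose {(S, N)})
  /-- NEGATIVE RETURN, the selected negative literal fails -/
  | negationFailure (F : Forest P C) (S : Atom P C) (N : Node P C) (G₁ G₂ : List (Literal P C))
      (A : Atom P C) (hS : S ∉ F.completed) (hN : F.IsActive S N)
      (hsel : R.Selects N.goals G₁ (.neg A) G₂) (hA : A.IsGround) (hs : F.Succeeded A) :
      Step prog R F (F.dispose {(S, N)})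
  /-- DELAYING -/
  | delaying (F : Forest P C) (S : Atom P C) (N : Node P C) (G₁ G₂ : List (Literal P C))
      (A : Atom P C) (hS : S ∉ F.completed) (hN : F.IsActive S N)
      (hsel : R.Selects N.goals G₁ (.neg A) G₂) (hA : A.IsGround) (hAF : A ∈ F.subgoals)
      (hf : ¬ F.Failed A) (hs : ¬ F.Succeeded A) :
      Step prog R F ((F.addNode S ⟨N.head, N.delays ++ [.neg A], G₁ ++ G₂⟩).dispose {(S, N)})
  /-- SIMPLIFICATION, a delayed literal has become successful -/
  | simplifySuccess (F : Forest P C) (S H : Atom P C) (D₁ D₂ : List (Delayed P C))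
      (d : Delayed P C) (hN : F.IsAnswer S H (D₁ ++ d :: D₂)) (hd : F.DelayedSucceeded d) :
      Step prog R F ((F.addNode S ⟨H, D₁ ++ D₂, []⟩).dispose {(S, ⟨H, D₁ ++ d :: D₂, []⟩)})
  /-- SIMPLIFICATION, a delayed literal has become failed -/
  | simplifyFailure (F : Forest P C) (S H : Atom P C) (D : List (Delayed P C)) (d : Delayed P C)
      (hN : F.IsAnswer S H D) (hdD : d ∈ D) (hd : F.DelayedFailed d) :
      Step prog R F (F.dispose {(S, ⟨H, D, []⟩)})
  /-- COMPLETION -/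
  | completion (F : Forest P C) (E : Set (Atom P C)) (hne : E.Nonempty) (hE : E ⊆ F.subgoals)
      (hnc : ∀ S ∈ E, S ∉ F.completed) (hev : CompletelyEvaluated prog R F E) :
      Step prog R F (F.complete E)
  /-- ANSWER COMPLETION -/
  | answerCompletion (F : Forest P C) (U : Set (Atom P C × Node P C)) (hne : U.Nonempty)
      (hU : F.Unsupported U) :
      Step prog R F (F.dispose U)

/-- No operation is applicable. -/
def IsFinal (prog : List (Clause P C)) (R : ComputationRule P C) (F : Forest P C) : Prop :=
  ∀ F', ¬ Step prog R F F'

/-- The evaluation flounders: in the tree of a subgoal that is not completed, a non-ground negative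
literal is selected. -/
def Flounders (R : ComputationRule P C) (F : Forest P C) : Prop :=
  ∃ S N G₁ A G₂, S ∉ F.completed ∧ F.IsActive S N ∧ R.Selects N.goals G₁ (.neg A) G₂ ∧
    ¬ A.IsGround

end Forest

end SLG

/-! ### The algorithm computing the random variables -/

section Algorithm

variable {P C : Type*}

/-- The most general atom `p(X₁, …, Xₙ)` of a predicate symbol. -/
def goalAtom (s : Pred P × ℕ) : Atom P C := ⟨s.1, (List.range s.2).map .var⟩

/-- States of the algorithm: `ready todo out` between two goals, with the set `todo` of predicate
symbols whose goals are still to be computed and the set `out` collected so far; and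
`eval s F todo out` during the SLG evaluation of the goal of `s`, with current forest `F`. -/
inductive AlgState (P C : Type*) where
  | ready (todo : Set (Pred P × ℕ)) (out : Set (Atom P C))
  | eval (s : Pred P × ℕ) (F : Forest P C) (todo : Set (Pred P × ℕ)) (out : Set (Atom P C))

/-- Steps of the algorithm. -/
inductive AlgStep (KB : KnowledgeBase P C) (R : ComputationRule P C) :
    AlgState P C → AlgState P C → Prop
  /-- Choose the next goal. -/
  | start (s : Pred P × ℕ) (todo : Set (Pred P × ℕ)) (out : Set (Atom P C)) (hs : s ∈ todo) :
      AlgStep KB R (.ready todo out) (.eval s (.init (goalAtom s)) (todo \ {s}) out)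
  /-- Apply an operation of SLG-resolution. -/
  | slg (s : Pred P × ℕ) (F F' : Forest P C) (todo : Set (Pred P × ℕ)) (out : Set (Atom P C))
      (hF : Forest.Step KB.program R F F') :
      AlgStep KB R (.eval s F todo out) (.eval s F' todo out)
  /-- Collect the table of the goal when its evaluation is finished. -/
  | collect (s : Pred P × ℕ) (F : Forest P C) (todo : Set (Pred P × ℕ)) (out : Set (Atom P C))
      (hF : F.IsFinal KB.program R) (hnf : ¬ F.Flounders R) :
      AlgStep KB R (.eval s F todo out) (.ready todo (out ∪ F.table (goalAtom s)))

/-- The initial state. -/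
def KnowledgeBase.start (KB : KnowledgeBase P C) : AlgState P C := .ready KB.headSyms ∅

/-- The algorithm is stuck in the evaluation of a goal that flounders. -/
def AlgState.Flounders (R : ComputationRule P C) : AlgState P C → Prop
  | .ready _ _ => False
  | .eval _ F _ _ => F.Flounders R

end Algorithm

end BKB

/-!
# Computing the random variables of a Bayesian knowledge base by SLG-resolution

Both halves of the theorem rest on invariants of SLG forests.

*Correctness.*  Let `(I_t, I_f)` be the well-founded model.  By the invariant `Forest.Sound`, every
ground instance of a node is the head of a ground clause whose body literals are true in the model
or are still represented by goals or delayed literals of the node, and every node that was disposed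
of has a successor or contains a literal that is false or has lost its support.  A ground clause
can therefore be followed through the tree of a completed subgoal until an answer is reached
(`Forest.Sound.exists_answer`), provided that its positive literals are covered by answers and its
negative literals are not false.  Hence the instances of completed subgoals that are covered by no
answer form an unfounded set (`Forest.Sound.mem_false`); this justifies the negative returns and
the simplifications, and shows that all operations preserve the invariant (`Forest.Sound.step`).
When no operation is applicable and the evaluation does not flounder, all subgoals are completed
(`Forest.IsFinal.mem_completed`).  Then the true atoms covered by unconditional answers and the
false atoms covered by no answer form a pre-fixed point of the operator of the well-founded
semantics: its first half follows clauses again, and its second half holds because answers with an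
instance in an unfounded set would be removed by answer completion.  As the well-founded model is
the least pre-fixed point, tables are complete (`Forest.Sound.exists_answer_of_mem_true`).  The
arguments need that no atom is both true and false, which is derived from the alternating fixed
point (`notMem_false_of_mem_true`), and that unifiable atoms have most general unifiers
(`Atom.exists_isMGU`).

The space of random variables consists of the true atoms whose predicates are head predicates of
`PB` (`KnowledgeBase.mem_space_iff`).  By the type constraints, the arguments of these atoms are
constants; hence there are finitely many, and the answers of the goals are ground.

*Termination.*  All atoms of an evaluation are function-free, except that the second argument of
`member` is a suffix of a list of the program, and the number of literals of a node never exceeds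
the length of a clause body.  Up to renaming there are finitely many such subgoals and nodes, and
forests contain no two variants; on the other hand every operation adds a subgoal, a node, a
disposal or a completion.  So the number of these is bounded and increases (`Bounded.acc`).
-/

namespace BKB

/-! ### Substitutions and instances -/

namespace Term

variable {C : Type*}

@[simp] theorem subst_var (t : Term C) : t.subst var = t := by
  induction t <;> simp_all [subst]

theorem subst_subst (σ τ : ℕ → Term C) (t : Term C) :
    (t.subst σ).subst τ = t.subst fun n => (σ n).subst τ := by
  induction t <;> simp_all [subst]

theorem subst_eq_subst_iff {σ τ : ℕ → Term C} {t : Term C} :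
    t.subst σ = t.subst τ ↔ ∀ n ∈ t.vars, σ n = τ n := by
  induction t with
  | var n => simp [subst, vars]
  | const c => simp [subst, vars]
  | nil => simp [subst, vars]
  | cons h t ih₁ ih₂ =>
    simp only [subst, vars, cons.injEq, ih₁, ih₂, Set.mem_union]
    grind

theorem mem_vars_subst {σ : ℕ → Term C} {t : Term C} {n : ℕ} :
    n ∈ (t.subst σ).vars ↔ ∃ m ∈ t.vars, n ∈ (σ m).vars := by
  induction t with
  | var n => simp [subst, vars]
  | const c => simp [subst, vars]
  | nil => simp [subst, vars]
  | cons h t ih₁ ih₂ =>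
    simp only [subst, vars, Set.mem_union, ih₁, ih₂]
    grind

theorem mem_consts_subst {σ : ℕ → Term C} {t : Term C} {a : C} :
    a ∈ (t.subst σ).consts ↔ a ∈ t.consts ∨ ∃ m ∈ t.vars, a ∈ (σ m).consts := by
  induction t with
  | var n => simp [subst, vars, consts]
  | const c => simp [subst, vars, consts]
  | nil => simp [subst, vars, consts]
  | cons h t ih₁ ih₂ =>
    simp only [subst, vars, consts, Set.mem_union, ih₁, ih₂]
    grind

theorem finite_vars (t : Term C) : t.vars.Finite := by
  induction t with
  | cons h t ih₁ ih₂ => exact ih₁.union ih₂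
  | _ => simp [vars]

theorem finite_consts (t : Term C) : t.consts.Finite := by
  induction t with
  | cons h t ih₁ ih₂ => exact ih₁.union ih₂
  | _ => simp [consts]

@[simp] theorem vars_ofList (l : List C) : (ofList l).vars = ∅ := by
  induction l <;> simp_all [ofList, vars]

theorem subst_of_vars_eq_empty {t : Term C} (h : t.vars = ∅) (σ : ℕ → Term C) :
    t.subst σ = t := by
  conv_rhs => rw [← subst_var t]
  rw [subst_eq_subst_iff, h]
  simp

@[simp] theorem subst_ofList (σ : ℕ → Term C) (l : List C) : (ofList l).subst σ = ofList l :=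
  subst_of_vars_eq_empty (vars_ofList l) σ

theorem ofList_injective : Function.Injective (ofList : List C → Term C) := by
  intro l
  induction l with
  | nil => intro l'; cases l' <;> simp [ofList]
  | cons c l ih =>
    intro l'
    cases l' with
    | nil => simp [ofList]
    | cons c' l' =>
      simp only [ofList, cons.injEq, const.injEq, List.cons.injEq, and_imp]
      exact fun h h' => ⟨h, ih h'⟩

end Term

namespace Atom

variable {P C : Type*}

@[simp] theorem subst_var (A : Atom P C) : A.subst .var = A := by
  obtain ⟨p, as⟩ := A
  simp only [subst, mk.injEq, true_and]
  exact List.map_id'' Term.subst_var as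

theorem subst_subst (σ τ : ℕ → Term C) (A : Atom P C) :
    (A.subst σ).subst τ = A.subst fun n => (σ n).subst τ := by
  simp [subst, Term.subst_subst]

theorem subst_eq_subst_iff {σ τ : ℕ → Term C} {A : Atom P C} :
    A.subst σ = A.subst τ ↔ ∀ n ∈ A.vars, σ n = τ n := by
  simp only [subst, mk.injEq, true_and, List.map_inj_left, Term.subst_eq_subst_iff, vars]
  grind

theorem subst_congr {σ τ : ℕ → Term C} {A : Atom P C} (h : ∀ n ∈ A.vars, σ n = τ n) :
    A.subst σ = A.subst τ := subst_eq_subst_iff.2 h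

theorem mem_vars_subst {σ : ℕ → Term C} {A : Atom P C} {n : ℕ} :
    n ∈ (A.subst σ).vars ↔ ∃ m ∈ A.vars, n ∈ (σ m).vars := by
  simp only [subst, vars, List.mem_map, exists_exists_and_eq_and, Term.mem_vars_subst,
    Set.mem_ofPred_eq]
  grind

theorem mem_consts_subst {σ : ℕ → Term C} {A : Atom P C} {a : C} :
    a ∈ (A.subst σ).consts ↔ a ∈ A.consts ∨ ∃ m ∈ A.vars, a ∈ (σ m).consts := by
  simp only [subst, vars, consts, List.mem_map, exists_exists_and_eq_and, Term.mem_consts_subst,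
    Set.mem_ofPred_eq]
  grind

theorem finite_vars (A : Atom P C) : A.vars.Finite := by
  have : A.vars = ⋃ t ∈ {t | t ∈ A.args}, t.vars := by ext; simp [vars]
  rw [this]
  exact (List.finite_toSet A.args).biUnion fun t _ => t.finite_vars

theorem finite_consts (A : Atom P C) : A.consts.Finite := by
  have : A.consts = ⋃ t ∈ {t | t ∈ A.args}, t.consts := by ext; simp [consts]
  rw [this]
  exact (List.finite_toSet A.args).biUnion fun t _ => t.finite_consts

@[simp] theorem sym_subst (σ : ℕ → Term C) (A : Atom P C) : (A.subst σ).sym = A.sym := by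
  simp [sym, subst]

theorem IsGround.subst_eq {A : Atom P C} (h : A.IsGround) (σ : ℕ → Term C) : A.subst σ = A := by
  conv_rhs => rw [← subst_var A]
  refine subst_congr fun n hn => ?_
  rw [h] at hn
  exact hn.elim

theorem mem_vars_rename {ρ : Equiv.Perm ℕ} {A : Atom P C} {n : ℕ} :
    n ∈ (A.rename ρ).vars ↔ ρ.symm n ∈ A.vars := by
  simp only [rename, mem_vars_subst, Term.vars, Set.mem_singleton_iff]
  constructor
  · rintro ⟨m, hm, rfl⟩; simpa
  · exact fun h => ⟨_, h, by simp⟩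

@[simp] theorem consts_rename (ρ : Equiv.Perm ℕ) (A : Atom P C) :
    (A.rename ρ).consts = A.consts := by
  ext; simp [rename, mem_consts_subst, Term.consts]

@[simp] theorem sym_rename (ρ : Equiv.Perm ℕ) (A : Atom P C) : (A.rename ρ).sym = A.sym :=
  sym_subst _ _

theorem subst_rename (ρ : Equiv.Perm ℕ) (σ : ℕ → Term C) (A : Atom P C) :
    (A.rename ρ).subst σ = A.subst fun n => σ (ρ n) := by
  simp [rename, subst_subst, Term.subst]

theorem rename_rename (ρ ρ' : Equiv.Perm ℕ) (A : Atom P C) :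
    (A.rename ρ).rename ρ' = A.rename (ρ.trans ρ') := by
  simp [rename, subst_subst, Term.subst]

theorem rename_symm_rename (ρ : Equiv.Perm ℕ) (A : Atom P C) :
    (A.rename ρ).rename ρ.symm = A := by
  simp [rename, subst_subst, Term.subst]

theorem IsVariant.refl (A : Atom P C) : A.IsVariant A := ⟨Equiv.refl _, by simp [rename]⟩

theorem IsVariant.symm {A B : Atom P C} (h : A.IsVariant B) : B.IsVariant A := by
  obtain ⟨ρ, rfl⟩ := h
  exact ⟨ρ.symm, (rename_symm_rename ρ A).symm⟩

theorem IsVariant.trans {A B D : Atom P C} (h : A.IsVariant B) (h' : B.IsVariant D) :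
    A.IsVariant D := by
  obtain ⟨ρ, rfl⟩ := h
  obtain ⟨ρ', rfl⟩ := h'
  exact ⟨ρ.trans ρ', rename_rename ρ ρ' A⟩

/-- `A` is an instance of `B`. -/
def IsInstance (A B : Atom P C) : Prop := ∃ σ : ℕ → Term C, A = B.subst σ

theorem IsInstance.refl (A : Atom P C) : A.IsInstance A := ⟨.var, (subst_var A).symm⟩

theorem IsInstance.trans {A B D : Atom P C} (h : A.IsInstance B) (h' : B.IsInstance D) :
    A.IsInstance D := by
  obtain ⟨σ, rfl⟩ := h
  obtain ⟨τ, rfl⟩ := h'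
  exact ⟨_, subst_subst _ _ _⟩

theorem IsInstance.subst {A B : Atom P C} (h : A.IsInstance B) (σ : ℕ → Term C) :
    (A.subst σ).IsInstance B := IsInstance.trans ⟨σ, rfl⟩ h

theorem IsVariant.isInstance {A B : Atom P C} (h : A.IsVariant B) : B.IsInstance A := by
  obtain ⟨ρ, rfl⟩ := h
  exact ⟨_, rfl⟩

theorem IsInstance.eq_of_isGround {A B : Atom P C} (h : A.IsInstance B) (hB : B.IsGround) :
    A = B := by
  obtain ⟨σ, rfl⟩ := h
  exact hB.subst_eq σ

end Atom

namespace Literal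

variable {P C : Type*}

@[simp] theorem subst_var (L : Literal P C) : L.subst .var = L := by
  cases L <;> simp [subst]

theorem subst_subst (σ τ : ℕ → Term C) (L : Literal P C) :
    (L.subst σ).subst τ = L.subst fun n => (σ n).subst τ := by
  cases L <;> simp [subst, Atom.subst_subst]

theorem subst_congr {σ τ : ℕ → Term C} {L : Literal P C} (h : ∀ n ∈ L.atom.vars, σ n = τ n) :
    L.subst σ = L.subst τ := by
  cases L with
  | pos A => exact congrArg pos (Atom.subst_congr h)
  | neg A => exact congrArg neg (Atom.subst_congr h)

@[simp] theorem atom_subst (σ : ℕ → Term C) (L : Literal P C) :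
    (L.subst σ).atom = L.atom.subst σ := by
  cases L <;> rfl

theorem subst_rename (ρ : Equiv.Perm ℕ) (σ : ℕ → Term C) (L : Literal P C) :
    (L.rename ρ).subst σ = L.subst fun n => σ (ρ n) := by
  simp [rename, subst_subst, Term.subst]

end Literal

namespace Clause

variable {P C : Type*}

theorem finite_vars (c : Clause P C) : c.vars.Finite := by
  have : c.vars = ⋃ A ∈ {A | A ∈ c.atoms}, A.vars := by ext; simp [vars]
  rw [this]
  exact (List.finite_toSet c.atoms).biUnion fun A _ => A.finite_vars

@[simp] theorem atoms_subst (σ : ℕ → Term C) (c : Clause P C) :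
    (c.subst σ).atoms = c.atoms.map (Atom.subst σ) := by
  simp [atoms, subst]

theorem atoms_rename (ρ : Equiv.Perm ℕ) (c : Clause P C) :
    (c.rename ρ).atoms = c.atoms.map (Atom.rename ρ) :=
  atoms_subst _ _

theorem mem_vars_rename {ρ : Equiv.Perm ℕ} {c : Clause P C} {n : ℕ} :
    n ∈ (c.rename ρ).vars ↔ ρ.symm n ∈ c.vars := by
  simp only [vars, atoms_rename, List.mem_map, exists_exists_and_eq_and, Atom.mem_vars_rename,
    Set.mem_ofPred_eq]

theorem subst_subst (σ τ : ℕ → Term C) (c : Clause P C) :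
    (c.subst σ).subst τ = c.subst fun n => (σ n).subst τ := by
  simp [subst, Atom.subst_subst, Literal.subst_subst]

theorem subst_rename (ρ : Equiv.Perm ℕ) (σ : ℕ → Term C) (c : Clause P C) :
    (c.rename ρ).subst σ = c.subst fun n => σ (ρ n) := by
  simp [rename, subst_subst, Term.subst]

end Clause

namespace Delayed

variable {P C : Type*}

/-- The literal that has been delayed. -/
def literal : Delayed P C → Literal P C
  | neg A => .neg A
  | pos A _ _ => .pos A

@[simp] theorem literal_subst (σ : ℕ → Term C) (d : Delayed P C) :
    (d.subst σ).literal = d.literal.subst σ := by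
  cases d <;> rfl

@[simp] theorem atom_subst (σ : ℕ → Term C) (d : Delayed P C) :
    (d.subst σ).atom = d.atom.subst σ := by
  cases d <;> rfl

end Delayed

/-! ### Unification -/

section Unification

variable {P C : Type*}

/-- Number of symbols of a term. -/
def Term.size : Term C → ℕ
  | .cons h t => h.size + t.size + 1
  | _ => 1

theorem Term.size_pos (t : Term C) : 0 < t.size := by
  cases t <;> simp [size]

theorem Term.size_le_size_subst {σ : ℕ → Term C} {t : Term C} {n : ℕ} (h : n ∈ t.vars) :
    (σ n).size ≤ (t.subst σ).size := by
  induction t with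
  | var m => obtain rfl : n = m := h; rfl
  | const c => exact h.elim
  | nil => exact h.elim
  | cons s t ih₁ ih₂ =>
    rcases h with h | h
    · have := ih₁ h; simp only [subst, size]; omega
    · have := ih₂ h; simp only [subst, size]; omega

/-- `σ` solves all equations of the list `E`. -/
def Unifies (σ : ℕ → Term C) (E : List (Term C × Term C)) : Prop :=
  ∀ p ∈ E, p.1.subst σ = p.2.subst σ

/-- `θ` solves the equations of `E`, and all solutions are instances of `θ`. -/
def MostGeneral (θ : ℕ → Term C) (E : List (Term C × Term C)) : Prop :=
  Unifies θ E ∧ ∀ σ, Unifies σ E → ∃ τ : ℕ → Term C, ∀ n, σ n = (θ n).subst τ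

theorem MostGeneral.congr {θ : ℕ → Term C} {E E' : List (Term C × Term C)}
    (h : MostGeneral θ E) (hE : ∀ σ, Unifies σ E ↔ Unifies σ E') : MostGeneral θ E' :=
  ⟨(hE θ).1 h.1, fun σ hσ => h.2 σ ((hE σ).2 hσ)⟩

theorem unifies_cons {σ : ℕ → Term C} {s t : Term C} {E : List (Term C × Term C)} :
    Unifies σ ((s, t) :: E) ↔ s.subst σ = t.subst σ ∧ Unifies σ E := by
  simp [Unifies]

/-- Binding of the variable `n` to `t`. -/
def bind (n : ℕ) (t : Term C) : ℕ → Term C := Function.update .var n t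

theorem subst_bind {n : ℕ} {t : Term C} {σ : ℕ → Term C} (h : σ n = t.subst σ) (s : Term C) :
    (s.subst (bind n t)).subst σ = s.subst σ := by
  rw [Term.subst_subst, Term.subst_eq_subst_iff]
  intro m _
  by_cases hm : m = n
  · subst hm; simp [bind, h]
  · simp [bind, hm, Term.subst]

theorem unifies_bind {n : ℕ} {t : Term C} {σ : ℕ → Term C} (h : σ n = t.subst σ)
    (E : List (Term C × Term C)) :
    Unifies σ (E.map fun p => (p.1.subst (bind n t), p.2.subst (bind n t))) ↔ Unifies σ E := by
  simp only [Unifies, List.forall_mem_map, subst_bind h]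

/-- Solving `n = t` first and substituting the solution into the other equations. -/
theorem MostGeneral.bind {n : ℕ} {t : Term C} (hn : n ∉ t.vars) {θ : ℕ → Term C}
    {E : List (Term C × Term C)}
    (h : MostGeneral θ (E.map fun p => (p.1.subst (bind n t), p.2.subst (bind n t)))) :
    MostGeneral (fun m => (BKB.bind n t m).subst θ) ((.var n, t) :: E) := by
  have ht : t.subst (BKB.bind n t) = t := by
    conv_rhs => rw [← Term.subst_var t]
    rw [Term.subst_eq_subst_iff]
    intro m hm
    have : m ≠ n := by rintro rfl; exact hn hm
    simp [BKB.bind, this]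
  refine ⟨unifies_cons.2 ⟨?_, ?_⟩, fun σ hσ => ?_⟩
  · rw [← Term.subst_subst, ← Term.subst_subst, ht]
    simp [Term.subst, BKB.bind]
  · intro p hp
    have := h.1 _ (List.mem_map_of_mem hp)
    simpa [Term.subst_subst] using this
  · obtain ⟨h₁, h₂⟩ := unifies_cons.1 hσ
    obtain ⟨τ, hτ⟩ := h.2 σ ((unifies_bind h₁ E).2 h₂)
    refine ⟨τ, fun m => ?_⟩
    rw [Term.subst_subst]
    have : (fun k => (θ k).subst τ) = σ := funext fun k => (hτ k).symm
    rw [this]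
    simpa [Term.subst] using (subst_bind h₁ (.var m)).symm

/-- Solvable equations have a most general solution.  The size of the equations under a given
solution decreases when a variable is eliminated. -/
theorem exists_mostGeneral {σ : ℕ → Term C} (k : ℕ) (E : List (Term C × Term C))
    (hσ : Unifies σ E) (hk : (E.map fun p => (p.1.subst σ).size).sum = k) :
    ∃ θ, MostGeneral θ E := by
  induction k using Nat.strong_induction_on generalizing E with
  | _ k ih =>
  have elim (n : ℕ) (t : Term C) (E' : List (Term C × Term C)) (h : σ n = t.subst σ)
      (hE' : Unifies σ E') (hlt : (E'.map fun p => (p.1.subst σ).size).sum < k) :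
      ∃ θ, MostGeneral θ ((.var n, t) :: E') := by
    by_cases hn : n ∈ t.vars
    · have hsz := Term.size_le_size_subst (σ := σ) hn
      obtain rfl : t = .var n := by
        cases t with
        | var m => obtain rfl : n = m := hn; rfl
        | const c => exact hn.elim
        | nil => exact hn.elim
        | cons s t =>
          exfalso
          rw [h] at hsz
          rcases hn with hn | hn
          · have := Term.size_le_size_subst (σ := σ) hn
            simp only [h, Term.subst, Term.size] at this
            omega
          · have := Term.size_le_size_subst (σ := σ) hn
            simp only [h, Term.subst, Term.size] at this
            omega
      obtain ⟨θ, hθ⟩ := ih _ hlt E' hE' rfl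
      exact ⟨θ, hθ.congr fun σ => by simp [unifies_cons]⟩
    · obtain ⟨θ, hθ⟩ := ih _ hlt (E'.map fun p => (p.1.subst (bind n t), p.2.subst (bind n t)))
        ((unifies_bind h E').2 hE') (by simp [Function.comp_def, subst_bind h])
      exact ⟨_, hθ.bind hn⟩
  match E with
  | [] => exact ⟨.var, by simp [Unifies], fun σ _ => ⟨σ, fun n => rfl⟩⟩
  | (s, t) :: E =>
    obtain ⟨h, hE⟩ := unifies_cons.1 hσ
    have hpos := Term.size_pos (s.subst σ)
    simp only [List.map_cons, List.sum_cons] at hk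
    have hlt : (E.map fun p => (p.1.subst σ).size).sum < k := by omega
    match s, t with
    | .var n, t => exact elim n t E h hE hlt
    | s, .var n =>
      obtain ⟨θ, hθ⟩ := elim n s E h.symm hE hlt
      exact ⟨θ, hθ.congr fun σ => by simp [unifies_cons, eq_comm]⟩
    | .const c, .const d =>
      obtain ⟨θ, hθ⟩ := ih _ hlt E hE rfl
      exact ⟨θ, hθ.congr fun σ => by simpa [unifies_cons, Term.subst] using fun _ => h⟩
    | .nil, .nil =>
      obtain ⟨θ, hθ⟩ := ih _ hlt E hE rfl
      exact ⟨θ, hθ.congr fun σ => by simp [unifies_cons, Term.subst]⟩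
    | .cons s₁ s₂, .cons t₁ t₂ =>
      simp only [Term.subst, Term.cons.injEq] at h
      have hlt' : (((s₁, t₁) :: (s₂, t₂) :: E).map fun p => (p.1.subst σ).size).sum < k := by
        simp only [List.map_cons, List.sum_cons, Term.subst, Term.size] at hk ⊢
        omega
      obtain ⟨θ, hθ⟩ := ih _ hlt' ((s₁, t₁) :: (s₂, t₂) :: E)
        (unifies_cons.2 ⟨h.1, unifies_cons.2 ⟨h.2, hE⟩⟩) rfl
      exact ⟨θ, hθ.congr fun σ => by simp [unifies_cons, Term.subst, and_assoc]⟩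

theorem Atom.subst_eq_iff_unifies {A B : Atom P C} (hp : A.pred = B.pred)
    (hl : A.args.length = B.args.length) (σ : ℕ → Term C) :
    A.subst σ = B.subst σ ↔ Unifies σ (A.args.zip B.args) := by
  obtain ⟨p, as⟩ := A
  obtain ⟨q, bs⟩ := B
  obtain rfl : p = q := hp
  simp only [subst, mk.injEq, true_and]
  simp only at hl
  clear * - hl
  induction as generalizing bs with
  | nil => cases bs <;> simp_all [Unifies]
  | cons a as ih =>
    cases bs with
    | nil => simp at hl
    | cons b bs =>
      simp only [List.length_cons, Nat.add_right_cancel_iff] at hl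
      simp [unifies_cons, ih bs hl]

/-- Unifiable atoms have a most general unifier. -/
theorem Atom.exists_isMGU {A B : Atom P C} {σ : ℕ → Term C} (h : A.subst σ = B.subst σ) :
    ∃ θ, IsMGU θ A B := by
  have hp : A.pred = B.pred := (mk.inj h).1
  have hl : A.args.length = B.args.length := by
    simpa [subst] using congrArg (fun A => A.args.length) h
  obtain ⟨θ, h₁, h₂⟩ := exists_mostGeneral _ _ ((subst_eq_iff_unifies hp hl σ).1 h) rfl
  exact ⟨θ, (subst_eq_iff_unifies hp hl θ).2 h₁,
    fun σ hσ => h₂ σ ((subst_eq_iff_unifies hp hl σ).1 hσ)⟩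

/-- Replacement of the constants outside `K` by the empty list. -/
noncomputable def Term.restrict (K : Set C) : Term C → Term C
  | .var n => .var n
  | .const c => open Classical in if c ∈ K then .const c else .nil
  | .nil => .nil
  | .cons h t => .cons (h.restrict K) (t.restrict K)

theorem Term.restrict_subst {K : Set C} {t : Term C} (h : t.consts ⊆ K) (σ : ℕ → Term C) :
    (t.subst σ).restrict K = t.subst fun n => (σ n).restrict K := by
  induction t with
  | const c => simpa [restrict, subst, consts] using h
  | cons s t ih₁ ih₂ =>
    simp only [consts, Set.union_subset_iff] at h
    simp [restrict, subst, ih₁ h.1, ih₂ h.2]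
  | _ => simp [restrict, subst]

theorem Term.consts_subset_of_restrict_eq {K : Set C} {t : Term C} {τ : ℕ → Term C}
    (h : t.restrict K = t.subst τ) : t.consts ⊆ K := by
  induction t with
  | const c =>
    by_contra hc
    simp only [consts, Set.singleton_subset_iff] at hc
    simp [restrict, subst, hc] at h
  | cons s t ih₁ ih₂ =>
    simp only [restrict, subst, cons.injEq] at h
    exact Set.union_subset (ih₁ h.1) (ih₂ h.2)
  | _ => simp [consts]

/-- A most general unifier introduces no constants: any others could be replaced. -/
theorem Atom.IsMGU.consts_subset {θ : ℕ → Term C} {A B : Atom P C} (h : IsMGU θ A B) {K : Set C}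
    (hA : A.consts ⊆ K) (hB : B.consts ⊆ K) (n : ℕ) : (θ n).consts ⊆ K := by
  have key (D : Atom P C) (hD : D.consts ⊆ K) :
      D.subst (fun n => (θ n).restrict K) =
        ⟨D.pred, (D.subst θ).args.map (Term.restrict K)⟩ := by
    simp only [subst, mk.injEq, List.map_map, List.map_inj_left, Function.comp_apply, true_and]
    exact fun t ht => (Term.restrict_subst (fun a ha => hD ⟨t, ht, ha⟩) θ).symm
  obtain ⟨τ, hτ⟩ := h.2 (fun n => (θ n).restrict K) <| by
    rw [key A hA, key B hB, h.1, show A.pred = B.pred from (mk.inj h.1).1]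
  exact Term.consts_subset_of_restrict_eq (hτ n)

/-- Finitely many variables can be renamed away from any finite set. -/
theorem exists_perm_disjoint {s t : Set ℕ} (hs : s.Finite) (ht : t.Finite) :
    ∃ ρ : Equiv.Perm ℕ, ∀ n ∈ s, ρ n ∉ t := by
  obtain ⟨M, hM⟩ := (hs.union ht).bddAbove
  have hinv : Function.Involutive fun n : ℕ =>
      if n ≤ M then n + (M + 1) else if n ≤ M + (M + 1) then n - (M + 1) else n := by
    intro n
    dsimp only
    split_ifs <;> omega
  refine ⟨hinv.toPerm, fun n hn hn' => ?_⟩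
  have h₁ : n ≤ M := hM (Or.inl hn)
  have h₂ := hM (Or.inr hn')
  simp only [Function.Involutive.coe_toPerm, h₁, if_true] at h₂
  omega

end Unification

/-! ### The language of a program -/

section Language

variable {P C : Type*}

/-- The constants occurring in a program. -/
def progConsts (prog : List (Clause P C)) : Set C := {a | ∃ c ∈ prog, ∃ A ∈ c.atoms, a ∈ A.consts}

/-- The predicate symbols occurring in a program. -/
def progSyms (prog : List (Clause P C)) : Set (Pred P × ℕ) :=
  {s | ∃ c ∈ prog, ∃ A ∈ c.atoms, A.sym = s}

/-- `A` is an atom of the language of the program. -/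
def InLanguage (prog : List (Clause P C)) (A : Atom P C) : Prop :=
  A.sym ∈ progSyms prog ∧ A.consts ⊆ progConsts prog

variable {prog : List (Clause P C)}

theorem mem_herbrandUniverse {t : Term C} :
    t ∈ herbrandUniverse prog ↔ t.vars = ∅ ∧ t.consts ⊆ progConsts prog := Iff.rfl

theorem nil_mem_herbrandUniverse : (Term.nil : Term C) ∈ herbrandUniverse prog := by
  simp [mem_herbrandUniverse, Term.vars, Term.consts]

theorem isGrounding_nil : IsGrounding prog fun _ => Term.nil := fun _ => nil_mem_herbrandUniverse

theorem inLanguage_of_mem_atoms {c : Clause P C} (hc : c ∈ prog) {A : Atom P C}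
    (hA : A ∈ c.atoms) : InLanguage prog A :=
  ⟨⟨c, hc, A, hA, rfl⟩, fun _ ha => ⟨c, hc, A, hA, ha⟩⟩

theorem InLanguage.subst {A : Atom P C} (h : InLanguage prog A) {σ : ℕ → Term C}
    (hσ : ∀ n, (σ n).consts ⊆ progConsts prog) : InLanguage prog (A.subst σ) := by
  refine ⟨by simpa using h.1, fun a ha => ?_⟩
  rcases Atom.mem_consts_subst.1 ha with ha | ⟨m, -, ha⟩
  exacts [h.2 ha, hσ m ha]

theorem InLanguage.rename {A : Atom P C} (h : InLanguage prog A) (ρ : Equiv.Perm ℕ) :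
    InLanguage prog (A.rename ρ) :=
  ⟨by simpa using h.1, by simpa using h.2⟩

/-- The arguments of `A` belong to the Herbrand universe. -/
def IsHerbrand (prog : List (Clause P C)) (A : Atom P C) : Prop :=
  ∀ t ∈ A.args, t ∈ herbrandUniverse prog

theorem Atom.IsGround.isHerbrand {A : Atom P C} (hA : A.IsGround) (h : InLanguage prog A) :
    IsHerbrand prog A := by
  refine fun t ht => ⟨Set.eq_empty_of_forall_notMem fun n hn => ?_, fun a ha => h.2 ⟨t, ht, ha⟩⟩
  have : n ∈ A.vars := ⟨t, ht, hn⟩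
  rw [hA] at this
  exact this

theorem subst_mem_herbrandUniverse {t : Term C} (ht : t.consts ⊆ progConsts prog)
    {σ : ℕ → Term C} (hσ : IsGrounding prog σ) : t.subst σ ∈ herbrandUniverse prog := by
  refine ⟨Set.eq_empty_of_forall_notMem fun n hn => ?_, fun a ha => ?_⟩
  · obtain ⟨m, -, hm⟩ := Term.mem_vars_subst.1 hn
    rw [(hσ m).1] at hm
    exact hm
  · rcases Term.mem_consts_subst.1 ha with ha | ⟨m, -, ha⟩
    exacts [ht ha, (hσ m).2 a ha]

theorem InLanguage.isHerbrand_subst {A : Atom P C} (h : InLanguage prog A) {σ : ℕ → Term C}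
    (hσ : IsGrounding prog σ) : IsHerbrand prog (A.subst σ) := by
  intro t ht
  obtain ⟨s, hs, rfl⟩ := List.mem_map.1 ht
  exact subst_mem_herbrandUniverse (fun a ha => h.2 ⟨s, hs, ha⟩) hσ

/-- A term whose value under `τ` lies in the Herbrand universe only uses such values of `τ`. -/
theorem mem_herbrandUniverse_of_subst {t : Term C} {τ : ℕ → Term C}
    (h : t.subst τ ∈ herbrandUniverse prog) {n : ℕ} (hn : n ∈ t.vars) :
    τ n ∈ herbrandUniverse prog := by
  refine ⟨Set.eq_empty_of_forall_notMem fun m hm => ?_, fun a ha => ?_⟩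
  · have := Term.mem_vars_subst.2 ⟨n, hn, hm⟩
    rw [h.1] at this
    exact this
  · exact h.2 a (Term.mem_consts_subst.2 (Or.inr ⟨n, hn, ha⟩))

/-- Any substitution can be made grounding by changing the values outside the Herbrand universe. -/
theorem exists_isGrounding (prog : List (Clause P C)) (τ : ℕ → Term C) :
    ∃ τ', IsGrounding prog τ' ∧ ∀ n, τ n ∈ herbrandUniverse prog → τ' n = τ n := by
  classical
  refine ⟨fun n => if τ n ∈ herbrandUniverse prog then τ n else .nil, fun n => ?_,
    fun n hn => if_pos hn⟩
  dsimp only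
  split_ifs with h
  exacts [h, nil_mem_herbrandUniverse]

theorem IsHerbrand.exists_isGrounding {A B : Atom P C} (hA : IsHerbrand prog A)
    (h : A.IsInstance B) : ∃ σ, IsGrounding prog σ ∧ A = B.subst σ := by
  obtain ⟨τ, rfl⟩ := h
  obtain ⟨σ, hσ, hστ⟩ := BKB.exists_isGrounding prog τ
  refine ⟨σ, hσ, Atom.subst_congr fun n hn => (hστ n ?_).symm⟩
  obtain ⟨t, ht, hn⟩ := hn
  exact mem_herbrandUniverse_of_subst (hA _ (List.mem_map_of_mem ht)) hn

/-- Lifting of a common ground instance of `A` and `B` to a most general unifier of `A` and a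
renamed copy of `B`, which has no variables in `V`. -/
theorem exists_isMGU_rename {A B : Atom P C} {V W : Set ℕ} (hV : V.Finite) (hW : W.Finite)
    (hA : A.vars ⊆ V) (hB : B.vars ⊆ W) {σ σ' : ℕ → Term C} (hσ : IsGrounding prog σ)
    (hσ' : IsGrounding prog σ') (h : A.subst σ = B.subst σ') :
    ∃ (ρ : Equiv.Perm ℕ) (θ τ : ℕ → Term C), (∀ n ∈ W, ρ n ∉ V) ∧ Atom.IsMGU θ A (B.rename ρ) ∧
      IsGrounding prog τ ∧ (∀ n ∈ V, (θ n).subst τ = σ n) ∧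
      ∀ n ∈ W, (θ (ρ n)).subst τ = σ' n := by
  classical
  obtain ⟨ρ, hρ⟩ := exists_perm_disjoint hW hV
  let η : ℕ → Term C := fun n => if n ∈ V then σ n else σ' (ρ.symm n)
  have hη : IsGrounding prog η := by
    intro n
    dsimp only [η]
    split_ifs
    exacts [hσ _, hσ' _]
  have h₁ : ∀ n ∈ V, η n = σ n := fun n hn => if_pos hn
  have h₂ : ∀ n ∈ W, η (ρ n) = σ' n := fun n hn => by simp [η, hρ n hn]
  have hun : A.subst η = (B.rename ρ).subst η := by
    rw [Atom.subst_rename, Atom.subst_congr fun n hn => h₁ n (hA hn), h]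
    exact (Atom.subst_congr fun n hn => h₂ n (hB hn)).symm
  obtain ⟨θ, hθ⟩ := Atom.exists_isMGU hun
  obtain ⟨τ, hτ⟩ := hθ.2 η hun
  obtain ⟨τ', hτ', hττ'⟩ := BKB.exists_isGrounding prog τ
  have key (n : ℕ) : (θ n).subst τ' = η n := by
    rw [hτ n, Term.subst_eq_subst_iff]
    intro m hm
    exact hττ' m (mem_herbrandUniverse_of_subst (hτ n ▸ hη n) hm)
  exact ⟨ρ, θ, τ', hρ, hθ, hτ', fun n hn => (key n).trans (h₁ n hn),
    fun n hn => (key _).trans (h₂ n hn)⟩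

theorem isHerbrand_of_mem_groundInstances {g : Clause P C} (hg : g ∈ groundInstances prog)
    {A : Atom P C} (hA : A ∈ g.atoms) : IsHerbrand prog A ∧ InLanguage prog A := by
  obtain ⟨c, hc, σ, hσ, rfl⟩ := hg
  rw [Clause.atoms_subst] at hA
  obtain ⟨B, hB, rfl⟩ := List.mem_map.1 hA
  have := inLanguage_of_mem_atoms hc hB
  exact ⟨this.isHerbrand_subst hσ, this.subst fun n => (hσ n).2⟩

theorem Clause.atom_mem_atoms {c : Clause P C} {L : Literal P C} (h : L ∈ c.body) :
    L.atom ∈ c.atoms :=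
  List.mem_cons_of_mem _ (List.mem_map_of_mem h)

theorem Clause.head_mem_atoms (c : Clause P C) : c.head ∈ c.atoms := List.mem_cons_self

end Language

/-! ### Consistency of the well-founded model -/

section Consistency

variable {P C : Type*} {prog : List (Clause P C)}

/-- The least model of the reduct of the program by `X`: the atoms derivable when `¬ A` is taken to
hold for the atoms `A` outside `X`. -/
inductive ReductModel (prog : List (Clause P C)) (X : Set (Atom P C)) : Atom P C → Prop
  | intro (g : Clause P C) (hg : g ∈ groundInstances prog)
      (hpos : ∀ A, Literal.pos A ∈ g.body → ReductModel prog X A)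
      (hneg : ∀ A, Literal.neg A ∈ g.body → A ∉ X) : ReductModel prog X g.head

theorem ReductModel.anti {X Y : Set (Atom P C)} (h : X ⊆ Y) {A : Atom P C}
    (hA : ReductModel prog Y A) : ReductModel prog X A := by
  induction hA with
  | intro g hg _ hneg ih => exact .intro g hg ih fun A hA hAX => hneg A hA (h hAX)

/-- The square of the reduct operator. -/
def alternatingOperator (prog : List (Clause P C)) : Set (Atom P C) →o Set (Atom P C) where
  toFun X := {A | ReductModel prog {B | ReductModel prog X B} A}
  monotone' _ _ h _ hA := ReductModel.anti (fun _ hB => ReductModel.anti h hB) hA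

theorem wellFoundedModel_eq (prog : List (Clause P C)) :
    wfOperator prog (wellFoundedModel prog) = wellFoundedModel prog :=
  (wfOperator prog).map_lfp

theorem wellFoundedModel_le {I : PInterp P C} (h : wfOperator prog I ≤ I) :
    wellFoundedModel prog ≤ I :=
  (wfOperator prog).lfp_le h

theorem mem_true_iff {A : Atom P C} : A ∈ (wellFoundedModel prog).1 ↔
    ∃ g ∈ groundInstances prog, g.head = A ∧ ∀ L ∈ g.body, L.TrueIn (wellFoundedModel prog) := by
  conv_lhs => rw [← wellFoundedModel_eq]
  rfl

theorem subset_false_of_isUnfounded {U : Set (Atom P C)}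
    (h : IsUnfounded prog (wellFoundedModel prog) U) : U ⊆ (wellFoundedModel prog).2 := by
  rw [← wellFoundedModel_eq]
  exact Set.subset_sUnion_of_mem h

theorem isHerbrand_of_mem_true {A : Atom P C} (h : A ∈ (wellFoundedModel prog).1) :
    IsHerbrand prog A ∧ InLanguage prog A := by
  obtain ⟨g, hg, rfl, -⟩ := mem_true_iff.1 h
  exact isHerbrand_of_mem_groundInstances hg g.head_mem_atoms

/-- No atom is both true and false: the least fixed point of the alternating operator, together
with the complement of its reduct model, bounds the well-founded model. -/
theorem notMem_false_of_mem_true {A : Atom P C} (h : A ∈ (wellFoundedModel prog).1) :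
    A ∉ (wellFoundedModel prog).2 := by
  set K := (alternatingOperator prog).lfp with hK
  have hfix : {A | ReductModel prog {B | ReductModel prog K B} A} = K :=
    (alternatingOperator prog).map_lfp
  have hle : wellFoundedModel prog ≤ (K, {A | ¬ ReductModel prog K A}) := by
    refine wellFoundedModel_le ⟨?_, ?_⟩
    · rintro _ ⟨g, hg, rfl, hb⟩
      change g.head ∈ K
      rw [← hfix]
      refine .intro g hg (fun B hB => ?_) fun B hB => hb _ hB
      have : B ∈ K := hb _ hB
      rwa [← hfix] at this
    · rintro A ⟨U, ⟨-, hU⟩, hA⟩ hred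
      induction hred with
      | intro g hg hpos hneg ih =>
        obtain ⟨L, hL, hL' | ⟨B, hB, rfl⟩⟩ := hU g hg hA
        · cases L with
          | pos B => exact hL' (hpos B hL)
          | neg B => exact hneg B hL hL'
        · exact ih B hL hB
  have hsub : K ⊆ {B | ReductModel prog K B} := by
    refine (alternatingOperator prog).lfp_le ?_
    change {A | ReductModel prog {B | ReductModel prog {D | ReductModel prog K D} B} A} ≤ _
    rw [show {A | ReductModel prog {D | ReductModel prog K D} A} = K from hfix]
  exact fun h' => hle.2 h' (hsub (hle.1 h))

end Consistency

/-! ### Invariants of SLG-resolution -/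

section Invariant

variable {P C : Type*}

theorem Delayed.Same.refl (d : Delayed P C) : d.Same d := by
  cases d with
  | neg A => exact .neg A
  | pos A call ans => exact .pos A call ans ans (.refl ans)

theorem Node.IsVariant.refl (N : Node P C) : N.IsVariant N := by
  refine ⟨Equiv.refl _, by simp [Atom.rename], ?_, ?_⟩
  · have : Literal.rename (Equiv.refl ℕ) = (id : Literal P C → _) := by
      funext L; simp [Literal.rename]
    simp [this]
  · have : Delayed.subst (fun n => .var (Equiv.refl ℕ n)) = (id : Delayed P C → _) := by
      funext d; cases d <;> simp [Delayed.subst]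
    rw [this, List.map_id]
    exact List.forall₂_same.2 fun d _ => .refl d

theorem Node.finite_vars (N : Node P C) : N.vars.Finite := by
  have h₁ : {n | ∃ d ∈ N.delays, n ∈ d.atom.vars} = ⋃ d ∈ {d | d ∈ N.delays}, d.atom.vars := by
    ext; simp
  have h₂ : {n | ∃ L ∈ N.goals, n ∈ L.atom.vars} = ⋃ L ∈ {L | L ∈ N.goals}, L.atom.vars := by
    ext; simp
  rw [Node.vars, h₁, h₂]
  exact ((Atom.finite_vars _).union ((List.finite_toSet _).biUnion fun d _ => d.atom.finite_vars)).union
    ((List.finite_toSet _).biUnion fun d _ => d.atom.finite_vars)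

theorem _root_.List.Forall₂.exists_right_of_mem {α β : Type*} {r : α → β → Prop} {l : List α}
    {l' : List β} (h : List.Forall₂ r l l') {a : α} (ha : a ∈ l) : ∃ b ∈ l', r a b := by
  induction h with
  | nil => simp at ha
  | cons hab _ ih =>
    rcases List.mem_cons.1 ha with rfl | ha
    · exact ⟨_, List.mem_cons_self, hab⟩
    · obtain ⟨b, hb, hr⟩ := ih ha
      exact ⟨b, List.mem_cons_of_mem _ hb, hr⟩

namespace Forest

/-- Invariants of a node `N` of the tree of `S`.  By `derivation`, each ground instance of the head
of `N` is the head of a ground clause whose body literals are true in the well-founded model or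
correspond to a remaining goal or to a delayed literal of `N`. -/
structure NodeSound (prog : List (Clause P C)) (F : Forest P C) (S : Atom P C) (N : Node P C) :
    Prop where
  subgoal : S ∈ F.subgoals
  head_instance : N.head.IsInstance S
  head_lang : InLanguage prog N.head
  goals_lang : ∀ L ∈ N.goals, InLanguage prog L.atom
  delays_lang : ∀ d ∈ N.delays, InLanguage prog d.atom
  delays_neg : ∀ A, .neg A ∈ N.delays → A.IsGround ∧ A ∈ F.subgoals
  delays_pos : ∀ A call ans, .pos A call ans ∈ N.delays →
    call ∈ F.subgoals ∧ A.IsInstance call ∧ A.IsInstance ans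
  derivation : ∀ σ, IsGrounding prog σ → ∃ g ∈ groundInstances prog, g.head = N.head.subst σ ∧
    ∀ L ∈ g.body, L.TrueIn (wellFoundedModel prog) ∨ (∃ L' ∈ N.goals, L = L'.subst σ) ∨
      ∃ d ∈ N.delays, L = d.literal.subst σ

/-- The reasons for which a node has been disposed of: a negative literal has been removed from its
goals, or is false; a delayed literal has been removed, or is a false negative literal, or is a
positive literal without any supporting answer. -/
def Discarded (prog : List (Clause P C)) (F : Forest P C) (S : Atom P C) (N : Node P C) : Prop :=
  (∃ G₁ A G₂, N.goals = G₁ ++ .neg A :: G₂ ∧ A.IsGround ∧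
    (A ∈ (wellFoundedModel prog).1 ∨ F.HasNode S ⟨N.head, N.delays, G₁ ++ G₂⟩ ∨
      F.HasNode S ⟨N.head, N.delays ++ [.neg A], G₁ ++ G₂⟩)) ∨
  (N.goals = [] ∧ ∃ D₁ d D₂, N.delays = D₁ ++ d :: D₂ ∧
    (F.HasNode S ⟨N.head, D₁ ++ D₂, []⟩ ∨ (∃ A, d = .neg A ∧ A ∈ (wellFoundedModel prog).1) ∨
      ∃ A call ans, d = .pos A call ans ∧ F.DelayedFailed (.pos A call ans)))

/-- The tree of `S` is closed under resolution: all resolvents with clauses are present, and the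
active nodes with goals wait for completed subgoals and have been resolved with all their answers.
An answer of a completed subgoal may have been simplified after it was returned, so that the delays
of the resolvent need not correspond to its present delays. -/
def ClosedTree (prog : List (Clause P C)) (F : Forest P C) (S : Atom P C) : Prop :=
  (∀ N, ClauseResolvent prog S N → F.HasNode S N) ∧
    ∀ N, F.IsActive S N → N.goals ≠ [] →
      ∃ G₁ B G₂, N.goals = G₁ ++ .pos B :: G₂ ∧ ∃ call ∈ F.completed, B.IsVariant call ∧
        ∀ H D, F.IsAnswer call H D → ∀ (ρ : Equiv.Perm ℕ) (θ : ℕ → Term C),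
          Disjoint (H.rename ρ).vars N.vars → Atom.IsMGU θ B (H.rename ρ) →
          ∃ D', F.HasNode S ⟨N.head.subst θ,
            N.delays.map (Delayed.subst θ) ++ returnDelay (B.subst θ) call H D',
            (G₁ ++ G₂).map (Literal.subst θ)⟩

/-- The invariant of SLG-resolution. -/
structure Sound (prog : List (Clause P C)) (F : Forest P C) : Prop where
  subgoals_lang : ∀ S ∈ F.subgoals, InLanguage prog S
  completed_subset : F.completed ⊆ F.subgoals
  nodes : ∀ S N, (S, N) ∈ F.nodes → NodeSound prog F S N
  disposed : ∀ S N, (S, N) ∈ F.disposed → F.Discarded prog S N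
  completed : ∀ S ∈ F.completed, (∃ H, H.IsVariant S ∧ F.IsAnswer S H []) ∨ F.ClosedTree prog S

variable {prog : List (Clause P C)} {R : ComputationRule P C} {F F' : Forest P C}

/-! ### Following a ground clause through a completed tree -/

/-- The ground literal obtained from `d` by `σ` occurs in the body of `g`; if it is positive, then
the answer that `d` refers to is in the table, with delays satisfying `ok`. -/
def Supports (F : Forest P C) (ok : List (Delayed P C) → Prop) (g : Clause P C) (σ : ℕ → Term C)
    (d : Delayed P C) : Prop :=
  d.literal.subst σ ∈ g.body ∧ ∀ A call ans, d = .pos A call ans →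
    ∃ H D, H.IsVariant ans ∧ F.IsAnswer call H D ∧ ok D

/-- The instance of the node `N` under `σ` arises from the ground clause `g`. -/
structure Tracks (F : Forest P C) (ok : List (Delayed P C) → Prop) (g : Clause P C)
    (N : Node P C) (σ : ℕ → Term C) : Prop where
  head : g.head = N.head.subst σ
  goals : ∀ L ∈ N.goals, L.subst σ ∈ g.body
  delays : ∀ d ∈ N.delays, F.Supports ok g σ d

theorem Tracks.of_isVariant {ok : List (Delayed P C) → Prop} {g : Clause P C} {N N' : Node P C}
    {σ : ℕ → Term C} (h : F.Tracks ok g N' σ) {ρ : Equiv.Perm ℕ}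
    (h₁ : N'.head = N.head.rename ρ) (h₂ : N'.goals = N.goals.map (Literal.rename ρ))
    (h₃ : List.Forall₂ Delayed.Same (N.delays.map (Delayed.subst fun n => .var (ρ n))) N'.delays) :
    F.Tracks ok g N fun n => σ (ρ n) := by
  refine ⟨?_, fun L hL => ?_, fun d hd => ?_⟩
  · rw [h.head, h₁, Atom.subst_rename]
  · rw [← Literal.subst_rename]
    refine h.goals _ ?_
    rw [h₂]
    exact List.mem_map_of_mem hL
  · obtain ⟨d', hd', hs⟩ := h₃.exists_right_of_mem (List.mem_map_of_mem hd)
    obtain ⟨h₄, h₅⟩ := h.delays d' hd'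
    have hlit : d'.literal = d.literal.rename ρ := by
      rw [Literal.rename, ← Delayed.literal_subst]
      revert hs
      generalize d.subst (fun n => .var (ρ n)) = e
      intro hs
      cases hs <;> rfl
    refine ⟨by rwa [hlit, Literal.subst_rename] at h₄, ?_⟩
    rintro A call ans rfl
    cases hs with
    | pos _ _ _ ans' hv =>
      obtain ⟨H, D, hH, hA, ho⟩ := h₅ _ _ _ rfl
      exact ⟨H, D, hH.trans hv.symm, hA, ho⟩

theorem HasNode.tracks {ok : List (Delayed P C) → Prop} {g : Clause P C} {S : Atom P C}
    {N : Node P C} {σ : ℕ → Term C} (hN : F.HasNode S N) (hσ : IsGrounding prog σ)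
    (h : F.Tracks ok g N σ) : ∃ N' σ', (S, N') ∈ F.nodes ∧ IsGrounding prog σ' ∧
      F.Tracks ok g N' σ' ∧ N'.goals.length = N.goals.length ∧
      N'.delays.length = N.delays.length := by
  obtain ⟨N', hN', ρ, h₁, h₂, h₃⟩ := hN
  refine ⟨N', _, hN', fun n => hσ (ρ n), h.of_isVariant h₁ h₂ h₃, by simp [h₂], ?_⟩
  simpa using h₃.length_eq

/-- A ground clause whose positive body literals are covered by answers, and whose negative ones
are not false, can be followed from a node of a closed tree to an answer. -/
theorem Sound.exists_answer_of_tracks (hF : F.Sound prog) {ok : List (Delayed P C) → Prop}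
    {S : Atom P C} (hS : F.ClosedTree prog S) {g : Clause P C} (hg : g ∈ groundInstances prog)
    (hneg : ∀ A, .neg A ∈ g.body → A ∉ (wellFoundedModel prog).1)
    (hpos : ∀ B, .pos B ∈ g.body → ∀ call ∈ F.completed, B.IsInstance call →
      ∃ H D, F.IsAnswer call H D ∧ ok D ∧ B.IsInstance H)
    (k : ℕ) (N : Node P C) (σ : ℕ → Term C) (hN : (S, N) ∈ F.nodes) (hσ : IsGrounding prog σ)
    (ht : F.Tracks ok g N σ) (hk : 2 * N.goals.length + N.delays.length = k) :
    ∃ H D σ, F.IsAnswer S H D ∧ IsGrounding prog σ ∧ g.head = H.subst σ ∧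
      ∀ d ∈ D, F.Supports ok g σ d := by
  induction k using Nat.strong_induction_on generalizing N σ with
  | _ k ih =>
  have next (N' : Node P C) (σ' : ℕ → Term C) (hN' : F.HasNode S N') (hσ' : IsGrounding prog σ')
      (ht' : F.Tracks ok g N' σ') (hlt : 2 * N'.goals.length + N'.delays.length < k) :
      ∃ H D σ, F.IsAnswer S H D ∧ IsGrounding prog σ ∧ g.head = H.subst σ ∧
        ∀ d ∈ D, F.Supports ok g σ d := by
    obtain ⟨N'', σ'', h₁, h₂, h₃, h₄, h₅⟩ := hN'.tracks hσ' ht'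
    exact ih _ hlt N'' σ'' h₁ h₂ h₃ (by rw [h₄, h₅])
  by_cases hact : (S, N) ∈ F.disposed
  · rcases hF.disposed S N hact with ⟨G₁, A, G₂, hG, hA, h⟩ | ⟨hG, D₁, d, D₂, hD, h⟩
    · have hL : .neg A ∈ g.body := by
        have := ht.goals (.neg A) (by simp [hG])
        rwa [Literal.subst, hA.subst_eq] at this
      have hsub : ∀ L ∈ G₁ ++ G₂, L.subst σ ∈ g.body := fun L hL => ht.goals L <| by
        rw [hG]; simp only [List.mem_append, List.mem_cons] at hL ⊢; tauto
      have hlen : N.goals.length = (G₁ ++ G₂).length + 1 := by simp [hG]; omega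
      rcases h with h | h | h
      · exact (hneg A hL h).elim
      · refine next _ σ h hσ ⟨ht.head, hsub, ht.delays⟩ ?_
        dsimp only
        omega
      · refine next _ σ h hσ ⟨ht.head, hsub, fun d hd => ?_⟩ ?_
        · rcases List.mem_append.1 hd with hd | hd
          · exact ht.delays d hd
          · obtain rfl := List.mem_singleton.1 hd
            refine ⟨?_, fun _ _ _ h => by cases h⟩
            simpa [Delayed.literal, Literal.subst, hA.subst_eq] using hL
        · simp only [List.length_append, List.length_singleton] at hlen ⊢
          omega
    · have hd : F.Supports ok g σ d := ht.delays d (by simp [hD])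
      rcases h with h | ⟨A, rfl, hA⟩ | ⟨A, call, ans, rfl, h⟩
      · refine next _ σ h hσ ⟨ht.head, by simp, fun d hd => ht.delays d ?_⟩ ?_
        · rw [hD]; simp only [List.mem_append, List.mem_cons] at hd ⊢; tauto
        · simp only [hD, hG, List.length_append, List.length_cons, List.length_nil] at hk ⊢
          omega
      · have hAg := (hF.nodes S N hN).delays_neg A (by simp [hD])
        have := hd.1
        rw [Delayed.literal, Literal.subst, hAg.1.subst_eq] at this
        exact (hneg A this hA).elim
      · obtain ⟨H, D, hH, hA, -⟩ := hd.2 _ _ _ rfl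
        exact (h.2 H D hH hA).elim
  · by_cases hgoals : N.goals = []
    · obtain ⟨H, D, G⟩ := N
      obtain rfl : G = [] := hgoals
      exact ⟨H, D, σ, ⟨hN, hact⟩, hσ, ht.head, ht.delays⟩
    · obtain ⟨G₁, B, G₂, hG, call, hcall, hv, hres⟩ := hS.2 N ⟨hN, hact⟩ hgoals
      have hB : .pos (B.subst σ) ∈ g.body := ht.goals (.pos B) (by simp [hG])
      obtain ⟨H, D, hA, hok, hBH⟩ := hpos _ hB call hcall (hv.symm.isInstance.subst σ)
      have hherb := (isHerbrand_of_mem_groundInstances hg (Clause.atom_mem_atoms hB)).1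
      obtain ⟨σ', hσ', he⟩ := hherb.exists_isGrounding hBH
      have hBv : B.vars ⊆ N.vars := fun n hn =>
        Or.inr ⟨.pos B, by simp [hG], hn⟩
      obtain ⟨ρ, θ, τ, hρ, hθ, hτ, hτσ, -⟩ := exists_isMGU_rename N.finite_vars H.finite_vars
        hBv subset_rfl hσ hσ' he
      have hdisj : Disjoint (H.rename ρ).vars N.vars := by
        rw [Set.disjoint_left]
        intro n hn hn'
        rw [Atom.mem_vars_rename] at hn
        exact hρ _ hn (by simpa using hn')
      obtain ⟨D', hD'⟩ := hres H D hA ρ θ hdisj hθ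
      refine next _ τ hD' hτ ⟨?_, fun L hL => ?_, fun d hd => ?_⟩ ?_
      · rw [ht.head, Atom.subst_subst]
        exact Atom.subst_congr fun n hn => (hτσ n (Or.inl (Or.inl hn))).symm
      · obtain ⟨L, hL', rfl⟩ := List.mem_map.1 hL
        have hLN : L ∈ N.goals := by
          rw [hG]; simp only [List.mem_append, List.mem_cons] at hL' ⊢; tauto
        have := ht.goals L hLN
        rwa [Literal.subst_subst, Literal.subst_congr fun n hn => hτσ n (Or.inr ⟨L, hLN, hn⟩)]
      · rcases List.mem_append.1 hd with hd | hd
        · obtain ⟨d, hd', rfl⟩ := List.mem_map.1 hd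
          obtain ⟨h₁, h₂⟩ := ht.delays d hd'
          constructor
          · rw [Delayed.literal_subst, Literal.subst_subst,
              Literal.subst_congr fun n hn => hτσ n (Or.inl (Or.inr ⟨d, hd', ?_⟩))]
            · exact h₁
            · cases d <;> exact hn
          · rintro A call ans h
            cases d with
            | neg A => cases h
            | pos A' call' ans' =>
              simp only [Delayed.subst, Delayed.pos.injEq] at h
              obtain ⟨-, rfl, rfl⟩ := h
              exact h₂ _ _ _ rfl
        · have hd : d = .pos (B.subst θ) call H := by
            cases D' with
            | nil => simp [returnDelay] at hd
            | cons => simpa [returnDelay] using hd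
          subst hd
          refine ⟨?_, ?_⟩
          · simp only [Delayed.literal, Literal.subst]
            rwa [Atom.subst_subst, Atom.subst_congr fun n hn => hτσ n (hBv hn)]
          · intro A call' ans h
            cases h
            exact ⟨H, D, .refl H, hA, hok⟩
      · have hlen : (returnDelay (B.subst θ) call H D').length ≤ 1 := by
          cases D' <;> simp [returnDelay]
        simp only [hG, List.length_append, List.length_map, List.length_cons] at hk ⊢
        omega

/-- A ground clause for an instance of a completed subgoal leads to an answer, if its positive
literals are covered by answers with delays satisfying `ok` and its negative literals are not
false.  The delays of the answer found are supported in the same sense. -/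
theorem Sound.exists_answer (hF : F.Sound prog) {ok : List (Delayed P C) → Prop}
    {S : Atom P C} (hS : S ∈ F.completed) {g : Clause P C} (hg : g ∈ groundInstances prog)
    (hgS : g.head.IsInstance S) (hneg : ∀ A, .neg A ∈ g.body → A ∉ (wellFoundedModel prog).1)
    (hpos : ∀ B, .pos B ∈ g.body → ∀ call ∈ F.completed, B.IsInstance call →
      ∃ H D, F.IsAnswer call H D ∧ ok D ∧ B.IsInstance H) :
    ∃ H D σ, F.IsAnswer S H D ∧ IsGrounding prog σ ∧ g.head = H.subst σ ∧
      ∀ d ∈ D, F.Supports ok g σ d := by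
  have hherb := (isHerbrand_of_mem_groundInstances hg g.head_mem_atoms).1
  rcases hF.completed S hS with ⟨H, hH, hA⟩ | hcl
  · obtain ⟨σ, hσ, he⟩ := hherb.exists_isGrounding (hgS.trans hH.isInstance)
    exact ⟨H, [], σ, hA, hσ, he, by simp⟩
  · obtain ⟨c, hc, σ', hσ', rfl⟩ := id hg
    obtain ⟨σ, hσ, he⟩ := hherb.exists_isGrounding hgS
    obtain ⟨ρ, θ, τ, hρ, hθ, hτ, hτσ, hτσ'⟩ := exists_isMGU_rename S.finite_vars c.finite_vars
      subset_rfl (fun n hn => ⟨_, c.head_mem_atoms, hn⟩) hσ hσ' he.symm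
    have hdisj : Disjoint (c.rename ρ).vars S.vars := by
      rw [Set.disjoint_left]
      intro n hn hn'
      rw [Clause.mem_vars_rename] at hn
      exact hρ _ hn (by simpa using hn')
    have hnode := hcl.1 _ ⟨c, hc, ρ, θ, hdisj, hθ, rfl⟩
    have htr : F.Tracks ok (c.subst σ')
        ⟨S.subst θ, [], (c.rename ρ).body.map (Literal.subst θ)⟩ τ := by
      refine ⟨?_, fun L hL => ?_, by simp⟩
      · rw [he, Atom.subst_subst]
        exact Atom.subst_congr fun n hn => (hτσ n hn).symm
      · simp only [Clause.rename, Clause.subst, List.map_map, List.mem_map,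
          Function.comp_apply] at hL ⊢
        obtain ⟨L, hL, rfl⟩ := hL
        refine ⟨L, hL, ?_⟩
        rw [Literal.subst_subst, Literal.subst_subst]
        refine Literal.subst_congr fun n hn => ?_
        simpa [Term.subst] using (hτσ' n ⟨_, Clause.atom_mem_atoms hL, hn⟩).symm
    obtain ⟨N', τ', h₁, h₂, h₃, -, -⟩ := hnode.tracks hτ htr
    exact hF.exists_answer_of_tracks hcl hg hneg hpos _ N' τ' h₁ h₂ h₃ rfl

/-! ### Soundness of tables -/

/-- Instances of a completed subgoal that are not covered by its answers are false: all of them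
together form an unfounded set. -/
theorem Sound.mem_false (hF : F.Sound prog) {S A : Atom P C} (hS : S ∈ F.completed)
    (hA : IsHerbrand prog A) (hAS : A.IsInstance S)
    (hno : ∀ H D, F.IsAnswer S H D → ¬ A.IsInstance H) : A ∈ (wellFoundedModel prog).2 := by
  refine subset_false_of_isUnfounded (U := {A | IsHerbrand prog A ∧ ∃ S ∈ F.completed,
    A.IsInstance S ∧ ∀ H D, F.IsAnswer S H D → ¬ A.IsInstance H}) ⟨?_, ?_⟩
    ⟨hA, S, hS, hAS, hno⟩
  · rintro A ⟨hA, S, hS, ⟨σ, rfl⟩, -⟩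
    obtain ⟨c, hc, B, hB, h⟩ := (hF.subgoals_lang S (hF.completed_subset hS)).1
    exact ⟨⟨c, hc, B, hB, by simpa using h⟩, hA⟩
  · rintro g hg ⟨-, S, hS, hgS, hno⟩
    by_contra! hcon
    obtain ⟨H, D, σ, h₁, -, h₂, -⟩ := hF.exists_answer (ok := fun _ => True) hS hg hgS
      (fun A hA => (hcon _ hA).1) fun B hB call hcall hBc => by
        by_contra! h
        refine (hcon _ hB).2 B ⟨?_, call, hcall, hBc, fun H D hH => h H D hH trivial⟩ rfl
        exact (isHerbrand_of_mem_groundInstances hg (Clause.atom_mem_atoms hB)).1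
    exact hno H D h₁ ⟨σ, h₂⟩

/-- Ground instances of unconditional answers are true. -/
theorem Sound.mem_true (hF : F.Sound prog) {S H A : Atom P C} (hH : F.IsAnswer S H [])
    (hA : IsHerbrand prog A) (hAH : A.IsInstance H) : A ∈ (wellFoundedModel prog).1 := by
  obtain ⟨σ, hσ, rfl⟩ := hA.exists_isGrounding hAH
  obtain ⟨g, hg, hgh, hb⟩ := (hF.nodes _ _ hH.1).derivation σ hσ
  exact mem_true_iff.2 ⟨g, hg, hgh, fun L hL => by simpa using hb L hL⟩

theorem Sound.mem_true_of_succeeded (hF : F.Sound prog) {A : Atom P C} (hA : A.IsGround)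
    (h : F.Succeeded A) : A ∈ (wellFoundedModel prog).1 :=
  hF.mem_true h (hA.isHerbrand (hF.nodes _ _ h.1).head_lang) (.refl A)

theorem Sound.mem_false_of_failed (hF : F.Sound prog) {A : Atom P C} (hA : A.IsGround)
    (h : F.Failed A) : A ∈ (wellFoundedModel prog).2 :=
  hF.mem_false h.1 (hA.isHerbrand (hF.subgoals_lang _ (hF.completed_subset h.1))) (.refl A)
    fun H D hH => (h.2 H D hH).elim

theorem Sound.delayed_trueIn (hF : F.Sound prog) {S : Atom P C} {N : Node P C}
    (hN : (S, N) ∈ F.nodes) {d : Delayed P C} (hd : d ∈ N.delays) (h : F.DelayedSucceeded d)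
    {σ : ℕ → Term C} (hσ : IsGrounding prog σ) :
    (d.literal.subst σ).TrueIn (wellFoundedModel prog) := by
  have hs := hF.nodes S N hN
  cases d with
  | neg A =>
    have hA := (hs.delays_neg A hd).1
    rw [Delayed.literal, Literal.subst, hA.subst_eq]
    exact hF.mem_false_of_failed hA h
  | pos A call ans =>
    obtain ⟨H, hH, hA⟩ := h
    exact hF.mem_true hA ((hs.delays_lang _ hd).isHerbrand_subst hσ)
      (((hs.delays_pos _ _ _ hd).2.2.trans hH.isInstance).subst σ)

end Forest

end Invariant

/-! ### Preservation of the invariant -/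

section Preservation

variable {P C : Type*}

namespace Forest

variable {prog : List (Clause P C)} {R : ComputationRule P C} {F F' : Forest P C}

theorem NodeSound.mono {S : Atom P C} {N : Node P C} (h : NodeSound prog F S N)
    (hs : F.subgoals ⊆ F'.subgoals) : NodeSound prog F' S N where
  subgoal := hs h.subgoal
  head_instance := h.head_instance
  head_lang := h.head_lang
  goals_lang := h.goals_lang
  delays_lang := h.delays_lang
  delays_neg A hA := ⟨(h.delays_neg A hA).1, hs (h.delays_neg A hA).2⟩
  delays_pos A call ans hA := ⟨hs (h.delays_pos A call ans hA).1, (h.delays_pos A call ans hA).2⟩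
  derivation := h.derivation

theorem HasNode.mono {S : Atom P C} {N : Node P C} (h : F.HasNode S N) (hn : F.nodes ⊆ F'.nodes) :
    F'.HasNode S N := by
  obtain ⟨N', h₁, h₂⟩ := h
  exact ⟨N', hn h₁, h₂⟩

theorem hasNode_of_mem {S : Atom P C} {N : Node P C} (h : (S, N) ∈ F.nodes) : F.HasNode S N :=
  ⟨N, h, .refl N⟩

theorem hasNode_addNode (F : Forest P C) (S : Atom P C) (N : Node P C) :
    (F.addNode S N).HasNode S N := by
  by_cases h : F.HasNode S N
  · exact h.mono Set.subset_union_left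
  · exact hasNode_of_mem (Or.inr ⟨rfl, h⟩)

/-- The invariant is preserved when the forest grows, if new nodes and new disposals satisfy the
invariant, completed trees only get simplified answers, and unconditional answers are kept. -/
theorem Sound.of_extension (hF : F.Sound prog) (hs : F.subgoals ⊆ F'.subgoals)
    (hs' : ∀ S ∈ F'.subgoals, InLanguage prog S) (hn : F.nodes ⊆ F'.nodes)
    (hn' : ∀ S N, (S, N) ∈ F'.nodes → (S, N) ∉ F.nodes → NodeSound prog F' S N)
    (hd : F.disposed ⊆ F'.disposed)
    (hd' : ∀ S N, (S, N) ∈ F'.disposed → (S, N) ∉ F.disposed → F'.Discarded prog S N)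
    (hc : F.completed ⊆ F'.completed) (hc' : F'.completed ⊆ F'.subgoals)
    (hnew : ∀ S N, S ∈ F.completed → (S, N) ∈ F'.nodes → (S, N) ∉ F.nodes →
      N.goals = [] ∧ ∃ D, F.IsAnswer S N.head D)
    (hun : ∀ S H, F.IsAnswer S H [] → (S, ⟨H, [], []⟩) ∉ F'.disposed)
    (hcl : ∀ S ∈ F'.completed, S ∉ F.completed →
      (∃ H, H.IsVariant S ∧ F'.IsAnswer S H []) ∨ F'.ClosedTree prog S) : F'.Sound prog := by
  have hact : ∀ S N, S ∈ F.completed → F'.IsActive S N →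
      F.IsActive S N ∨ N.goals = [] ∧ ∃ D, F.IsAnswer S N.head D := by
    intro S N hS hN
    by_cases h : (S, N) ∈ F.nodes
    · exact Or.inl ⟨h, fun h' => hN.2 (hd h')⟩
    · exact Or.inr (hnew S N hS hN.1 h)
  have hans : ∀ S H D, S ∈ F.completed → F'.IsAnswer S H D → ∃ D', F.IsAnswer S H D' := by
    intro S H D hS hH
    rcases hact S _ hS hH with h | h
    · exact ⟨D, h⟩
    · exact h.2
  refine ⟨hs', hc', fun S N hN => ?_, fun S N hN => ?_, fun S hS => ?_⟩
  · by_cases h : (S, N) ∈ F.nodes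
    · exact (hF.nodes S N h).mono hs
    · exact hn' S N hN h
  · by_cases h : (S, N) ∈ F.disposed
    · rcases hF.disposed S N h with ⟨G₁, A, G₂, hG, hA, h⟩ | ⟨hG, D₁, d, D₂, hD, h⟩
      · refine Or.inl ⟨G₁, A, G₂, hG, hA, ?_⟩
        rcases h with h | h | h
        exacts [Or.inl h, Or.inr (Or.inl (h.mono hn)), Or.inr (Or.inr (h.mono hn))]
      · refine Or.inr ⟨hG, D₁, d, D₂, hD, ?_⟩
        rcases h with h | h | ⟨A, call, ans, rfl, h₁, h₂⟩
        · exact Or.inl (h.mono hn)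
        · exact Or.inr (Or.inl h)
        · refine Or.inr (Or.inr ⟨A, call, ans, rfl, hc h₁, fun H D hH hA => ?_⟩)
          obtain ⟨D', hA'⟩ := hans call H D h₁ hA
          exact h₂ H D' hH hA'
    · exact hd' S N hN h
  · by_cases h : S ∈ F.completed
    · rcases hF.completed S h with ⟨H, hH, hA⟩ | ⟨h₁, h₂⟩
      · exact Or.inl ⟨H, hH, hn hA.1, hun S H hA⟩
      · refine Or.inr ⟨fun N hN => (h₁ N hN).mono hn, fun N hN hgoals => ?_⟩
        have hN' : F.IsActive S N := (hact S N h hN).resolve_right fun h => hgoals h.1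
        obtain ⟨G₁, B, G₂, hG, call, hcall, hv, hres⟩ := h₂ N hN' hgoals
        refine ⟨G₁, B, G₂, hG, call, hc hcall, hv, fun H D hA ρ θ hdisj hθ => ?_⟩
        obtain ⟨D', hA'⟩ := hans call H D hcall hA
        obtain ⟨D'', hD''⟩ := hres H D' hA' ρ θ hdisj hθ
        exact ⟨D'', hD''.mono hn⟩
    · exact hcl S hS h

theorem Sound.init {A : Atom P C} (hA : InLanguage prog A) : (Forest.init A).Sound prog where
  subgoals_lang := by rintro _ rfl; exact hA
  completed_subset := Set.empty_subset _
  nodes _ _ h := h.elim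
  disposed _ _ h := h.elim
  completed _ h := h.elim

/-- Adding nodes to trees that are not completed, and disposing of nodes with goals. -/
theorem Sound.addNode_dispose (hF : F.Sound prog) {S : Atom P C} {N : Node P C}
    {U : Set (Atom P C × Node P C)} (hS : S ∉ F.completed) (hN : NodeSound prog F S N)
    (hU : ∀ S' N', (S', N') ∈ U → N'.goals ≠ [] ∧ (F.addNode S N).Discarded prog S' N') :
    ((F.addNode S N).dispose U).Sound prog := by
  refine hF.of_extension (F' := (F.addNode S N).dispose U) subset_rfl hF.subgoals_lang
    Set.subset_union_left ?_ Set.subset_union_left ?_ subset_rfl hF.completed_subset ?_ ?_ ?_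
  · rintro S' N' (h | ⟨h, -⟩) h'
    · exact (h' h).elim
    · cases h; exact hN.mono subset_rfl
  · rintro S' N' (h | h) h'
    · exact (h' h).elim
    · obtain ⟨hg, h⟩ := hU S' N' h
      rcases h with h | h
      · exact Or.inl h
      · exact (hg h.1).elim
  · rintro S' N' hS' (h | ⟨h, -⟩) h'
    · exact (h' h).elim
    · cases h; exact (hS hS').elim
  · rintro S' H hH (h | h)
    · exact hH.2 h
    · exact (hU _ _ h).1 rfl
  · exact fun S h h' => (h' h).elim

theorem Sound.addNode (hF : F.Sound prog) {S : Atom P C} {N : Node P C} (hS : S ∉ F.completed)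
    (hN : NodeSound prog F S N) : (F.addNode S N).Sound prog := by
  have := hF.addNode_dispose (U := ∅) hS hN (by simp)
  simpa [dispose] using this

theorem Sound.dispose (hF : F.Sound prog) {U : Set (Atom P C × Node P C)}
    (hun : ∀ S H, (S, ⟨H, [], []⟩) ∉ U)
    (hU : ∀ S N, (S, N) ∈ U → (F.dispose U).Discarded prog S N) : (F.dispose U).Sound prog := by
  refine hF.of_extension (F' := F.dispose U) subset_rfl hF.subgoals_lang
    subset_rfl (fun _ _ h h' => (h' h).elim) Set.subset_union_left ?_ subset_rfl
    hF.completed_subset (fun _ _ _ h h' => (h' h).elim) ?_ (fun S h h' => (h' h).elim)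
  · rintro S N (h | h) h'
    · exact (h' h).elim
    · exact hU S N h
  · rintro S H hH (h | h)
    · exact hH.2 h
    · exact hun _ _ h

theorem Sound.complete (hF : F.Sound prog) {E : Set (Atom P C)} (hE : E ⊆ F.subgoals)
    (hev : CompletelyEvaluated prog R F E) : (F.complete E).Sound prog := by
  refine hF.of_extension (F' := F.complete E) subset_rfl hF.subgoals_lang
    subset_rfl (fun _ _ h h' => (h' h).elim) subset_rfl (fun _ _ h h' => (h' h).elim)
    Set.subset_union_left (Set.union_subset hF.completed_subset hE)
    (fun _ _ _ h h' => (h' h).elim) (fun S H h => h.2) ?_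
  rintro S (hS | hS) h
  · exact (h hS).elim
  · rcases hev S hS with h | ⟨h₁, h₂⟩
    · exact Or.inl h
    · refine Or.inr ⟨h₁, fun N hN hgoals => ?_⟩
      obtain ⟨⟨G₁, B, G₂, hsel, call, hcall, hv, hcall'⟩, hres⟩ := h₂ N hN hgoals
      refine ⟨G₁, B, G₂, hsel.1, call, hcall', hv, fun H D hA ρ θ hdisj hθ => ⟨D, ?_⟩⟩
      exact hres _ ⟨G₁, B, G₂, hsel, call, hcall, hv, H, D, hA, ρ, θ, hdisj, hθ, rfl⟩

theorem Sound.nodeSound_clauseResolvent (hF : F.Sound prog) {S : Atom P C} {N : Node P C}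
    (hS : S ∈ F.subgoals) (hN : ClauseResolvent prog S N) : NodeSound prog F S N := by
  obtain ⟨c, hc, ρ, θ, -, hθ, rfl⟩ := hN
  have hlS := hF.subgoals_lang S hS
  have hlc : ∀ A ∈ (c.rename ρ).atoms, InLanguage prog A := by
    intro A hA
    rw [Clause.atoms_rename] at hA
    obtain ⟨B, hB, rfl⟩ := List.mem_map.1 hA
    exact (inLanguage_of_mem_atoms hc hB).rename ρ
  have hcons := hθ.consts_subset hlS.2 (hlc _ (Clause.head_mem_atoms _)).2
  refine ⟨hS, ⟨θ, rfl⟩, hlS.subst hcons, fun L hL => ?_, by simp, by simp, by simp,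
    fun σ hσ => ?_⟩
  · obtain ⟨L, hL', rfl⟩ := List.mem_map.1 hL
    rw [Literal.atom_subst]
    exact (hlc _ (Clause.atom_mem_atoms hL')).subst hcons
  · refine ⟨(c.rename ρ).subst fun n => (θ n).subst σ, ⟨c, hc, fun n => (θ (ρ n)).subst σ,
      fun n => subst_mem_herbrandUniverse (hcons _) hσ, Clause.subst_rename _ _ _⟩, ?_,
      fun L hL => Or.inr (Or.inl ?_)⟩
    · rw [hθ.1, Atom.subst_subst]
      rfl
    · obtain ⟨L, hL', rfl⟩ := List.mem_map.1 hL
      exact ⟨_, List.mem_map_of_mem hL', (Literal.subst_subst _ _ _).symm⟩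

theorem Sound.nodeSound_answerResolvent (hF : F.Sound prog) {S : Atom P C} {N N' : Node P C}
    (hN : F.IsActive S N) (hN' : AnswerResolvent R F N N') : NodeSound prog F S N' := by
  obtain ⟨G₁, B, G₂, ⟨hG, -⟩, call, hcall, hv, H, D, hA, ρ, θ, -, hθ, rfl⟩ := hN'
  have hs := hF.nodes S N hN.1
  have ha := hF.nodes call _ hA.1
  have hB : InLanguage prog B := hs.goals_lang (.pos B) (by simp [hG])
  have hcons := hθ.consts_subset hB.2 (ha.head_lang.rename ρ).2
  have hgoal : ∀ L ∈ G₁ ++ G₂, L ∈ N.goals := fun L hL => by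
    rw [hG]; simp only [List.mem_append, List.mem_cons] at hL ⊢; tauto
  have hret : ∀ d ∈ returnDelay (B.subst θ) call H D, d = .pos (B.subst θ) call H := by
    cases D <;> simp [returnDelay]
  refine ⟨hs.subgoal, hs.head_instance.subst θ, hs.head_lang.subst hcons, fun L hL => ?_,
    fun d hd => ?_, fun A hd => ?_, fun A call' ans hd => ?_, fun σ hσ => ?_⟩
  · obtain ⟨L, hL', rfl⟩ := List.mem_map.1 hL
    rw [Literal.atom_subst]
    exact (hs.goals_lang L (hgoal L hL')).subst hcons
  · rcases List.mem_append.1 hd with hd | hd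
    · obtain ⟨d, hd', rfl⟩ := List.mem_map.1 hd
      rw [Delayed.atom_subst]
      exact (hs.delays_lang d hd').subst hcons
    · rw [hret d hd]
      exact hB.subst hcons
  · rcases List.mem_append.1 hd with hd | hd
    · obtain ⟨d, hd', hd⟩ := List.mem_map.1 hd
      cases d with
      | neg A' =>
        have h := hs.delays_neg A' hd'
        simp only [Delayed.subst, h.1.subst_eq, Delayed.neg.injEq] at hd
        rwa [← hd]
      | pos => cases hd
    · cases hret _ hd
  · rcases List.mem_append.1 hd with hd | hd
    · obtain ⟨d, hd', hd⟩ := List.mem_map.1 hd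
      cases d with
      | neg A' => cases hd
      | pos A' _ _ =>
        simp only [Delayed.subst, Delayed.pos.injEq] at hd
        obtain ⟨rfl, rfl, rfl⟩ := hd
        obtain ⟨h₁, h₂, h₃⟩ := hs.delays_pos _ _ _ hd'
        exact ⟨h₁, h₂.subst θ, h₃.subst θ⟩
    · cases hret _ hd
      refine ⟨hcall, hv.symm.isInstance.subst θ, ?_⟩
      rw [hθ.1]
      exact Atom.IsInstance.subst ⟨_, rfl⟩ θ
  · have hσ' : IsGrounding prog fun n => (θ n).subst σ :=
      fun n => subst_mem_herbrandUniverse (hcons n) hσ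
    obtain ⟨g, hg, hgh, hb⟩ := hs.derivation _ hσ'
    refine ⟨g, hg, by rw [hgh, Atom.subst_subst], fun L hL => ?_⟩
    rcases hb L hL with h | ⟨L', hL', rfl⟩ | ⟨d, hd, rfl⟩
    · exact Or.inl h
    · rw [hG] at hL'
      rcases (by simpa [or_left_comm] using hL' : L' = .pos B ∨ L' ∈ G₁ ∨ L' ∈ G₂) with rfl | hL'
      · simp only [Literal.subst]
        rw [← Atom.subst_subst]
        cases D with
        | nil =>
          left
          refine hF.mem_true hA ((hB.subst hcons).isHerbrand_subst hσ) ?_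
          rw [hθ.1]
          exact Atom.IsInstance.subst (Atom.IsInstance.subst ⟨_, rfl⟩ θ) σ
        | cons d D =>
          exact Or.inr (Or.inr ⟨.pos (B.subst θ) call H, by simp [returnDelay], rfl⟩)
      · exact Or.inr (Or.inl ⟨L'.subst θ, List.mem_map_of_mem (List.mem_append.2 hL'),
          (Literal.subst_subst _ _ _).symm⟩)
    · refine Or.inr (Or.inr ⟨d.subst θ, List.mem_append_left _ (List.mem_map_of_mem hd), ?_⟩)
      rw [Delayed.literal_subst, Literal.subst_subst]

/-- Operations of SLG-resolution preserve the invariant. -/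
theorem Sound.step (hF : F.Sound prog) (h : Step prog R F F') : F'.Sound prog := by
  cases h with
  | newSubgoal S N G₁ G₂ L hS hN hsel hL hnew =>
    have hs := hF.nodes S N hN.1
    refine hF.of_extension (F' := F.addSubgoal L.atom) (Set.subset_insert _ _) ?_
      subset_rfl (fun _ _ h h' => (h' h).elim) subset_rfl (fun _ _ h h' => (h' h).elim)
      subset_rfl (hF.completed_subset.trans (Set.subset_insert _ _))
      (fun _ _ _ h h' => (h' h).elim) (fun S H h => h.2) (fun _ h h' => (h' h).elim)
    rintro S' (rfl | hS')
    · exact hs.goals_lang L (by simp [hsel.1])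
    · exact hF.subgoals_lang S' hS'
  | clauseResolution S N hSF hS hres hnew =>
    exact hF.addNode hS (hF.nodeSound_clauseResolvent hSF hres)
  | positiveReturn S N N' hS hN hres hnew =>
    exact hF.addNode hS (hF.nodeSound_answerResolvent hN hres)
  | negationSuccess S N G₁ G₂ A hS hN hsel hA hf =>
    have hs := hF.nodes S N hN.1
    have hG := hsel.1
    have hgoal : ∀ L ∈ G₁ ++ G₂, L ∈ N.goals := fun L hL => by
      rw [hG]; simp only [List.mem_append, List.mem_cons] at hL ⊢; tauto
    refine hF.addNode_dispose hS ?_ ?_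
    · refine { hs with goals_lang := fun L hL => hs.goals_lang L (hgoal L hL), derivation := ?_ }
      intro σ hσ
      obtain ⟨g, hg, hgh, hb⟩ := hs.derivation σ hσ
      refine ⟨g, hg, hgh, fun L hL => ?_⟩
      rcases hb L hL with h | ⟨L', hL', rfl⟩ | h
      · exact Or.inl h
      · rw [hG] at hL'
        rcases (by simpa [or_left_comm] using hL' : L' = .neg A ∨ L' ∈ G₁ ∨ L' ∈ G₂)
          with rfl | hL'
        · rw [Literal.subst, hA.subst_eq]
          exact Or.inl (hF.mem_false_of_failed hA hf)
        · exact Or.inr (Or.inl ⟨L', List.mem_append.2 hL', rfl⟩)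
      · exact Or.inr (Or.inr h)
    · rintro S' N' h
      cases h
      exact ⟨by simp [hG], Or.inl ⟨G₁, A, G₂, hG, hA, Or.inr (Or.inl (hasNode_addNode _ _ _))⟩⟩
  | negationFailure S N G₁ G₂ A hS hN hsel hA hs =>
    have hG := hsel.1
    refine hF.dispose ?_ ?_
    · rintro S' H h
      cases h
      simp at hG
    · rintro S' N' h
      cases h
      exact Or.inl ⟨G₁, A, G₂, hG, hA, Or.inl (hF.mem_true_of_succeeded hA hs)⟩
  | delaying S N G₁ G₂ A hS hN hsel hA hAF hf hs' =>
    have hs := hF.nodes S N hN.1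
    have hG := hsel.1
    have hgoal : ∀ L ∈ G₁ ++ G₂, L ∈ N.goals := fun L hL => by
      rw [hG]; simp only [List.mem_append, List.mem_cons] at hL ⊢; tauto
    refine hF.addNode_dispose hS ?_ ?_
    · refine ⟨hs.subgoal, hs.head_instance, hs.head_lang,
        fun L hL => hs.goals_lang L (hgoal L hL), fun d hd => ?_, fun A' hd => ?_,
        fun A' call ans hd => ?_, fun σ hσ => ?_⟩
      · rcases List.mem_append.1 hd with hd | hd
        · exact hs.delays_lang d hd
        · obtain rfl := List.mem_singleton.1 hd
          exact hF.subgoals_lang A hAF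
      · rcases List.mem_append.1 hd with hd | hd
        · exact hs.delays_neg A' hd
        · cases List.mem_singleton.1 hd
          exact ⟨hA, hAF⟩
      · rcases List.mem_append.1 hd with hd | hd
        · exact hs.delays_pos A' call ans hd
        · cases List.mem_singleton.1 hd
      · obtain ⟨g, hg, hgh, hb⟩ := hs.derivation σ hσ
        refine ⟨g, hg, hgh, fun L hL => ?_⟩
        rcases hb L hL with h | ⟨L', hL', rfl⟩ | ⟨d, hd, h⟩
        · exact Or.inl h
        · rw [hG] at hL'
          rcases (by simpa [or_left_comm] using hL' : L' = .neg A ∨ L' ∈ G₁ ∨ L' ∈ G₂)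
            with rfl | hL'
          · exact Or.inr (Or.inr ⟨.neg A, by simp, rfl⟩)
          · exact Or.inr (Or.inl ⟨L', List.mem_append.2 hL', rfl⟩)
        · exact Or.inr (Or.inr ⟨d, List.mem_append_left _ hd, h⟩)
    · rintro S' N' h
      cases h
      exact ⟨by simp [hG], Or.inl ⟨G₁, A, G₂, hG, hA, Or.inr (Or.inr (hasNode_addNode _ _ _))⟩⟩
  | simplifySuccess S H D₁ D₂ d hN hd =>
    have hs := hF.nodes S _ hN.1
    have hmem : ∀ d' ∈ D₁ ++ D₂, d' ∈ D₁ ++ d :: D₂ := fun d' hd' => by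
      simp only [List.mem_append, List.mem_cons] at hd' ⊢; tauto
    refine hF.of_extension
      (F' := (F.addNode S ⟨H, D₁ ++ D₂, []⟩).dispose {(S, ⟨H, D₁ ++ d :: D₂, []⟩)}) subset_rfl
      hF.subgoals_lang Set.subset_union_left ?_ Set.subset_union_left ?_ subset_rfl
      hF.completed_subset ?_ ?_ fun S h h' => (h' h).elim
    · rintro S' N' (h | ⟨h, -⟩) h'
      · exact (h' h).elim
      · cases h
        refine ⟨hs.subgoal, hs.head_instance, hs.head_lang, hs.goals_lang,
          fun d' hd' => hs.delays_lang d' (hmem d' hd'), fun A hA => hs.delays_neg A (hmem _ hA),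
          fun A call ans hA => hs.delays_pos A call ans (hmem _ hA), fun σ hσ => ?_⟩
        obtain ⟨g, hg, hgh, hb⟩ := hs.derivation σ hσ
        refine ⟨g, hg, hgh, fun L hL => ?_⟩
        rcases hb L hL with h | h | ⟨d', hd', rfl⟩
        · exact Or.inl h
        · exact Or.inr (Or.inl h)
        · rcases (by simpa [or_left_comm] using hd' : d' = d ∨ d' ∈ D₁ ∨ d' ∈ D₂)
            with rfl | hd'
          · exact Or.inl (hF.delayed_trueIn hN.1 (by simp) hd hσ)
          · exact Or.inr (Or.inr ⟨d', List.mem_append.2 hd', rfl⟩)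
    · rintro S' N' (h | h) h'
      · exact (h' h).elim
      · cases h
        exact Or.inr ⟨rfl, D₁, d, D₂, rfl, Or.inl (hasNode_addNode _ _ _)⟩
    · rintro S' N' hS' (h | ⟨h, -⟩) h'
      · exact (h' h).elim
      · cases h
        exact ⟨rfl, _, hN⟩
    · rintro S' H' hH (h | h)
      · exact hH.2 h
      · cases D₁ <;> cases h
  | simplifyFailure S H D d hN hdD hd =>
    refine hF.dispose ?_ ?_
    · rintro S' H' h
      cases h
      simp at hdD
    · rintro S' N' h
      cases h
      obtain ⟨D₁, D₂, rfl⟩ := List.append_of_mem hdD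
      refine Or.inr ⟨rfl, D₁, d, D₂, rfl, Or.inr ?_⟩
      cases d with
      | neg A =>
        have hA := (hF.nodes S _ hN.1).delays_neg A hdD
        exact Or.inl ⟨A, rfl, hF.mem_true_of_succeeded hA.1 hd⟩
      | pos A call ans =>
        exact Or.inr ⟨A, call, ans, rfl, hd.1,
          fun H' D' hH hA => hd.2 H' D' hH ⟨hA.1, fun h => hA.2 (Or.inl h)⟩⟩
  | completion E hne hE hnc hev => exact hF.complete hE hev
  | answerCompletion U hne hU =>
    refine hF.dispose ?_ ?_
    · intro S H h
      obtain ⟨-, -, -, A, call, ans, hd, -⟩ := hU S _ h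
      simp at hd
    · intro S N h
      obtain ⟨-, -, hG, A, call, ans, hd, hcall, hsup⟩ := hU S N h
      obtain ⟨D₁, D₂, hD⟩ := List.append_of_mem hd
      refine Or.inr ⟨hG, D₁, _, D₂, hD, Or.inr (Or.inr ⟨A, call, ans, rfl, hcall, ?_⟩)⟩
      intro H D hH hA
      exact hA.2 (Or.inr (hsup H D hH ⟨hA.1, fun h => hA.2 (Or.inl h)⟩))

theorem Sound.reflTransGen (hF : F.Sound prog) (h : Relation.ReflTransGen (Step prog R) F F') :
    F'.Sound prog := by
  induction h with
  | refl => exact hF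
  | tail _ h ih => exact ih.step h

end Forest

end Preservation

/-! ### Final forests -/

section Completeness

variable {P C : Type*}

theorem ComputationRule.exists_selects (R : ComputationRule P C) {G : List (Literal P C)}
    (hG : G ≠ []) : ∃ G₁ L G₂, R.Selects G G₁ L G₂ := by
  have h := R.index_lt G hG
  refine ⟨G.take (R.index G), G[R.index G], G.drop (R.index G + 1), ?_, ?_⟩
  · simp
  · simp [h.le]

namespace Forest

variable {prog : List (Clause P C)} {R : ComputationRule P C} {F : Forest P C}

/-- If no operation is applicable and the evaluation does not flounder, then all subgoals are
completed: otherwise the set of those that are not is completely evaluated. -/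
theorem IsFinal.mem_completed (hfin : F.IsFinal prog R) (hnf : ¬ F.Flounders R) {S : Atom P C}
    (hS : S ∈ F.subgoals) : S ∈ F.completed := by
  by_contra hSc
  refine hfin _ (.completion F (F.subgoals \ F.completed) ⟨S, hS, hSc⟩ Set.sdiff_subset
    (fun _ h => h.2) ?_)
  rintro T ⟨hT, hTc⟩
  refine Or.inr ⟨fun N hN => ?_, fun N hN hgoals => ?_⟩
  · by_contra hnew
    exact hfin _ (.clauseResolution F T N hT hTc hN hnew)
  · obtain ⟨G₁, L, G₂, hsel⟩ := R.exists_selects hgoals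
    have hground : ∀ A, L = .neg A → A.IsGround := by
      rintro A rfl
      by_contra hA
      exact hnf ⟨T, N, G₁, A, G₂, hTc, hN, hsel, hA⟩
    obtain ⟨call, hcall, hv⟩ : ∃ call ∈ F.subgoals, L.atom.IsVariant call := by
      by_contra! h
      exact hfin _ (.newSubgoal F T N G₁ G₂ L hTc hN hsel hground h)
    cases L with
    | neg A =>
      exfalso
      have hA := hground A rfl
      obtain rfl : call = A := hv.isInstance.eq_of_isGround hA
      by_cases hf : F.Failed call
      · exact hfin _ (.negationSuccess F T N G₁ G₂ call hTc hN hsel hA hf)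
      by_cases hs : F.Succeeded call
      · exact hfin _ (.negationFailure F T N G₁ G₂ call hTc hN hsel hA hs)
      exact hfin _ (.delaying F T N G₁ G₂ call hTc hN hsel hA hcall hf hs)
    | pos B =>
      refine ⟨⟨G₁, B, G₂, hsel, call, hcall, hv, ?_⟩, fun N' hN' => ?_⟩
      · by_cases h : call ∈ F.completed
        · exact Or.inl h
        · exact Or.inr ⟨hcall, h⟩
      · by_contra hnew
        exact hfin _ (.positiveReturn F T N N' hTc hN hN' hnew)

/-- The atoms all of whose subgoals cover them by unconditional answers. -/
def coveredAtoms (F : Forest P C) : Set (Atom P C) :=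
  {A | ∀ S ∈ F.subgoals, A.IsInstance S → ∃ H, F.IsAnswer S H [] ∧ A.IsInstance H}

/-- The atoms none of whose subgoals covers them by an answer. -/
def uncoveredAtoms (F : Forest P C) : Set (Atom P C) :=
  {A | ∀ S ∈ F.subgoals, A.IsInstance S → ∀ H D, F.IsAnswer S H D → ¬ A.IsInstance H}

/-- The answers having an instance in an unfounded set are unsupported; hence there are none in a
final forest. -/
theorem Sound.subset_uncoveredAtoms (hF : F.Sound prog) (hfin : F.IsFinal prog R)
    (hcomp : ∀ S ∈ F.subgoals, S ∈ F.completed) {U : Set (Atom P C)}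
    (hU : IsUnfounded prog (F.coveredAtoms ∩ (wellFoundedModel prog).1,
      F.uncoveredAtoms ∩ (wellFoundedModel prog).2) U)
    (hUf : U ⊆ (wellFoundedModel prog).2) : U ⊆ F.uncoveredAtoms := by
  set W : Set (Atom P C × Node P C) := {x | F.IsActive x.1 x.2 ∧ x.2.goals = [] ∧
    ∃ σ, IsGrounding prog σ ∧ x.2.head.subst σ ∈ U} with hW
  have huns : F.Unsupported W := by
    rintro S N ⟨hact, hgoals, σ, hσ, hσU⟩
    have hs := hF.nodes S N hact.1
    refine ⟨hcomp S hs.subgoal, hact, hgoals, ?_⟩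
    -- a false delayed literal would allow a simplification
    have hsimp : ∀ d ∈ N.delays, ¬ F.DelayedFailed d := by
      intro d hd hfail
      obtain ⟨H, D, G⟩ := N
      obtain rfl : G = [] := hgoals
      exact hfin _ (.simplifyFailure F S H D d hact hd hfail)
    obtain ⟨g, hg, hgh, hb⟩ := hs.derivation σ hσ
    obtain ⟨L, hL, hLU⟩ := hU.2 g hg (hgh ▸ hσU)
    rcases hb L hL with h | ⟨L', hL', -⟩ | ⟨d, hd, rfl⟩
    · exfalso
      rcases hLU with hLU | ⟨B, hB, rfl⟩
      · cases L with
        | pos B => exact notMem_false_of_mem_true h hLU.2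
        | neg B => exact notMem_false_of_mem_true hLU.2 h
      · exact notMem_false_of_mem_true h (hUf hB)
    · exact (List.not_mem_nil (hgoals ▸ hL')).elim
    · cases d with
      | neg A =>
        exfalso
        obtain ⟨hA, hAF⟩ := hs.delays_neg A hd
        rw [Delayed.literal, Literal.subst, hA.subst_eq] at hLU
        rcases hLU with hLU | ⟨B, -, h⟩
        · obtain ⟨H, hH, -⟩ := hLU.1 A hAF (.refl A)
          obtain rfl := (hF.nodes _ _ hH.1).head_instance.eq_of_isGround hA
          exact hsimp _ hd hH
        · cases h
      | pos A call ans =>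
        obtain ⟨hcall, hAc, hAa⟩ := hs.delays_pos A call ans hd
        rcases hLU with hLU | ⟨B, hB, h⟩
        · refine (hsimp _ hd ⟨hcomp call hcall, fun H D hH hA => ?_⟩).elim
          exact hLU.1 call hcall (hAc.subst σ) H D hA ((hAa.trans hH.isInstance).subst σ)
        · cases h
          refine ⟨A, call, ans, hd, hcomp call hcall, fun H D hH hA => ⟨hA, rfl, ?_⟩⟩
          obtain ⟨τ, hτ, he⟩ := ((hs.delays_lang _ hd).isHerbrand_subst hσ).exists_isGrounding
            ((hAa.trans hH.isInstance).subst σ)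
          exact ⟨τ, hτ, he ▸ hB⟩
  intro A hA S hS hAS H D hH hAH
  obtain ⟨σ, hσ, rfl⟩ := IsHerbrand.exists_isGrounding (prog := prog) (hU.1 hA).2 hAH
  exact hfin _ (.answerCompletion F W ⟨(S, ⟨H, D, []⟩), hH, rfl, σ, hσ, hA⟩ huns)

/-- Completeness: in a final forest whose subgoals are completed, true instances of subgoals are
covered by unconditional answers. -/
theorem Sound.exists_answer_of_mem_true (hF : F.Sound prog) (hfin : F.IsFinal prog R)
    (hcomp : ∀ S ∈ F.subgoals, S ∈ F.completed) {A S : Atom P C}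
    (hA : A ∈ (wellFoundedModel prog).1) (hS : S ∈ F.subgoals) (hAS : A.IsInstance S) :
    ∃ H, F.IsAnswer S H [] ∧ A.IsInstance H := by
  set I₀ : PInterp P C := (F.coveredAtoms ∩ (wellFoundedModel prog).1,
    F.uncoveredAtoms ∩ (wellFoundedModel prog).2) with hI₀
  have hle : I₀ ≤ wellFoundedModel prog := ⟨Set.inter_subset_right, Set.inter_subset_right⟩
  have hle' : wfOperator prog I₀ ≤ wellFoundedModel prog := by
    conv_rhs => rw [← wellFoundedModel_eq]
    exact (wfOperator prog).monotone hle
  suffices h : wfOperator prog I₀ ≤ I₀ from ((wellFoundedModel_le h).1 hA).1 S hS hAS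
  refine ⟨Set.subset_inter ?_ hle'.1, Set.subset_inter ?_ hle'.2⟩
  · rintro _ ⟨g, hg, rfl, hb⟩ S hS hgS
    obtain ⟨H, D, σ, hH, -, he, hD⟩ := hF.exists_answer (ok := fun D => D = []) (hcomp S hS) hg hgS
      (fun A hA h => notMem_false_of_mem_true h (hb _ hA).2) fun B hB call hcall hBc => by
        obtain ⟨H, hH, hBH⟩ := (hb _ hB).1 call (hF.completed_subset hcall) hBc
        exact ⟨H, [], hH, rfl, hBH⟩
    have hs := hF.nodes _ _ hH.1
    obtain rfl : D = [] := by
      -- all delayed literals are successful, and no simplification is applicable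
      cases D with
      | nil => rfl
      | cons d D =>
        obtain ⟨h₁, h₂⟩ := hD d List.mem_cons_self
        refine (hfin _ (.simplifySuccess F S H [] D d hH ?_)).elim
        cases d with
        | neg A =>
          obtain ⟨hA, hAF⟩ := hs.delays_neg A List.mem_cons_self
          rw [Delayed.literal, Literal.subst, hA.subst_eq] at h₁
          refine ⟨hcomp A hAF, fun H' D' hH' => ?_⟩
          obtain rfl := (hF.nodes _ _ hH'.1).head_instance.eq_of_isGround hA
          exact (hb _ h₁).1 _ hAF (.refl _) _ _ hH' (.refl _)
        | pos A call ans =>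
          obtain ⟨H', _, hH', hA', rfl⟩ := h₂ _ _ _ rfl
          exact ⟨H', hH', hA'⟩
    exact ⟨H, hH, σ, he⟩
  · rintro A ⟨U, hU, hA⟩
    refine hF.subset_uncoveredAtoms hfin hcomp hU (fun B hB => hle'.2 ?_) hA
    exact ⟨U, hU, hB⟩

end Forest

end Completeness

/-! ### The space of random variables and the well-founded model -/

section Space

variable {P C : Type*}

namespace KnowledgeBase

variable {KB : KnowledgeBase P C}

theorem mem_program {c : Clause P C} :
    c ∈ KB.program ↔ (∃ d ∈ KB.PB, d.toClause = c) ∨ c ∈ builtinClauses P C ++ KB.aux := by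
  simp [program, CB]

theorem mem_program_cases {c : Clause P C} (h : c ∈ KB.program) :
    (∃ d ∈ KB.PB, d.toClause = c) ∨ c ∈ builtinClauses P C ∨ c ∈ KB.aux := by
  simpa [mem_program] using h

/-- Predicates of heads and of influences are neither `true` nor `member`, which occur in `CB`. -/
theorem exists_user_of_mem {c : PBClause P C} (hc : c ∈ KB.PB) {A : Atom P C}
    (hA : A ∈ c.head :: c.influences) : ∃ p, A.pred = .user p ∧ ∀ t ∈ A.args, t.IsSimple := by
  have hA' : A ∈ c.toClause.atoms := by
    simp only [PBClause.toClause, Clause.atoms, List.mem_cons, List.mem_map] at hA ⊢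
    rcases hA with h | h
    · exact Or.inl h
    · exact Or.inr ⟨.pos A, List.mem_append_left _ (List.mem_map_of_mem h), rfl⟩
  rcases KB.pb_datalog c hc A hA' with h | rfl | ⟨t, dom, -, rfl⟩
  · exact h
  · exact (KB.only_in_PB c hc _ hA ⟨.truth, []⟩ (by simp [builtinClauses]) .truth
      (by simp [Clause.atoms]) rfl).elim
  · exact (KB.only_in_PB c hc _ hA
      ⟨.member (.var 0) (.cons (.var 0) (.var 1)), []⟩ (by simp [builtinClauses]) _
      (Clause.head_mem_atoms _) rfl).elim

theorem exists_user_head {c : Clause P C} (hc : c ∈ KB.program)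
    (hc' : c ∉ builtinClauses P C) : ∃ p, c.head.pred = .user p ∧ ∀ t ∈ c.head.args, t.IsSimple := by
  rcases mem_program_cases hc with ⟨d, hd, rfl⟩ | h | h
  · exact exists_user_of_mem hd List.mem_cons_self
  · exact (hc' h).elim
  · obtain ⟨p, hp⟩ := KB.aux_head c h
    rcases KB.aux_datalog c h _ c.head_mem_atoms with h' | h' | ⟨t, dom, -, h'⟩
    · exact h'
    · rw [h'] at hp; cases hp
    · rw [h'] at hp; cases hp

/-- A clause whose head predicate is the head predicate of a clause of `PB` belongs to `PB`. -/
theorem mem_PB_of_head_sym {c : Clause P C} (hc : c ∈ KB.program) (hs : c.head.sym ∈ KB.headSyms) :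
    ∃ d ∈ KB.PB, d.toClause = c := by
  rcases mem_program.1 hc with h | h
  · exact h
  · obtain ⟨d, hd, hds⟩ := hs
    exact (KB.only_in_PB d hd d.head List.mem_cons_self c h _ c.head_mem_atoms hds.symm).elim

theorem mem_headSyms_of_influence {d : PBClause P C} (hd : d ∈ KB.PB) {A : Atom P C}
    (hA : A ∈ d.influences) {c : Clause P C} (hc : c ∈ KB.program) (hs : c.head.sym = A.sym) :
    A.sym ∈ KB.headSyms := by
  rcases mem_program.1 hc with ⟨e, he, rfl⟩ | h
  · exact ⟨e, he, hs⟩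
  · exact (KB.only_in_PB d hd A (List.mem_cons_of_mem _ hA) c h _ c.head_mem_atoms hs).elim

theorem exists_const_of_member_mem_true {t : Term C} {dom : List C}
    (h : Atom.member t (.ofList dom) ∈ (wellFoundedModel KB.program).1) :
    ∃ c ∈ dom, t = .const c := by
  induction dom with
  | nil =>
    obtain ⟨_, ⟨c, hc, σ, -, rfl⟩, he, -⟩ := mem_true_iff.1 h
    by_cases hb : c ∈ builtinClauses P C
    · simp only [builtinClauses, List.mem_cons, List.not_mem_nil, or_false] at hb
      rcases hb with rfl | rfl | rfl <;>
        simp [Clause.subst, Atom.subst, Atom.truth, Atom.member, Term.subst, Term.ofList] at he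
    · obtain ⟨p, hp, -⟩ := exists_user_head hc hb
      have := congrArg Atom.pred he
      simp [Clause.subst, Atom.subst, hp, Atom.member] at this
  | cons a l ih =>
    obtain ⟨_, ⟨c, hc, σ, -, rfl⟩, he, hbody⟩ := mem_true_iff.1 h
    by_cases hb : c ∈ builtinClauses P C
    · simp only [builtinClauses, List.mem_cons, List.not_mem_nil, or_false] at hb
      rcases hb with rfl | rfl | rfl
      · simp [Clause.subst, Atom.subst, Atom.truth, Atom.member] at he
      · simp only [Clause.subst, Atom.subst, Atom.member, Term.subst, Term.ofList, List.map_cons,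
          List.map_nil, Atom.mk.injEq, List.cons.injEq, Term.cons.injEq, true_and, and_true] at he
        exact ⟨a, List.mem_cons_self, he.1.symm.trans he.2.1⟩
      · simp only [Clause.subst, Atom.subst, Atom.member, Term.subst, Term.ofList, List.map_cons,
          List.map_nil, Atom.mk.injEq, List.cons.injEq, Term.cons.injEq, true_and, and_true] at he
        have : Atom.member t (.ofList l) ∈ (wellFoundedModel KB.program).1 := by
          have := hbody (.pos (.member (σ 0) (σ 2)))
            (by simp [Clause.subst, Literal.subst, Atom.subst, Atom.member, Term.subst])
          rwa [he.1, he.2.2] at this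
        obtain ⟨c, hc, rfl⟩ := ih this
        exact ⟨c, List.mem_cons_of_mem _ hc, rfl⟩
    · obtain ⟨p, hp, -⟩ := exists_user_head hc hb
      have := congrArg Atom.pred he
      simp [Clause.subst, Atom.subst, hp, Atom.member] at this

theorem truth_mem_true : Atom.truth ∈ (wellFoundedModel KB.program).1 := by
  refine mem_true_iff.2 ⟨_, ⟨⟨.truth, []⟩, ?_, _, isGrounding_nil, rfl⟩, rfl, by simp [Clause.subst]⟩
  simp [mem_program, builtinClauses]

/-- The type constraints make the arguments of true atoms constants. -/
theorem exists_const_of_mem_true {A : Atom P C} (hA : A ∈ (wellFoundedModel KB.program).1)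
    (hs : A.sym ∈ KB.headSyms) {t : Term C} (ht : t ∈ A.args) : ∃ c, t = .const c := by
  obtain ⟨_, ⟨c, hc, σ, -, rfl⟩, rfl, hb⟩ := mem_true_iff.1 hA
  obtain ⟨d, hd, rfl⟩ := mem_PB_of_head_sym hc (by simpa [Clause.subst] using hs)
  obtain ⟨p, -, hp⟩ := exists_user_of_mem hd List.mem_cons_self
  obtain ⟨s, hs, rfl⟩ := List.mem_map.1 ht
  rcases hp s hs with ⟨n, rfl⟩ | ⟨c, rfl⟩
  · obtain ⟨x, hx, rfl⟩ := KB.typed d hd n ⟨_, hs, rfl⟩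
    have := hb (.pos (.member (σ x.1) (.ofList x.2))) <| by
      refine List.mem_map.2 ⟨.pos (.member (.var x.1) (.ofList x.2)), ?_, ?_⟩
      · simp only [PBClause.toClause, PBClause.typeConstraints, List.mem_append, List.mem_cons]
        exact Or.inr (Or.inr (Or.inr (List.mem_map_of_mem hx)))
      · simp [Literal.subst, Atom.subst, Atom.member, Term.subst]
    obtain ⟨c, -, h⟩ := exists_const_of_member_mem_true this
    exact ⟨c, h⟩
  · exact ⟨c, rfl⟩

theorem mem_space_iff {A : Atom P C} :
    A ∈ KB.space ↔ A ∈ (wellFoundedModel KB.program).1 ∧ A.sym ∈ KB.headSyms := by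
  constructor
  · intro hA
    change KB.IsRandomVariable A at hA
    have hprog : ∀ c ∈ KB.PB, c.toClause ∈ KB.program := fun c hc => mem_program.2 (Or.inl ⟨c, hc, rfl⟩)
    induction hA with
    | unit c hc hu =>
      refine ⟨mem_true_iff.2 ⟨_, ⟨_, hprog c hc, _, isGrounding_nil, rfl⟩, ?_, ?_⟩, c, hc, rfl⟩
      · refine Atom.IsGround.subst_eq (Set.eq_empty_of_forall_notMem fun n hn => ?_) _
        obtain ⟨x, hx, -⟩ := KB.typed c hc n hn
        simp [hu.2.2] at hx
      · intro L hL
        obtain rfl : L = .pos .truth := by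
          simpa [PBClause.toClause, PBClause.typeConstraints, hu.1, hu.2.1, hu.2.2, Clause.subst,
            Literal.subst, Atom.subst, Atom.truth] using hL
        exact truth_mem_true
    | derive c hc σ hσ hctx htyp hinf ih =>
      refine ⟨mem_true_iff.2 ⟨_, ⟨_, hprog c hc, σ, hσ, rfl⟩, rfl, fun L hL => ?_⟩, c, hc, by simp⟩
      obtain ⟨L, hL', rfl⟩ := List.mem_map.1 hL
      simp only [PBClause.toClause, List.mem_append, List.mem_map, List.mem_cons] at hL'
      rcases hL' with ⟨B, hB, rfl⟩ | rfl | hL | hL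
      · exact (ih B hB).1
      · exact truth_mem_true
      · exact hctx L hL
      · exact htyp L hL
  · rintro ⟨hA, hs⟩
    -- the true atoms that are random variables if their predicate is a head predicate of `PB`
    set I₀ : PInterp P C := ({A | A.sym ∈ KB.headSyms → A ∈ KB.space} ∩
      (wellFoundedModel KB.program).1, (wellFoundedModel KB.program).2) with hI₀
    have hle : I₀ ≤ wellFoundedModel KB.program := ⟨Set.inter_subset_right, le_rfl⟩
    have hle' : wfOperator KB.program I₀ ≤ wellFoundedModel KB.program := by
      conv_rhs => rw [← wellFoundedModel_eq]
      exact (wfOperator KB.program).monotone hle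
    suffices h : wfOperator KB.program I₀ ≤ I₀ from ((wellFoundedModel_le h).1 hA).1 hs
    refine ⟨Set.subset_inter ?_ hle'.1, hle'.2⟩
    rintro _ ⟨_, ⟨c, hc, σ, hσ, rfl⟩, rfl, hb⟩ hsym
    obtain ⟨d, hd, rfl⟩ := mem_PB_of_head_sym hc (by simpa [Clause.subst] using hsym)
    have hmem : ∀ L ∈ d.toClause.body, (L.subst σ).TrueIn I₀ :=
      fun L hL => hb _ (List.mem_map_of_mem hL)
    simp only [PBClause.toClause, List.mem_append, List.mem_cons, List.mem_map] at hmem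
    refine .derive d hd σ hσ (fun L hL => (hmem L ?_).mono hle) (fun L hL => (hmem L ?_).mono hle)
      fun A hA => ?_
    · exact Or.inr (Or.inr (Or.inl hL))
    · exact Or.inr (Or.inr (Or.inr hL))
    · obtain ⟨h₁, h₂⟩ := hmem (.pos A) (Or.inl ⟨A, hA, rfl⟩)
      obtain ⟨_, ⟨e, he, τ, -, rfl⟩, heA, -⟩ := mem_true_iff.1 h₂
      refine h₁ ?_
      rw [Atom.sym_subst]
      refine mem_headSyms_of_influence hd hA he ?_
      simpa [Clause.subst] using congrArg Atom.sym heA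

theorem finite_progSyms (prog : List (Clause P C)) : (progSyms prog).Finite := by
  have : progSyms prog = ⋃ c ∈ {c | c ∈ prog}, Atom.sym '' {A | A ∈ c.atoms} := by
    ext; simp [progSyms]
  rw [this]
  exact (List.finite_toSet prog).biUnion fun c _ => (List.finite_toSet c.atoms).image _

theorem finite_progConsts (prog : List (Clause P C)) : (progConsts prog).Finite := by
  have : progConsts prog = ⋃ c ∈ {c | c ∈ prog}, ⋃ A ∈ {A | A ∈ c.atoms}, A.consts := by
    ext; simp [progConsts]
  rw [this]
  exact (List.finite_toSet prog).biUnion fun c _ =>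
    (List.finite_toSet c.atoms).biUnion fun A _ => A.finite_consts

theorem _root_.Set.Finite.lists_length_le {α : Type*} {T : Set α} (hT : T.Finite) (n : ℕ) :
    {l : List α | l.length ≤ n ∧ ∀ x ∈ l, x ∈ T}.Finite := by
  have := hT.to_subtype
  refine ((List.finite_length_le T n).image (List.map Subtype.val)).subset ?_
  rintro l ⟨hl, hT⟩
  exact ⟨l.attach.map fun x => ⟨x.1, hT x.1 x.2⟩, by simpa using hl, by simp⟩

theorem finite_atoms {T' : Set (Pred P × ℕ)} {T : Set (Term C)} (hT' : T'.Finite) (hT : T.Finite) :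
    {A : Atom P C | A.sym ∈ T' ∧ ∀ t ∈ A.args, t ∈ T}.Finite := by
  obtain ⟨n, hn⟩ := (hT'.image Prod.snd).bddAbove
  refine ((hT'.prod (hT.lists_length_le n)).image fun x : (Pred P × ℕ) × List (Term C) =>
    (⟨x.1.1, x.2⟩ : Atom P C)).subset ?_
  rintro A ⟨hA, hA'⟩
  exact ⟨(A.sym, A.args), ⟨hA, hn ⟨_, hA, rfl⟩, hA'⟩, rfl⟩

theorem finite_space (KB : KnowledgeBase P C) : KB.space.Finite := by
  refine (finite_atoms (finite_progSyms KB.program)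
    ((finite_progConsts KB.program).image Term.const)).subset fun A hA => ?_
  obtain ⟨h, hs⟩ := mem_space_iff.1 hA
  have hl := (isHerbrand_of_mem_true h).2
  refine ⟨hl.1, fun t ht => ?_⟩
  obtain ⟨c, rfl⟩ := exists_const_of_mem_true h hs ht
  exact ⟨c, hl.2 ⟨_, ht, rfl⟩, rfl⟩

/-- Answers for head predicates are ground: otherwise the instance in which all variables are
replaced by the empty list would be true, against the type constraints. -/
theorem isGround_of_isAnswer {F : Forest P C} (hF : F.Sound KB.program) {S H : Atom P C}
    (hH : F.IsAnswer S H []) (hs : H.sym ∈ KB.headSyms) : H.IsGround := by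
  refine Set.eq_empty_of_forall_notMem ?_
  rintro n ⟨t, ht, hn⟩
  have hl := (hF.nodes _ _ hH.1).head_lang
  have htrue := hF.mem_true hH (hl.isHerbrand_subst isGrounding_nil) ⟨_, rfl⟩
  obtain ⟨c, hc⟩ := exists_const_of_mem_true htrue (by simpa using hs) (List.mem_map_of_mem ht)
  cases t with
  | var m => cases hc
  | const c => exact hn
  | nil => exact hn
  | cons => cases hc

theorem inLanguage_goalAtom {s : Pred P × ℕ} (hs : s ∈ KB.headSyms) :
    InLanguage KB.program (goalAtom s) := by
  obtain ⟨c, hc, rfl⟩ := hs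
  refine ⟨⟨c.toClause, mem_program.2 (Or.inl ⟨c, hc, rfl⟩), _, Clause.head_mem_atoms _, ?_⟩, ?_⟩
  · simp [PBClause.toClause, Atom.sym, goalAtom]
  · rintro a ⟨t, ht, ha⟩
    obtain ⟨n, -, rfl⟩ := List.mem_map.1 ht
    exact ha.elim

theorem isInstance_goalAtom (A : Atom P C) : A.IsInstance (goalAtom A.sym) := by
  refine ⟨fun n => A.args.getD n .nil, ?_⟩
  obtain ⟨p, as⟩ := A
  simp only [Atom.subst, goalAtom, Atom.sym, List.map_map, Atom.mk.injEq, true_and]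
  refine List.ext_getElem (by simp) fun n h₁ h₂ => ?_
  simp [Term.subst, h₁]

/-- The table of the goal for a head predicate, once its evaluation is finished. -/
theorem table_eq {R : ComputationRule P C} {s : Pred P × ℕ} (hs : s ∈ KB.headSyms)
    {F : Forest P C} (hrun : Relation.ReflTransGen (Forest.Step KB.program R)
      (.init (goalAtom s)) F) (hfin : F.IsFinal KB.program R) (hnf : ¬ F.Flounders R) :
    F.table (goalAtom s) = {A ∈ KB.space | A.sym = s} := by
  have hF := (Forest.Sound.init (inLanguage_goalAtom hs)).reflTransGen hrun
  have hgoal : goalAtom s ∈ F.subgoals := by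
    clear hfin hnf hF
    induction hrun with
    | refl => rfl
    | tail _ h ih => cases h <;> first | exact ih | exact Or.inr ih
  have hsym : (goalAtom s : Atom P C).sym = s := by simp [Atom.sym, goalAtom]
  ext A
  constructor
  · intro hA
    have hn := hF.nodes _ _ hA.1
    have hAs : A.sym = s := by
      obtain ⟨σ, h⟩ := hn.head_instance
      simp only at h
      rw [h, Atom.sym_subst, hsym]
    have hg := isGround_of_isAnswer hF hA (hAs ▸ hs)
    exact ⟨mem_space_iff.2 ⟨hF.mem_true hA (hg.isHerbrand hn.head_lang) (.refl A), hAs ▸ hs⟩, hAs⟩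
  · rintro ⟨hA, rfl⟩
    obtain ⟨H, hH, hAH⟩ := hF.exists_answer_of_mem_true hfin
      (fun S hS => hfin.mem_completed hnf hS) (mem_space_iff.1 hA).1 hgoal (isInstance_goalAtom A)
    have hHs : H.sym = A.sym := by
      obtain ⟨σ, h⟩ := hAH
      rw [h, Atom.sym_subst]
    obtain rfl := hAH.eq_of_isGround (isGround_of_isAnswer hF hH (hHs ▸ hs))
    exact hH

end KnowledgeBase

end Space

/-! ### The atoms occurring in an evaluation -/

section Shape

variable {P C : Type*}

/-- The domains of the type constraints and other lists occurring in the program, with their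
suffixes. -/
def KnowledgeBase.doms (KB : KnowledgeBase P C) : Set (List C) :=
  {l | ∃ d, l <:+ d ∧ ∃ c ∈ KB.program, ∃ A ∈ c.atoms, Term.ofList d ∈ A.args}

/-- The form of the atoms that occur in the evaluation of a goal: function-free except for `member`,
whose second argument is a suffix of a list in the program. -/
def HasShape (KB : KnowledgeBase P C) (A : Atom P C) : Prop :=
  (∃ p, A.pred = .user p ∧ ∀ t ∈ A.args, t.IsSimple) ∨ A = .truth ∨
    ∃ (t : Term C) (l : List C), t.IsSimple ∧ l ∈ KB.doms ∧ A = .member t (.ofList l)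

variable {KB : KnowledgeBase P C}

theorem KnowledgeBase.finite_doms (KB : KnowledgeBase P C) : KB.doms.Finite := by
  have h : {t | ∃ c ∈ KB.program, ∃ A ∈ c.atoms, t ∈ A.args}.Finite := by
    have : {t | ∃ c ∈ KB.program, ∃ A ∈ c.atoms, t ∈ A.args} =
        ⋃ c ∈ {c | c ∈ KB.program}, ⋃ A ∈ {A | A ∈ c.atoms}, {t | t ∈ A.args} := by
      ext; simp
    rw [this]
    exact (List.finite_toSet _).biUnion fun c _ =>
      (List.finite_toSet _).biUnion fun A _ => List.finite_toSet _
  refine ((h.preimage Term.ofList_injective.injOn).biUnion fun d _ =>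
    List.finite_toSet d.tails).subset ?_
  rintro l ⟨d, hl, hd⟩
  exact Set.mem_biUnion hd ((List.mem_tails _ _).2 hl)

theorem KnowledgeBase.isDatalog_of_mem {c : Clause P C} (hc : c ∈ KB.program)
    (hb : c ∉ builtinClauses P C) {A : Atom P C} (hA : A ∈ c.atoms) : A.IsDatalog := by
  rcases KnowledgeBase.mem_program_cases hc with ⟨d, hd, rfl⟩ | h | h
  · exact KB.pb_datalog d hd A hA
  · exact (hb h).elim
  · exact KB.aux_datalog c h A hA

theorem Atom.IsDatalog.hasShape {c : Clause P C} (hc : c ∈ KB.program) {A : Atom P C}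
    (hA : A ∈ c.atoms) (h : A.IsDatalog) : HasShape KB A := by
  rcases h with h | h | ⟨t, dom, ht, rfl⟩
  · exact Or.inl h
  · exact Or.inr (Or.inl h)
  · exact Or.inr (Or.inr ⟨t, dom, ht, ⟨dom, List.suffix_rfl, c, hc, _, hA, by simp [Atom.member]⟩,
      rfl⟩)

theorem Term.IsSimple.subst {t : Term C} (ht : t.IsSimple) {θ : ℕ → Term C}
    (hθ : ∀ n ∈ t.vars, (θ n).IsSimple) : (t.subst θ).IsSimple := by
  rcases ht with ⟨n, rfl⟩ | ⟨c, rfl⟩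
  · exact hθ n rfl
  · exact Or.inr ⟨c, rfl⟩

theorem HasShape.subst {A : Atom P C} (h : HasShape KB A) {θ : ℕ → Term C}
    (hθ : ∀ n ∈ A.vars, (θ n).IsSimple) : HasShape KB (A.subst θ) := by
  rcases h with ⟨p, hp, h⟩ | rfl | ⟨t, l, ht, hl, rfl⟩
  · refine Or.inl ⟨p, hp, fun t ht => ?_⟩
    obtain ⟨s, hs, rfl⟩ := List.mem_map.1 ht
    exact (h s hs).subst fun n hn => hθ n ⟨s, hs, hn⟩
  · exact Or.inr (Or.inl rfl)
  · refine Or.inr (Or.inr ⟨t.subst θ, l, ht.subst fun n hn => hθ n ⟨t, ?_, hn⟩, hl, ?_⟩)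
    · simp [Atom.member]
    · simp [Atom.member, Atom.subst]

theorem HasShape.rename {A : Atom P C} (h : HasShape KB A) (ρ : Equiv.Perm ℕ) :
    HasShape KB (A.rename ρ) :=
  h.subst fun _ _ => Or.inl ⟨_, rfl⟩

/-- Replacement of terms that are not simple by a variable. -/
def Term.collapse : Term C → Term C
  | .var n => .var n
  | .const c => .const c
  | _ => .var 0

theorem Term.isSimple_collapse (t : Term C) : t.collapse.IsSimple := by
  cases t
  exacts [Or.inl ⟨_, rfl⟩, Or.inr ⟨_, rfl⟩, Or.inl ⟨_, rfl⟩, Or.inl ⟨_, rfl⟩]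

theorem Term.IsSimple.collapse_subst {t : Term C} (ht : t.IsSimple) (θ : ℕ → Term C) :
    (t.subst θ).collapse = t.subst fun n => (θ n).collapse := by
  rcases ht with ⟨n, rfl⟩ | ⟨c, rfl⟩ <;> rfl

theorem Term.isSimple_of_subst {t : Term C} {τ : ℕ → Term C} (h : (t.subst τ).IsSimple) :
    t.IsSimple := by
  cases t with
  | var n => exact Or.inl ⟨n, rfl⟩
  | const c => exact Or.inr ⟨c, rfl⟩
  | nil => rcases h with ⟨n, h⟩ | ⟨c, h⟩ <;> cases h
  | cons s t => rcases h with ⟨n, h⟩ | ⟨c, h⟩ <;> cases h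

/-- A most general unifier of atoms of the evaluation has simple values: any others could be
collapsed. -/
theorem Atom.IsMGU.isSimple {θ : ℕ → Term C} {A B : Atom P C} (h : IsMGU θ A B)
    (hA : HasShape KB A) (hB : HasShape KB B) (n : ℕ) : (θ n).IsSimple := by
  suffices hun : A.subst (fun n => (θ n).collapse) = B.subst fun n => (θ n).collapse by
    obtain ⟨τ, hτ⟩ := h.2 _ hun
    exact Term.isSimple_of_subst (hτ n ▸ Term.isSimple_collapse (θ n))
  have hpred : A.pred = B.pred := (Atom.mk.inj h.1).1
  have key {D : Atom P C} (hD : ∀ t ∈ D.args, t.IsSimple) :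
      (D.subst fun n => (θ n).collapse) = ⟨D.pred, (D.subst θ).args.map Term.collapse⟩ := by
    simp only [subst, mk.injEq, true_and, List.map_map, List.map_inj_left, Function.comp_apply]
    exact fun t ht => ((hD t ht).collapse_subst θ).symm
  rcases hA with ⟨p, hp, hA⟩ | rfl | ⟨t, l, ht, hl, rfl⟩ <;>
    rcases hB with ⟨q, hq, hB⟩ | rfl | ⟨t', l', ht', hl', rfl⟩
  · rw [key hA, key hB, h.1, hpred]
  · rw [hp] at hpred; cases hpred
  · rw [hp] at hpred; cases hpred
  · rw [hq] at hpred; cases hpred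
  · rfl
  · cases hpred
  · rw [hq] at hpred; cases hpred
  · cases hpred
  · have := h.1
    simp only [subst, member, List.map_cons, List.map_nil, Term.subst_ofList, mk.injEq,
      List.cons.injEq, and_true, true_and] at this ⊢
    rw [← ht.collapse_subst, ← ht'.collapse_subst, this.1]
    exact ⟨rfl, this.2⟩

end Shape

/-! ### Bounded forests -/

section Bounded

variable {P C : Type*} {KB : KnowledgeBase P C} {R : ComputationRule P C}

/-- Bounds on a node: the form of its atoms, and `m` for the number of its literals. -/
structure NodeBounded (KB : KnowledgeBase P C) (m : ℕ) (N : Node P C) : Prop where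
  head : HasShape KB N.head
  goals : ∀ L ∈ N.goals, HasShape KB L.atom
  delays : ∀ d ∈ N.delays, HasShape KB d.atom
  answers : ∀ A call ans, .pos A call ans ∈ N.delays → InLanguage KB.program ans ∧ HasShape KB ans
  length_le : N.goals.length + N.delays.length ≤ m

theorem nodeBounded_clauseResolvent {m : ℕ} (hm : ∀ c ∈ KB.program, c.body.length ≤ m)
    {S : Atom P C} (hS : HasShape KB S) {N : Node P C}
    (hN : Forest.ClauseResolvent KB.program S N) : NodeBounded KB m N := by
  obtain ⟨c, hc, ρ, θ, hdisj, hθ, rfl⟩ := hN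
  have hlen : ((c.rename ρ).body.map (Literal.subst θ)).length + ([] : List (Delayed P C)).length
      ≤ m := by
    simpa [Clause.rename, Clause.subst] using hm c hc
  suffices h : HasShape KB (S.subst θ) ∧
      ∀ L ∈ (c.rename ρ).body.map (Literal.subst θ), HasShape KB L.atom from
    ⟨h.1, h.2, by simp, by simp, hlen⟩
  by_cases hb : c ∈ builtinClauses P C
  · have heq := hθ.1
    rcases hS with ⟨p, hp, -⟩ | rfl | ⟨t, l, ht, hl, rfl⟩
    · have := congrArg Atom.pred heq
      simp only [builtinClauses, List.mem_cons, List.not_mem_nil, or_false] at hb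
      rcases hb with rfl | rfl | rfl <;>
        simp [Clause.rename, Clause.subst, Atom.subst, hp, Atom.truth, Atom.member] at this
    · refine ⟨Or.inr (Or.inl rfl), ?_⟩
      simp only [builtinClauses, List.mem_cons, List.not_mem_nil, or_false] at hb
      rcases hb with rfl | rfl | rfl
      · simp [Clause.rename, Clause.subst]
      · simp [Clause.rename, Clause.subst]
      · simp [Clause.rename, Clause.subst, Atom.subst, Atom.truth, Atom.member] at heq
    · simp only [builtinClauses, List.mem_cons, List.not_mem_nil, or_false] at hb
      rcases hb with rfl | rfl | rfl
      · simp [Clause.rename, Clause.subst, Atom.subst, Atom.truth, Atom.member] at heq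
      · simp only [Clause.rename, Clause.subst, Atom.subst, Atom.member, Term.subst, List.map_cons,
          List.map_nil, Term.subst_ofList, Atom.mk.injEq, List.cons.injEq, true_and,
          and_true] at heq
        cases l with
        | nil => simp [Term.ofList] at heq
        | cons a l =>
          simp only [Term.ofList, Term.cons.injEq] at heq
          refine ⟨Or.inr (Or.inr ⟨.const a, a :: l, Or.inr ⟨a, rfl⟩, hl, ?_⟩), ?_⟩
          · simp [Atom.subst, Atom.member, heq.1, heq.2.1]
          · simp [Clause.rename, Clause.subst]
      · simp only [Clause.rename, Clause.subst, Atom.subst, Atom.member, Term.subst, List.map_cons,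
          List.map_nil, Term.subst_ofList, Atom.mk.injEq, List.cons.injEq, true_and,
          and_true] at heq
        cases l with
        | nil => simp [Term.ofList] at heq
        | cons a l =>
          simp only [Term.ofList, Term.cons.injEq] at heq
          -- a unifier that leaves `t` unchanged shows that `θ` does not bind it to a list
          have htθ : (t.subst θ).IsSimple := by
            have hfix : ∀ n ∈ t.vars, ∀ i ∈ ({0, 1, 2} : Set ℕ), ρ.symm n ≠ i := by
              rintro n hn i hi rfl
              refine Set.disjoint_left.1 hdisj (Clause.mem_vars_rename.2 ?_)
                (show n ∈ _ from ⟨t, by simp [Atom.member], hn⟩)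
              refine ⟨_, Clause.head_mem_atoms _, ?_⟩
              simp only [Set.mem_insert_iff, Set.mem_singleton_iff] at hi
              rcases hi with hi | hi | hi <;> rw [hi] <;>
                simp [Atom.vars, Atom.member, Term.vars]
            let η : ℕ → Term C := fun n =>
              if ρ.symm n = 0 then t else if ρ.symm n = 1 then .const a else
                if ρ.symm n = 2 then .ofList l else .var n
            have hη : t.subst η = t := by
              conv_rhs => rw [← Term.subst_var t]
              rw [Term.subst_eq_subst_iff]
              intro n hn
              simp [η, hfix n hn 0 (by simp), hfix n hn 1 (by simp), hfix n hn 2 (by simp)]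
            obtain ⟨τ, hτ⟩ := hθ.2 η <| by
              simp [Clause.rename, Clause.subst, Atom.subst, Atom.member, Term.subst, hη, η,
                Term.ofList]
            refine Term.isSimple_of_subst (τ := τ) ?_
            rw [Term.subst_subst, ← funext hτ]
            exact hη.symm ▸ ht
          refine ⟨Or.inr (Or.inr ⟨t.subst θ, a :: l, htθ, hl, ?_⟩), ?_⟩
          · simp [Atom.subst, Atom.member]
          · intro L hL
            obtain rfl : L = .pos (.member (t.subst θ) (.ofList l)) := by
              simpa [Clause.rename, Clause.subst, Literal.subst, Atom.subst, Atom.member,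
                Term.subst, ← heq.2.2, ← heq.1] using hL
            obtain ⟨d, hd, hd'⟩ := hl
            exact Or.inr (Or.inr ⟨_, l, htθ, ⟨d, (List.suffix_cons a l).trans hd, hd'⟩, rfl⟩)
  · have hsh : ∀ A ∈ (c.rename ρ).atoms, HasShape KB A := by
      intro A hA
      rw [Clause.atoms_rename] at hA
      obtain ⟨B, hB, rfl⟩ := List.mem_map.1 hA
      exact ((KnowledgeBase.isDatalog_of_mem hc hb hB).hasShape hc hB).rename ρ
    have hθ' := hθ.isSimple hS (hsh _ (Clause.head_mem_atoms _))
    refine ⟨hS.subst fun n _ => hθ' n, fun L hL => ?_⟩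
    obtain ⟨L, hL', rfl⟩ := List.mem_map.1 hL
    rw [Literal.atom_subst]
    exact (hsh _ (Clause.atom_mem_atoms hL')).subst fun n _ => hθ' n

theorem nodeBounded_answerResolvent {m : ℕ} {F : Forest P C} (hF : F.Sound KB.program)
    (hb : ∀ S N, (S, N) ∈ F.nodes → NodeBounded KB m N) {S : Atom P C} {N N' : Node P C}
    (hN : F.IsActive S N) (hN' : Forest.AnswerResolvent R F N N') : NodeBounded KB m N' := by
  obtain ⟨G₁, B, G₂, ⟨hG, -⟩, call, hcall, hv, H, D, hA, ρ, θ, -, hθ, rfl⟩ := hN'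
  have hs := hb S N hN.1
  have ha := hb call _ hA.1
  have hB : HasShape KB B := hs.goals (.pos B) (by simp [hG])
  have hθ' := hθ.isSimple hB (ha.head.rename ρ)
  have hret : ∀ d ∈ Forest.returnDelay (B.subst θ) call H D, d = .pos (B.subst θ) call H := by
    cases D <;> simp [Forest.returnDelay]
  refine ⟨hs.head.subst fun n _ => hθ' n, fun L hL => ?_, fun d hd => ?_,
    fun A call' ans hd => ?_, ?_⟩
  · obtain ⟨L, hL', rfl⟩ := List.mem_map.1 hL
    rw [Literal.atom_subst]
    refine (hs.goals L ?_).subst fun n _ => hθ' n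
    rw [hG]; simp only [List.mem_append, List.mem_cons] at hL' ⊢; tauto
  · rcases List.mem_append.1 hd with hd | hd
    · obtain ⟨d, hd', rfl⟩ := List.mem_map.1 hd
      rw [Delayed.atom_subst]
      exact (hs.delays d hd').subst fun n _ => hθ' n
    · rw [hret d hd]
      exact hB.subst fun n _ => hθ' n
  · rcases List.mem_append.1 hd with hd | hd
    · obtain ⟨d, hd', hd⟩ := List.mem_map.1 hd
      cases d with
      | neg A' => cases hd
      | pos A' _ _ =>
        simp only [Delayed.subst, Delayed.pos.injEq] at hd
        obtain ⟨rfl, rfl, rfl⟩ := hd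
        exact hs.answers _ _ _ hd'
    · cases hret _ hd
      exact ⟨(hF.nodes _ _ hA.1).head_lang, ha.head⟩
  · have hlen : (Forest.returnDelay (B.subst θ) call H D).length ≤ 1 := by
      cases D <;> simp [Forest.returnDelay]
    have := hs.length_le
    simp only [hG, List.length_append, List.length_map, List.length_cons] at this ⊢
    omega

theorem _root_.List.forall₂_of_map_eq {α β γ : Type*} {f : α → γ} {g : β → γ} {r : α → β → Prop}
    {l : List α} {l' : List β} (h : l.map f = l'.map g)
    (hr : ∀ a ∈ l, ∀ b ∈ l', f a = g b → r a b) : List.Forall₂ r l l' := by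
  induction l generalizing l' with
  | nil => cases l' <;> simp_all
  | cons a l ih =>
    cases l' with
    | nil => simp at h
    | cons b l' =>
      simp only [List.map_cons, List.cons.injEq] at h
      exact .cons (hr a (by simp) b (by simp) h.1) (ih h.2 fun a ha b hb =>
        hr a (List.mem_cons_of_mem _ ha) b (List.mem_cons_of_mem _ hb))

theorem Node.IsVariant.symm {N N' : Node P C} (h : N.IsVariant N') : N'.IsVariant N := by
  obtain ⟨ρ, h₁, h₂, h₃⟩ := h
  refine ⟨ρ.symm, ?_, ?_, ?_⟩
  · rw [h₁, Atom.rename_symm_rename]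
  · rw [h₂, List.map_map]
    have : Literal.rename ρ.symm ∘ Literal.rename ρ = (id : Literal P C → _) := by
      funext L
      simp [Literal.rename, Literal.subst_subst, Term.subst]
    simp [this]
  · rw [List.forall₂_map_left_iff] at h₃ ⊢
    refine h₃.flip.imp fun d' d hd => ?_
    cases d with
    | neg A =>
      cases hd
      have := Atom.rename_symm_rename ρ A
      rw [Atom.rename, Atom.rename] at this
      rw [Delayed.subst, this]
      exact .neg A
    | pos A call ans =>
      cases hd with
      | pos _ _ _ ans' hv =>
      have := Atom.rename_symm_rename ρ A
      rw [Atom.rename, Atom.rename] at this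
      rw [Delayed.subst, this]
      exact .pos A call ans' ans hv.symm

/-- Bounds on a forest: the form of its atoms and the number of literals of its nodes, and the
absence of repetitions up to renaming. -/
structure Bounded (KB : KnowledgeBase P C) (m : ℕ) (F : Forest P C) : Prop where
  sound : F.Sound KB.program
  subgoals : ∀ S ∈ F.subgoals, HasShape KB S
  eq_of_isVariant : ∀ A ∈ F.subgoals, ∀ B ∈ F.subgoals, A.IsVariant B → A = B
  nodes : ∀ S N, (S, N) ∈ F.nodes → NodeBounded KB m N
  node_eq_of_isVariant : ∀ S N N', (S, N) ∈ F.nodes → (S, N') ∈ F.nodes → N.IsVariant N' → N = N'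
  disposed_subset : F.disposed ⊆ F.nodes

/-- The number of subgoals, nodes, disposals and completions. -/
noncomputable def Forest.weight (F : Forest P C) : ℕ :=
  F.subgoals.ncard + F.nodes.ncard + F.disposed.ncard + F.completed.ncard

theorem Bounded.addNode_dispose {m : ℕ} {F : Forest P C} (hF : Bounded KB m F) {S : Atom P C}
    {N : Node P C} {U : Set (Atom P C × Node P C)} (hN : NodeBounded KB m N)
    (hU : U ⊆ F.nodes) (hs : ((F.addNode S N).dispose U).Sound KB.program) :
    Bounded KB m ((F.addNode S N).dispose U) where
  sound := hs
  subgoals := hF.subgoals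
  eq_of_isVariant := hF.eq_of_isVariant
  nodes := by
    rintro S' N' (h | ⟨h, -⟩)
    · exact hF.nodes S' N' h
    · cases h; exact hN
  node_eq_of_isVariant := by
    rintro S' N₁ N₂ (h₁ | ⟨h₁, h₁'⟩) (h₂ | ⟨h₂, h₂'⟩) hv
    · exact hF.node_eq_of_isVariant S' N₁ N₂ h₁ h₂ hv
    · cases h₂; exact (h₂' ⟨N₁, h₁, hv⟩).elim
    · cases h₁; exact (h₁' ⟨N₂, h₂, hv.symm⟩).elim
    · cases h₁; cases h₂; rfl
  disposed_subset := by
    rintro x (h | h)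
    · exact Or.inl (hF.disposed_subset h)
    · exact Or.inl (hU h)

theorem Bounded.dispose {m : ℕ} {F : Forest P C} (hF : Bounded KB m F)
    {U : Set (Atom P C × Node P C)} (hU : U ⊆ F.nodes) (hs : (F.dispose U).Sound KB.program) :
    Bounded KB m (F.dispose U) :=
  { hF with sound := hs, disposed_subset := Set.union_subset hF.disposed_subset hU }

theorem Bounded.step {m : ℕ} (hm : ∀ c ∈ KB.program, c.body.length ≤ m) {F F' : Forest P C}
    (hF : Bounded KB m F) (h : Forest.Step KB.program R F F') : Bounded KB m F' := by
  have hsound := hF.sound.step h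
  cases h with
  | newSubgoal S N G₁ G₂ L hS hN hsel hL hnew =>
    refine { hF with sound := hsound, subgoals := ?_, eq_of_isVariant := ?_ }
    · rintro S' (rfl | hS')
      · exact (hF.nodes S N hN.1).goals L (by simp [hsel.1])
      · exact hF.subgoals S' hS'
    · rintro A (rfl | hA) B (rfl | hB) hv
      · rfl
      · exact (hnew B hB hv).elim
      · exact (hnew A hA hv.symm).elim
      · exact hF.eq_of_isVariant A hA B hB hv
  | clauseResolution S N hSF hS hres hnew =>
    have := hF.addNode_dispose (U := ∅) (S := S)
      (nodeBounded_clauseResolvent hm (hF.subgoals S hSF) hres) (Set.empty_subset _)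
      (by simpa [Forest.dispose] using hsound)
    simpa [Forest.dispose] using this
  | positiveReturn S N N' hS hN hres hnew =>
    have := hF.addNode_dispose (U := ∅) (S := S)
      (nodeBounded_answerResolvent hF.sound hF.nodes hN hres) (Set.empty_subset _)
      (by simpa [Forest.dispose] using hsound)
    simpa [Forest.dispose] using this
  | negationSuccess S N G₁ G₂ A hS hN hsel hA hf =>
    have hb := hF.nodes S N hN.1
    refine hF.addNode_dispose ⟨hb.head, fun L hL => hb.goals L ?_, hb.delays, hb.answers, ?_⟩
      (Set.singleton_subset_iff.2 hN.1) hsound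
    · rw [hsel.1]; simp only [List.mem_append, List.mem_cons] at hL ⊢; tauto
    · have := hb.length_le
      simp only [hsel.1, List.length_append, List.length_cons] at this ⊢
      omega
  | negationFailure S N G₁ G₂ A hS hN hsel hA hs =>
    exact hF.dispose (Set.singleton_subset_iff.2 hN.1) hsound
  | delaying S N G₁ G₂ A hS hN hsel hA hAF hf hs =>
    have hb := hF.nodes S N hN.1
    refine hF.addNode_dispose ⟨hb.head, fun L hL => hb.goals L ?_, fun d hd => ?_,
      fun A' call ans hd => ?_, ?_⟩ (Set.singleton_subset_iff.2 hN.1) hsound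
    · rw [hsel.1]; simp only [List.mem_append, List.mem_cons] at hL ⊢; tauto
    · rcases List.mem_append.1 hd with hd | hd
      · exact hb.delays d hd
      · obtain rfl := List.mem_singleton.1 hd
        exact hF.subgoals A hAF
    · rcases List.mem_append.1 hd with hd | hd
      · exact hb.answers A' call ans hd
      · cases List.mem_singleton.1 hd
    · have := hb.length_le
      simp only [hsel.1, List.length_append, List.length_cons, List.length_nil] at this ⊢
      omega
  | simplifySuccess S H D₁ D₂ d hN hd =>
    have hb := hF.nodes S _ hN.1
    have hmem : ∀ d' ∈ D₁ ++ D₂, d' ∈ D₁ ++ d :: D₂ := fun d' hd' => by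
      simp only [List.mem_append, List.mem_cons] at hd' ⊢; tauto
    refine hF.addNode_dispose ⟨hb.head, hb.goals, fun d' hd' => hb.delays d' (hmem d' hd'),
      fun A call ans hA => hb.answers A call ans (hmem _ hA), ?_⟩
      (Set.singleton_subset_iff.2 hN.1) hsound
    have := hb.length_le
    simp only [List.length_append, List.length_cons] at this ⊢
    omega
  | simplifyFailure S H D d hN hdD hd =>
    exact hF.dispose (Set.singleton_subset_iff.2 hN.1) hsound
  | completion E hne hE hnc hev => exact { hF with sound := hsound }
  | answerCompletion U hne hU =>
    exact hF.dispose (fun x hx => (hU x.1 x.2 hx).2.1.1) hsound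

/-- Every operation enlarges one of the components of the forest. -/
theorem Forest.Step.growth {prog : List (Clause P C)} {F F' : Forest P C}
    (h : Forest.Step prog R F F') :
    (F.subgoals ⊆ F'.subgoals ∧ F.nodes ⊆ F'.nodes ∧ F.disposed ⊆ F'.disposed ∧
      F.completed ⊆ F'.completed) ∧
    (F.subgoals ≠ F'.subgoals ∨ F.nodes ≠ F'.nodes ∨ F.disposed ≠ F'.disposed ∨
      F.completed ≠ F'.completed) := by
  have ne {α : Type _} {s t : Set α} (x : α) (hs : x ∉ s) (ht : x ∈ t) : s ≠ t := by
    rintro rfl; exact hs ht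
  have hdisp {U : Set (Atom P C × Node P C)} {S : Atom P C} {N : Node P C} (hN : F.IsActive S N)
      (hU : (S, N) ∈ U) : F.disposed ≠ F.disposed ∪ U := ne _ hN.2 (Or.inr hU)
  cases h with
  | newSubgoal S N G₁ G₂ L hS hN hsel hL hnew =>
    exact ⟨⟨Set.subset_insert _ _, subset_rfl, subset_rfl, subset_rfl⟩,
      Or.inl (ne L.atom (fun h => hnew _ h (.refl _)) (Or.inl rfl))⟩
  | clauseResolution S N hSF hS hres hnew =>
    exact ⟨⟨subset_rfl, Set.subset_union_left, subset_rfl, subset_rfl⟩,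
      Or.inr (Or.inl (ne (S, N) (fun h => hnew (Forest.hasNode_of_mem h)) (Or.inr ⟨rfl, hnew⟩)))⟩
  | positiveReturn S N N' hS hN hres hnew =>
    exact ⟨⟨subset_rfl, Set.subset_union_left, subset_rfl, subset_rfl⟩,
      Or.inr (Or.inl (ne (S, N') (fun h => hnew (Forest.hasNode_of_mem h)) (Or.inr ⟨rfl, hnew⟩)))⟩
  | negationSuccess S N G₁ G₂ A hS hN hsel hA hf =>
    exact ⟨⟨subset_rfl, Set.subset_union_left, Set.subset_union_left, subset_rfl⟩,
      Or.inr (Or.inr (Or.inl (hdisp hN rfl)))⟩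
  | negationFailure S N G₁ G₂ A hS hN hsel hA hs =>
    exact ⟨⟨subset_rfl, subset_rfl, Set.subset_union_left, subset_rfl⟩,
      Or.inr (Or.inr (Or.inl (hdisp hN rfl)))⟩
  | delaying S N G₁ G₂ A hS hN hsel hA hAF hf hs =>
    exact ⟨⟨subset_rfl, Set.subset_union_left, Set.subset_union_left, subset_rfl⟩,
      Or.inr (Or.inr (Or.inl (hdisp hN rfl)))⟩
  | simplifySuccess S H D₁ D₂ d hN hd =>
    exact ⟨⟨subset_rfl, Set.subset_union_left, Set.subset_union_left, subset_rfl⟩,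
      Or.inr (Or.inr (Or.inl (hdisp hN rfl)))⟩
  | simplifyFailure S H D d hN hdD hd =>
    exact ⟨⟨subset_rfl, subset_rfl, Set.subset_union_left, subset_rfl⟩,
      Or.inr (Or.inr (Or.inl (hdisp hN rfl)))⟩
  | completion E hne hE hnc hev =>
    obtain ⟨S, hS⟩ := hne
    exact ⟨⟨subset_rfl, subset_rfl, subset_rfl, Set.subset_union_left⟩,
      Or.inr (Or.inr (Or.inr (ne S (hnc S hS) (Or.inr hS))))⟩
  | answerCompletion U hne hU =>
    obtain ⟨x, hx⟩ := hne
    exact ⟨⟨subset_rfl, subset_rfl, Set.subset_union_left, subset_rfl⟩,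
      Or.inr (Or.inr (Or.inl (hdisp (hU x.1 x.2 hx).2.1 hx)))⟩

end Bounded

/-! ### Termination -/

section Termination

variable {P C : Type*} {KB : KnowledgeBase P C} {R : ComputationRule P C}

theorem encard_setOf_exists_mem_le {α : Type*} (l : List α) (f : α → Set ℕ) (w : ℕ)
    (h : ∀ a ∈ l, (f a).encard ≤ w) : {n | ∃ a ∈ l, n ∈ f a}.encard ≤ (l.length * w : ℕ) := by
  induction l with
  | nil => simp
  | cons a l ih =>
    have : {n | ∃ b ∈ a :: l, n ∈ f b} = f a ∪ {n | ∃ b ∈ l, n ∈ f b} := by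
      ext; simp
    rw [this]
    refine (Set.encard_union_le _ _).trans ?_
    calc _ ≤ (w : ℕ∞) + (l.length * w : ℕ) :=
          add_le_add (h a (by simp)) (ih fun b hb => h b (List.mem_cons_of_mem _ hb))
      _ = _ := by rw [← Nat.cast_add]; congr 1; simp [Nat.succ_mul, add_comm]

theorem HasShape.encard_vars_le {A : Atom P C} (h : HasShape KB A) :
    A.vars.encard ≤ (A.args.length : ℕ) := by
  have hs {t : Term C} (ht : t.IsSimple) : t.vars.encard ≤ (1 : ℕ) := by
    rcases ht with ⟨n, rfl⟩ | ⟨c, rfl⟩ <;> simp [Term.vars]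
  have := encard_setOf_exists_mem_le A.args Term.vars 1 fun t ht => by
    rcases h with ⟨p, -, h⟩ | rfl | ⟨s, l, h, -, rfl⟩
    · exact hs (h t ht)
    · simp [Atom.truth] at ht
    · simp only [Atom.member, List.mem_cons, List.not_mem_nil, or_false] at ht
      rcases ht with rfl | rfl
      · exact hs h
      · simp
  rwa [mul_one] at this

/-- A set of at most `V` variables can be renamed into the first `V` variables. -/
theorem exists_perm_lt {s : Set ℕ} {V : ℕ} (h : s.encard ≤ V) :
    ∃ ρ : Equiv.Perm ℕ, ∀ n ∈ s, ρ n < V := by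
  have hfin : s.Finite := Set.finite_of_encard_le_coe h
  obtain ⟨t, rfl⟩ := hfin.exists_finset_coe
  rw [Set.encard_coe_eq_coe_finsetCard, Nat.cast_le] at h
  have := Equiv.Perm.isMultiplyPretransitive ℕ t.card
  obtain ⟨ρ, hρ⟩ := MulAction.exists_smul_eq (Equiv.Perm ℕ)
    (t.orderEmbOfFin rfl).toEmbedding (Fin.valEmbedding (n := t.card))
  refine ⟨ρ, fun n hn => ?_⟩
  have hn' : n ∈ Set.range (t.orderEmbOfFin rfl) := by rwa [Finset.range_orderEmbOfFin]
  obtain ⟨i, rfl⟩ := hn'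
  have : ρ (t.orderEmbOfFin rfl i) = i := congrArg (fun f => f i) hρ
  rw [this]
  exact i.2.trans_le h

/-- The atoms of the evaluation whose variables are among the first `V`. -/
def canonicalAtoms (KB : KnowledgeBase P C) (V : ℕ) : Set (Atom P C) :=
  {A | InLanguage KB.program A ∧ HasShape KB A ∧ ∀ n ∈ A.vars, n < V}

theorem finite_canonicalAtoms (KB : KnowledgeBase P C) (V : ℕ) :
    (canonicalAtoms KB V).Finite := by
  refine (KnowledgeBase.finite_atoms (KnowledgeBase.finite_progSyms KB.program)
    ((((Set.finite_lt_nat V).image Term.var).union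
      ((KnowledgeBase.finite_progConsts KB.program).image Term.const)).union
      (KB.finite_doms.image Term.ofList))).subset ?_
  rintro A ⟨hl, hs, hV⟩
  have hsimple {t : Term C} (ht : t ∈ A.args) (h : t.IsSimple) :
      t ∈ Term.var '' {n | n < V} ∪ Term.const '' progConsts KB.program ∪
        Term.ofList '' KB.doms := by
    rcases h with ⟨n, rfl⟩ | ⟨c, rfl⟩
    · exact Or.inl (Or.inl ⟨n, hV n ⟨_, ht, rfl⟩, rfl⟩)
    · exact Or.inl (Or.inr ⟨c, hl.2 ⟨_, ht, rfl⟩, rfl⟩)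
  refine ⟨hl.1, fun t ht => ?_⟩
  rcases hs with ⟨p, -, h⟩ | rfl | ⟨s, l, h, hl', rfl⟩
  · exact hsimple ht (h t ht)
  · simp [Atom.truth] at ht
  · rcases (by simpa [Atom.member] using ht : t = s ∨ t = .ofList l) with rfl | rfl
    · exact hsimple ht h
    · exact Or.inr ⟨l, hl', rfl⟩

/-- The nodes with at most `m` literals whose atoms belong to `T`. -/
def nodesOver (T : Set (Atom P C)) (m : ℕ) : Set (Node P C) :=
  {N | N.head ∈ T ∧ (N.delays.length ≤ m ∧ ∀ d ∈ N.delays, d ∈ Delayed.neg '' T ∪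
      (fun x : Atom P C × Atom P C × Atom P C => Delayed.pos x.1 x.2.1 x.2.2) '' (T ×ˢ T ×ˢ T)) ∧
    (N.goals.length ≤ m ∧ ∀ L ∈ N.goals, L ∈ Literal.pos '' T ∪ Literal.neg '' T)}

theorem finite_nodesOver {T : Set (Atom P C)} (hT : T.Finite) (m : ℕ) :
    (nodesOver T m).Finite := by
  have h₁ := (((hT.image Delayed.neg).union ((hT.prod (hT.prod hT)).image
    fun x : Atom P C × Atom P C × Atom P C => Delayed.pos x.1 x.2.1 x.2.2))).lists_length_le m
  have h₂ := ((hT.image Literal.pos).union (hT.image Literal.neg)).lists_length_le m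
  refine ((hT.prod (h₁.prod h₂)).image fun x : Atom P C × List (Delayed P C) × List (Literal P C) =>
    (⟨x.1, x.2.1, x.2.2⟩ : Node P C)).subset ?_
  rintro N ⟨hh, hd, hg⟩
  exact ⟨(N.head, N.delays, N.goals), ⟨hh, hd, hg⟩, rfl⟩

/-- Renaming of the variables of a node by `ρ`, with representatives `rep` of table entries. -/
def Node.encode (rep : Atom P C → Atom P C) (ρ : Equiv.Perm ℕ) (N : Node P C) : Node P C where
  head := N.head.rename ρ
  delays := N.delays.map fun
    | .neg A => .neg (A.rename ρ)
    | .pos A call ans => .pos (A.rename ρ) (rep call) (rep ans)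
  goals := N.goals.map (Literal.rename ρ)

theorem Atom.rename_trans_symm_of_eq {A B : Atom P C} {ρ ρ' : Equiv.Perm ℕ}
    (h : A.rename ρ = B.rename ρ') : B = A.rename (ρ.trans ρ'.symm) := by
  rw [← rename_rename, h, rename_symm_rename]

theorem Literal.rename_trans_symm_of_eq {L L' : Literal P C} {ρ ρ' : Equiv.Perm ℕ}
    (h : L.rename ρ = L'.rename ρ') : L' = L.rename (ρ.trans ρ'.symm) := by
  cases L <;> cases L' <;> first
    | exact congrArg _ (Atom.rename_trans_symm_of_eq (by injection h))
    | cases h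

/-- Nodes with the same code are equal up to renaming. -/
theorem Node.isVariant_of_encode_eq {rep : Atom P C → Atom P C} {ρ ρ' : Equiv.Perm ℕ}
    {N N' : Node P C} (h : N.encode rep ρ = N'.encode rep ρ')
    (hcall : ∀ A call ans A' call' ans', .pos A call ans ∈ N.delays →
      .pos A' call' ans' ∈ N'.delays → rep call = rep call' → rep ans = rep ans' →
      call = call' ∧ ans.IsVariant ans') : N.IsVariant N' := by
  obtain ⟨h₁, h₂, h₃⟩ := Node.mk.inj h
  refine ⟨ρ.trans ρ'.symm, Atom.rename_trans_symm_of_eq h₁, ?_, ?_⟩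
  · have := List.forall₂_of_map_eq h₃ (r := fun L L' => L' = L.rename (ρ.trans ρ'.symm))
      fun L _ L' _ h => Literal.rename_trans_symm_of_eq h
    rw [← List.forall₂_eq_eq_eq, List.forall₂_map_right_iff]
    exact this.flip
  · rw [List.forall₂_map_left_iff]
    refine List.forall₂_of_map_eq h₂ fun d hd d' hd' h => ?_
    cases d with
    | neg A =>
      cases d' with
      | neg A' =>
        rw [Atom.rename_trans_symm_of_eq (Delayed.neg.inj h)]
        exact .neg _
      | pos => cases h
    | pos A call ans =>
      cases d' with
      | neg => cases h
      | pos A' call' ans' =>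
        obtain ⟨h₁, h₂, h₃⟩ := Delayed.pos.inj h
        obtain ⟨rfl, hv⟩ := hcall _ _ _ _ _ _ hd hd' h₂ h₃
        rw [Atom.rename_trans_symm_of_eq h₁]
        exact .pos _ _ _ _ hv

theorem exists_width (KB : KnowledgeBase P C) :
    ∃ w : ℕ, ∀ A : Atom P C, InLanguage KB.program A → A.args.length ≤ w := by
  obtain ⟨w, hw⟩ := ((KnowledgeBase.finite_progSyms KB.program).image Prod.snd).bddAbove
  exact ⟨w, fun A hA => hw ⟨_, hA.1, rfl⟩⟩

/-- The forests of an evaluation have bounded weight, because up to renaming only finitely many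
subgoals and nodes are possible. -/
theorem exists_weight_le (KB : KnowledgeBase P C) (m : ℕ) : ∃ M, ∀ F, Bounded KB m F →
    F.subgoals.Finite ∧ F.nodes.Finite ∧ F.weight ≤ M := by
  obtain ⟨w, hw⟩ := exists_width KB
  set V := w + m * w + m * w with hV
  set T := canonicalAtoms KB V with hT
  have hTfin : T.Finite := finite_canonicalAtoms KB V
  have hcanon {A : Atom P C} (hl : InLanguage KB.program A) (hs : HasShape KB A)
      {ρ : Equiv.Perm ℕ} (hρ : ∀ n ∈ A.vars, ρ n < V) : A.rename ρ ∈ T := by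
    refine ⟨hl.rename ρ, hs.rename ρ, fun n hn => ?_⟩
    simpa using hρ _ (Atom.mem_vars_rename.1 hn)
  have hcard {A : Atom P C} (hl : InLanguage KB.program A) (hs : HasShape KB A) :
      A.vars.encard ≤ w := hs.encard_vars_le.trans (Nat.cast_le.2 (hw A hl))
  have hrep : ∀ A : Atom P C, ∃ B, InLanguage KB.program A → HasShape KB A →
      A.IsVariant B ∧ B ∈ T := by
    intro A
    by_cases h : InLanguage KB.program A ∧ HasShape KB A
    · obtain ⟨ρ, hρ⟩ := exists_perm_lt ((hcard h.1 h.2).trans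
        (Nat.cast_le.2 (show w ≤ V by omega)))
      exact ⟨A.rename ρ, fun _ _ => ⟨⟨ρ, rfl⟩, hcanon h.1 h.2 hρ⟩⟩
    · exact ⟨A, fun h₁ h₂ => (h ⟨h₁, h₂⟩).elim⟩
  choose rep hrep using hrep
  have hrep_inj {A B : Atom P C} (hA : InLanguage KB.program A) (hA' : HasShape KB A)
      (hB : InLanguage KB.program B) (hB' : HasShape KB B) (h : rep A = rep B) :
      A.IsVariant B := by
    have h₁ := (hrep A hA hA').1
    rw [h] at h₁
    exact h₁.trans (hrep B hB hB').1.symm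
  have hρ : ∀ N : Node P C, ∃ ρ : Equiv.Perm ℕ, N.vars.encard ≤ V → ∀ n ∈ N.vars, ρ n < V := by
    intro N
    by_cases h : N.vars.encard ≤ V
    · obtain ⟨ρ, hρ⟩ := exists_perm_lt h
      exact ⟨ρ, fun _ => hρ⟩
    · exact ⟨1, fun h' => (h h').elim⟩
  choose ρ hρ using hρ
  set code : Atom P C × Node P C → Atom P C × Node P C :=
    fun x => (rep x.1, x.2.encode rep (ρ x.2)) with hcode
  have hNfin : (T ×ˢ nodesOver T m).Finite := hTfin.prod (finite_nodesOver hTfin m)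
  refine ⟨T.ncard + (T ×ˢ nodesOver T m).ncard + (T ×ˢ nodesOver T m).ncard + T.ncard,
    fun F hF => ?_⟩
  have hrep_eq {A B : Atom P C} (hA : A ∈ F.subgoals) (hB : B ∈ F.subgoals)
      (h : rep A = rep B) : A = B :=
    hF.eq_of_isVariant A hA B hB (hrep_inj (hF.sound.subgoals_lang A hA) (hF.subgoals A hA)
      (hF.sound.subgoals_lang B hB) (hF.subgoals B hB) h)
  have hsub : Set.MapsTo rep F.subgoals T := fun A hA =>
    (hrep A (hF.sound.subgoals_lang A hA) (hF.subgoals A hA)).2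
  have hsub_inj : Set.InjOn rep F.subgoals := fun A hA B hB h => hrep_eq hA hB h
  have hnodes : Set.MapsTo code F.nodes (T ×ˢ nodesOver T m) := by
    rintro ⟨S, N⟩ hN
    have hs := hF.sound.nodes S N hN
    have hb := hF.nodes S N hN
    have hlen := hb.length_le
    have hvars : N.vars.encard ≤ V := by
      refine (Set.encard_union_le _ _).trans ?_
      rw [hV, Nat.cast_add]
      refine add_le_add ((Set.encard_union_le _ _).trans ?_) ?_
      · rw [Nat.cast_add]
        refine add_le_add (hcard hs.head_lang hb.head) ?_
        refine (encard_setOf_exists_mem_le N.delays (fun d => d.atom.vars) w fun d hd =>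
          hcard (hs.delays_lang d hd) (hb.delays d hd)).trans ?_
        exact Nat.cast_le.2 (Nat.mul_le_mul_right w (by omega))
      · refine (encard_setOf_exists_mem_le N.goals (fun L => L.atom.vars) w fun L hL =>
          hcard (hs.goals_lang L hL) (hb.goals L hL)).trans ?_
        exact Nat.cast_le.2 (Nat.mul_le_mul_right w (by omega))
    have hρN := hρ N hvars
    refine ⟨hsub hs.subgoal, hcanon hs.head_lang hb.head fun n hn => hρN n (Or.inl (Or.inl hn)),
      ⟨by simp only [hcode, Node.encode, List.length_map]; omega, fun d hd => ?_⟩,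
      ⟨by simp only [hcode, Node.encode, List.length_map]; omega, fun L hL => ?_⟩⟩
    · obtain ⟨d, hd', rfl⟩ := List.mem_map.1 hd
      have hA := hcanon (hs.delays_lang d hd') (hb.delays d hd') fun n hn =>
        hρN n (Or.inl (Or.inr ⟨d, hd', hn⟩))
      cases d with
      | neg A => exact Or.inl ⟨_, hA, rfl⟩
      | pos A call ans =>
        have hc := (hs.delays_pos A call ans hd').1
        have ha := hb.answers A call ans hd'
        exact Or.inr ⟨(_, _, _), ⟨hA, hsub hc, (hrep ans ha.1 ha.2).2⟩, rfl⟩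
    · obtain ⟨L, hL', rfl⟩ := List.mem_map.1 hL
      have hA := hcanon (hs.goals_lang L hL') (hb.goals L hL') fun n hn =>
        hρN n (Or.inr ⟨L, hL', hn⟩)
      cases L with
      | pos A => exact Or.inl ⟨_, hA, rfl⟩
      | neg A => exact Or.inr ⟨_, hA, rfl⟩
  have hnodes_inj : Set.InjOn code F.nodes := by
    rintro ⟨S, N⟩ hN ⟨S', N'⟩ hN' h
    obtain ⟨h₁, h₂⟩ := Prod.mk.inj h
    have hs := hF.sound.nodes S N hN
    have hs' := hF.sound.nodes S' N' hN'
    obtain rfl := hrep_eq hs.subgoal hs'.subgoal h₁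
    have hv : N.IsVariant N' := Node.isVariant_of_encode_eq h₂
      fun A call ans A' call' ans' hd hd' hc ha => by
        have hans := (hF.nodes S N hN).answers A call ans hd
        have hans' := (hF.nodes S N' hN').answers A' call' ans' hd'
        exact ⟨hrep_eq (hs.delays_pos A call ans hd).1 (hs'.delays_pos A' call' ans' hd').1 hc,
          hrep_inj hans.1 hans.2 hans'.1 hans'.2 ha⟩
    rw [hF.node_eq_of_isVariant S N N' hN hN' hv]
  have hsfin : F.subgoals.Finite := .of_injOn hsub hsub_inj hTfin
  have hnfin : F.nodes.Finite := .of_injOn hnodes hnodes_inj hNfin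
  have h₁ := Set.ncard_le_ncard_of_injOn rep hsub hsub_inj hTfin
  have h₂ := Set.ncard_le_ncard_of_injOn code hnodes hnodes_inj hNfin
  have h₃ := Set.ncard_le_ncard hF.disposed_subset hnfin
  have h₄ := Set.ncard_le_ncard hF.sound.completed_subset hsfin
  refine ⟨hsfin, hnfin, ?_⟩
  unfold Forest.weight
  omega

theorem Bounded.acc {m : ℕ} (hm : ∀ c ∈ KB.program, c.body.length ≤ m) {F : Forest P C}
    (hF : Bounded KB m F) : Acc (flip (Forest.Step KB.program R)) F := by
  obtain ⟨M, hM⟩ := exists_weight_le KB m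
  induction h : M - F.weight using Nat.strong_induction_on generalizing F with
  | _ k ih =>
  refine ⟨F, fun F' hstep => ?_⟩
  have hF' := hF.step hm hstep
  obtain ⟨hs, hn, hw⟩ := hM F' hF'
  have hd := hn.subset hF'.disposed_subset
  have hc := hs.subset hF'.sound.completed_subset
  refine ih (M - F'.weight) ?_ hF' rfl
  obtain ⟨⟨s₁, s₂, s₃, s₄⟩, hne⟩ := Forest.Step.growth hstep
  have n₁ := Set.ncard_le_ncard s₁ hs
  have n₂ := Set.ncard_le_ncard s₂ hn
  have n₃ := Set.ncard_le_ncard s₃ hd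
  have n₄ := Set.ncard_le_ncard s₄ hc
  suffices hlt : F.weight < F'.weight by omega
  unfold Forest.weight
  by_contra hge
  rcases hne with h | h | h | h
  · exact h (Set.eq_of_subset_of_ncard_le s₁ (by omega) hs)
  · exact h (Set.eq_of_subset_of_ncard_le s₂ (by omega) hn)
  · exact h (Set.eq_of_subset_of_ncard_le s₃ (by omega) hd)
  · exact h (Set.eq_of_subset_of_ncard_le s₄ (by omega) hc)

theorem Bounded.init (KB : KnowledgeBase P C) (m : ℕ) {s : Pred P × ℕ} (hs : s ∈ KB.headSyms) :
    Bounded KB m (.init (goalAtom s)) where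
  sound := .init (KnowledgeBase.inLanguage_goalAtom hs)
  subgoals := by
    rintro _ rfl
    obtain ⟨c, hc, rfl⟩ := hs
    obtain ⟨p, hp, -⟩ := KnowledgeBase.exists_user_of_mem hc List.mem_cons_self
    refine Or.inl ⟨p, hp, fun t ht => ?_⟩
    obtain ⟨n, -, rfl⟩ := List.mem_map.1 ht
    exact Or.inl ⟨n, rfl⟩
  eq_of_isVariant := by rintro _ rfl _ rfl -; rfl
  nodes _ _ h := h.elim
  node_eq_of_isVariant _ _ _ h := h.elim
  disposed_subset := subset_rfl

/-- SLG-resolution terminates for the goals of the algorithm. -/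
theorem acc_init (KB : KnowledgeBase P C) (R : ComputationRule P C) {s : Pred P × ℕ}
    (hs : s ∈ KB.headSyms) : Acc (flip (Forest.Step KB.program R)) (.init (goalAtom s)) := by
  obtain ⟨m, hm⟩ := ((List.finite_toSet KB.program).image fun c => c.body.length).bddAbove
  exact (Bounded.init KB m hs).acc fun c hc => hm ⟨c, hc, rfl⟩

theorem KnowledgeBase.finite_headSyms (KB : KnowledgeBase P C) : KB.headSyms.Finite :=
  ((List.finite_toSet KB.PB).image fun c => c.head.sym).subset fun _ ⟨c, hc, h⟩ => ⟨c, hc, h⟩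

theorem acc_eval (KB : KnowledgeBase P C) (R : ComputationRule P C) {s : Pred P × ℕ}
    {todo : Set (Pred P × ℕ)} (htodo : ∀ out, Acc (flip (AlgStep KB R)) (.ready todo out))
    {F : Forest P C} (hF : Acc (flip (Forest.Step KB.program R)) F) (out : Set (Atom P C)) :
    Acc (flip (AlgStep KB R)) (.eval s F todo out) := by
  induction hF with
  | intro F _ ih =>
    refine ⟨_, fun t ht => ?_⟩
    cases ht with
    | slg _ _ F' _ _ hF => exact ih F' hF
    | collect => exact htodo _

/-- The algorithm terminates: the set of goals still to be computed decreases. -/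
theorem acc_ready (KB : KnowledgeBase P C) (R : ComputationRule P C) {todo : Set (Pred P × ℕ)}
    (htodo : todo ⊆ KB.headSyms) (out : Set (Atom P C)) :
    Acc (flip (AlgStep KB R)) (.ready todo out) := by
  have hfin := KB.finite_headSyms.subset htodo
  induction h : todo.ncard using Nat.strong_induction_on generalizing todo out with
  | _ k ih =>
    refine ⟨_, fun t ht => ?_⟩
    cases ht with
    | start s _ _ hs =>
      have hsub : todo \ {s} ⊆ todo := Set.sdiff_subset
      refine acc_eval KB R (fun out' => ih _ ?_ (hsub.trans htodo) out' (hfin.subset hsub) rfl)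
        (acc_init KB R (htodo hs)) out
      rw [← h]
      exact Set.ncard_sdiff_singleton_lt_of_mem hs hfin

theorem not_exists_infinite_run {α : Type*} {r : α → α → Prop} {a : α} (h : Acc (flip r) a) :
    ¬ ∃ f : ℕ → α, f 0 = a ∧ ∀ n, r (f n) (f (n + 1)) := by
  induction h with
  | intro a _ ih =>
    rintro ⟨f, rfl, hf⟩
    exact ih (f 1) (hf 0) ⟨fun n => f (n + 1), rfl, fun n => hf (n + 1)⟩

end Termination

/-! ### Correctness of the algorithm -/

section Correctness

variable {P C : Type*}

/-- The states reached by the algorithm: the atoms collected so far are the random variables whose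
predicates have been treated. -/
inductive Reached (KB : KnowledgeBase P C) (R : ComputationRule P C) : AlgState P C → Prop
  | ready (todo : Set (Pred P × ℕ)) (h : todo ⊆ KB.headSyms) :
      Reached KB R (.ready todo {A ∈ KB.space | A.sym ∉ todo})
  | eval (s : Pred P × ℕ) (F : Forest P C) (todo : Set (Pred P × ℕ)) (hs : s ∈ todo)
      (h : todo ⊆ KB.headSyms)
      (hF : Relation.ReflTransGen (Forest.Step KB.program R) (.init (goalAtom s)) F) :
      Reached KB R (.eval s F (todo \ {s}) {A ∈ KB.space | A.sym ∉ todo})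

theorem Reached.start (KB : KnowledgeBase P C) (R : ComputationRule P C) :
    Reached KB R KB.start := by
  have h : {A ∈ KB.space | A.sym ∉ KB.headSyms} = ∅ :=
    Set.eq_empty_of_forall_notMem fun A hA => hA.2 (KnowledgeBase.mem_space_iff.1 hA.1).2
  have := Reached.ready (R := R) KB.headSyms subset_rfl
  rwa [h] at this

theorem Reached.step {KB : KnowledgeBase P C} {R : ComputationRule P C} {t t' : AlgState P C}
    (ht : Reached KB R t) (h : AlgStep KB R t t') : Reached KB R t' := by
  cases ht with
  | ready todo htodo =>
    cases h with
    | start s _ _ hs => exact .eval s _ todo hs htodo .refl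
  | eval s F todo hs htodo hF =>
    cases h with
    | slg _ _ F' _ _ hF' => exact .eval s F' todo hs htodo (hF.tail hF')
    | collect _ _ _ _ hfin hnf =>
      rw [KnowledgeBase.table_eq (htodo hs) hF hfin hnf]
      have : {A ∈ KB.space | A.sym ∉ todo} ∪ {A ∈ KB.space | A.sym = s} =
          {A ∈ KB.space | A.sym ∉ todo \ {s}} := by
        ext A
        simp only [Set.mem_union, Set.mem_ofPred_eq, Set.mem_sdiff, Set.mem_singleton_iff]
        tauto
      rw [this]
      exact .ready _ (Set.sdiff_subset.trans htodo)

end Correctness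

end BKB

theorem mainTheorem4 {P C : Type*} (KB : BKB.KnowledgeBase P C) (R : BKB.ComputationRule P C) :
    -- the algorithm terminates: it has no infinite run
    (¬ ∃ st : ℕ → BKB.AlgState P C,
        st 0 = KB.start ∧ ∀ n, BKB.AlgStep KB R (st n) (st (n + 1))) ∧
    -- every run that has come to its end, and does not flounder, returns the space of random
    -- variables, which is finite
    (∀ t : BKB.AlgState P C, Relation.ReflTransGen (BKB.AlgStep KB R) KB.start t →
        (∀ t', ¬ BKB.AlgStep KB R t t') → ¬ t.Flounders R →
        ∃ out : Set (BKB.Atom P C), t = .ready ∅ out ∧ out.Finite ∧ out = KB.space) := by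
  refine ⟨BKB.not_exists_infinite_run (BKB.acc_ready KB R subset_rfl ∅), ?_⟩
  intro t hrun hend hnf
  have ht : BKB.Reached KB R t := by
    clear hend hnf
    induction hrun with
    | refl => exact .start KB R
    | tail _ h ih => exact ih.step h
  cases ht with
  | ready todo htodo =>
    obtain rfl : todo = ∅ := Set.eq_empty_of_forall_notMem fun s hs => hend _ (.start s todo _ hs)
    simp only [Set.mem_empty_iff_false, not_false_eq_true, and_true]
    exact ⟨_, rfl, KB.finite_space, rfl⟩
  | eval s F todo hs htodo hF =>
    exact (hend _ (.collect s F _ _ (fun F' h => hend _ (.slg s F F' _ _ h)) hnf)).elim
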